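/- Fix $\Lambda>0$. Let $M=[0,1)_\tau\times\mathbb S^3$, $M^\circ=(0,1)_\tau\times\mathbb S^3$, $\partial M=\{\tau=0\}=\mathbb S^3\subset\mathbb R^4$, with the de Sitter metric $$g_{dS}=\tfrac{3}{\Lambda}\tau^{-2}\bigl(-(1-\tau^2)^{-1}d\tau^2+g_{\mathbb S^3}\bigr).$$ For $p\in\mathbb S^3$ and $\mathfrak m\in\mathbb R$ let $g_{p,\mathfrak m}$ be the Schwarzschild--de Sitter metric $$g_{p,\mathfrak m}=-F^{-1}dr^2+F\,dt^2+r^2g_{\mathbb S^2},\qquad F=\tfrac{\Lambda r^2}{3}-1+\tfrac{2\mathfrak m}{r},$$ defined on the points of $M^\circ$ in a neighborhood of $\mathbb S^3\setminus\{p,-p\}\subset\partial M$, where, for $(\tau,\psi)\in M^\circ$, $$\tilde\tau=\frac{\tau}{\sqrt{1-\tau^2}+\langle p,\psi\rangle},\qquad \tilde x=\frac{\psi-\langle p,\psi\rangle p}{\sqrt{1-\tau^2}+\langle p,\psi\rangle}\in p^\perp\cong\mathbb R^3$$ are the upper half space coordinates of de Sitter space centered at $p$, and $$t=-\tfrac12\sqrt{3/\Lambda}\,\log(|\tilde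 x|^2-\tilde\tau^2),\qquad r=\sqrt{3/\Lambda}\,\frac{|\tilde x|}{\tilde\tau},\qquad \omega=\frac{\tilde x}{|\tilde x|}\in\mathbb S^2;$$ thus $g_{p,0}=g_{dS}$. For an open subset $U$ of $M$, let $C^\infty(U;S^2\,{}^0T^*M)$ be the space of symmetric 2-tensors $u$ on $U\cap M^\circ$ such that $\tau^2u$ extends to a smooth symmetric 2-tensor on $U$ (smooth up to $U\cap\partial M$). Let $\mathcal A^\alpha(U;S^2\,{}^0T^*M)$ be the space of smooth symmetric 2-tensors $u$ on $U\cap M^\circ$ such that, for all $k\ge 0$ and all smooth vector fields $Y_1,\dots,Y_k$ on $M$ tangent to $\partial M$, the derivative $Y_1\cdots Y_k(\tau^{-\alpha}\tau^2u)$, taken on the coefficients with respect to a frame that is smooth up to $\partial M$, is bounded on $K\cap M^\circ$ for every compact $K\subset U$. **Theorem.** Let $(p_1,\mathfrak m_1),\dots,(p_N,\mathfrak m_N)\in\mathbb S^3\times\mathbb R$, with the $p_i$ pairwise distinct. Let $V_i\subset\mathbb S^3\setminus\{p_i,-p_i\}$ be a ball around $p_i$ with the point $p_i$ removed, such that $\overline{V_i}\cap\overline{V_j}=\emptyset$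 for $i\ne j$. Let $U\subset M$ be an open neighborhood of $\partial M\setminus\{p_1,\dots,p_N\}$, and let $g$ be a smooth Lorentzian metric on $U\cap M^\circ$ such that 1. $\mathrm{Ric}(g)-\Lambda g=0$; 2. for each $i$, $g=g_{p_i,\mathfrak m_i}$ on $U'\cap U\cap M^\circ$ for some neighborhood $U'$ of $V_i$ in $M$; 3. for some $\epsilon>0$, $$g-g_{dS}\in\tau^3(\log\tau)\,C^\infty(U;S^2\,{}^0T^*M)+\tau^3C^\infty(U;S^2\,{}^0T^*M)+\mathcal A^{3+\epsilon}(U;S^2\,{}^0T^*M).$$ Then $\{(p_1,\mathfrak m_1),\dots,(p_N,\mathfrak m_N)\}$ is balanced, i.e. the $p_i$ are pairwise distinct and $\sum_{i=1}^N\mathfrak m_ip_i=0\in\mathbb R^4$. -/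

import Mathlib

open scoped ContDiff Topology InnerProductSpace

namespace SdSGluing

noncomputable section

/-! # The spacetime manifold

The semi-global de Sitter manifold with boundary `[0,1)_τ × 𝕊³` is realised as the punctured closed
unit ball of `ℝ⁴` through the diffeomorphism `(τ, ψ) ↦ (1 - τ) ψ`.  The conformal boundary `τ = 0`
is the unit sphere.  Thus one Cartesian chart covers everything, and a covariant 2-tensor is a field
of bilinear forms on `ℝ⁴`. -/

/-- `ℝ⁴` with its Euclidean norm. -/
abbrev E4 : Type := EuclideanSpace ℝ (Fin 4)

/-- Bilinear forms on `ℝ⁴`. -/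
abbrev Bil : Type := E4 →L[ℝ] E4 →L[ℝ] ℝ

/-- `𝕊³ ⊆ ℝ⁴`, which is also the conformal boundary `∂M`. -/
def bdryM : Set E4 := Metric.sphere 0 1

/-- The manifold with boundary `M ≅ [0,1)_τ × 𝕊³`. -/
def M : Set E4 := {y | 0 < ‖y‖ ∧ ‖y‖ ≤ 1}

/-- The interior `M° ≅ (0,1)_τ × 𝕊³`. -/
def intM : Set E4 := {y | 0 < ‖y‖ ∧ ‖y‖ < 1}

/-- The boundary defining function `τ`. -/
def tau (y : E4) : ℝ := 1 - ‖y‖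

/-- The spherical coordinate `ψ ∈ 𝕊³`. -/
def psi (y : E4) : E4 := ‖y‖⁻¹ • y

/-! # Pseudo-Riemannian geometry in the Cartesian chart -/

/-- The coordinate basis vectors. -/
def ev (i : Fin 4) : E4 := EuclideanSpace.single i 1

/-- The components `g_{ij}` of a tensor field. -/
def comps (g : E4 → Bil) (y : E4) : Matrix (Fin 4) (Fin 4) ℝ :=
  Matrix.of fun i j => g y (ev i) (ev j)

/-- The partial derivative `∂_i f`. -/
def pd (i : Fin 4) (f : E4 → ℝ) (y : E4) : ℝ := fderiv ℝ f y (ev i)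

/-- The Christoffel symbols `Γ^k_{ij}`. -/
def christoffel (g : E4 → Bil) (k i j : Fin 4) (y : E4) : ℝ :=
  (1 / 2) * ∑ l, (comps g y)⁻¹ k l *
    (pd i (fun z => comps g z j l) y + pd j (fun z => comps g z i l) y
      - pd l (fun z => comps g z i j) y)

/-- The components `Ric_{ij}` of the Ricci tensor of `g`. -/
def ricci (g : E4 → Bil) (i j : Fin 4) (y : E4) : ℝ :=
  ∑ k, (pd k (christoffel g k i j) y - pd i (christoffel g k k j) y)
    + ∑ k, ∑ l, (christoffel g k k l y * christoffel g l i j y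
      - christoffel g k i l y * christoffel g l k j y)

/-- A symmetric bilinear form. -/
def IsSymm (B : Bil) : Prop := ∀ v w, B v w = B w v

/-- A symmetric bilinear form of signature `(-,+,+,+)`. -/
def IsLorentzian (B : Bil) : Prop :=
  IsSymm B ∧ ∃ b : Module.Basis (Fin 4) ℝ E4, ∀ i j,
    B (b i) (b j) = if i = j then (if i = 0 then -1 else 1) else 0

/-- `α ⊗ α` for a covector `α`. -/
def sq (α : E4 →L[ℝ] ℝ) : Bil := α.smulRight α

/-- The form `(v, w) ↦ ⟪A v, A w⟫`.  For `A` the differential of a sphere-valued map, this is the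
pull-back of the round metric of the sphere. -/
def pullInner (A : E4 →L[ℝ] E4) : Bil := (innerSL ℝ).bilinearComp A A

/-! # The de Sitter and Schwarzschild-de Sitter metrics -/

/-- The de Sitter metric `(3/Λ) τ⁻² (-(1-τ²)⁻¹ dτ² + g_{𝕊³})`. -/
def deSitter (Λ : ℝ) (y : E4) : Bil :=
  ((3 / Λ) * (tau y ^ 2)⁻¹) •
    (-(1 - tau y ^ 2)⁻¹ • sq (fderiv ℝ tau y) + pullInner (fderiv ℝ psi y))

/-- The upper half space time coordinate `τ̃` of de Sitter space, centered at `p ∈ 𝕊³`. -/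
def halfTau (p y : E4) : ℝ := tau y / (√(1 - tau y ^ 2) + ⟪p, psi y⟫_ℝ)

/-- The upper half space spatial coordinate `x̃` of de Sitter space centered at `p ∈ 𝕊³`, with values
in the 3-dimensional Euclidean space `p^⊥`. -/
def halfX (p y : E4) : E4 :=
  (√(1 - tau y ^ 2) + ⟪p, psi y⟫_ℝ)⁻¹ • (psi y - ⟪p, psi y⟫_ℝ • p)

/-- The static coordinate `t = -(1/2) √(3/Λ) log (|x̃|² - τ̃²)`. -/
def tCoord (Λ : ℝ) (p y : E4) : ℝ :=
  -(1 / 2) * √(3 / Λ) * Real.log (‖halfX p y‖ ^ 2 - halfTau p y ^ 2)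

/-- The static coordinate `r = √(3/Λ) |x̃| / τ̃`. -/
def rCoord (Λ : ℝ) (p y : E4) : ℝ := √(3 / Λ) * (‖halfX p y‖ / halfTau p y)

/-- The static coordinate `ω = x̃ / |x̃|`, in the unit 2-sphere of `p^⊥`. -/
def omegaCoord (p y : E4) : E4 := ‖halfX p y‖⁻¹ • halfX p y

/-- The function `Λ r²/3 - 1 + 2𝔪/r`. -/
def sdsF (Λ m r : ℝ) : ℝ := Λ * r ^ 2 / 3 - 1 + 2 * m / r

/-- The Schwarzschild-de Sitter metric `g_{p,𝔪} = -F⁻¹ dr² + F dt² + r² g_{𝕊²}`,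
`F = Λ r²/3 - 1 + 2𝔪/r`, glued into de Sitter space at the point `p` of the conformal boundary.
(Only its values near `𝕊³ ∖ {p, -p}`, where `r` is large, are meaningful.)  The metric depends on `p`
by pull-back along rotations, see `sds_rotate`. -/
def sds (Λ : ℝ) (p : E4) (m : ℝ) (y : E4) : Bil :=
  -(sdsF Λ m (rCoord Λ p y))⁻¹ • sq (fderiv ℝ (rCoord Λ p) y)
    + sdsF Λ m (rCoord Λ p y) • sq (fderiv ℝ (tCoord Λ p) y)
    + (rCoord Λ p y ^ 2) • pullInner (fderiv ℝ (omegaCoord p) y)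

/-- `(τ̃, x̃)` are the upper half space coordinates: they invert the map
`(τ̃, x̃) ↦ (τ, ψ)`, `τ = (((1 - (τ̃² - |x̃|²)) / (2τ̃))² + 1)^{-1/2}`,
`ψ = (τ/τ̃) ((1 + τ̃² - |x̃|²)/2, x̃)`, where `ℝ⁴ = ℝ p ⊕ p^⊥`. -/
theorem halfspace_spec {p y : E4} (hp : ‖p‖ = 1) (hy : y ∈ intM)
    (hD : 0 < √(1 - tau y ^ 2) + ⟪p, psi y⟫_ℝ) :
    tau y = (√(((1 - (halfTau p y ^ 2 - ‖halfX p y‖ ^ 2)) / (2 * halfTau p y)) ^ 2 + 1))⁻¹ ∧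
    psi y = (tau y / halfTau p y) •
      (((1 + halfTau p y ^ 2 - ‖halfX p y‖ ^ 2) / 2) • p + halfX p y) := by
  obtain ⟨hy0, hy1⟩ := hy
  have ht0 : 0 < tau y := by simp only [tau]; linarith
  have ht1 : tau y < 1 := by simp only [tau]; linarith
  have hpsi : ‖psi y‖ = 1 := by
    simp only [psi, norm_smul, norm_inv, norm_norm]; field_simp
  have hs : √(1 - tau y ^ 2) ^ 2 = 1 - tau y ^ 2 := Real.sq_sqrt (by nlinarith)
  have hs0 : 0 < √(1 - tau y ^ 2) := Real.sqrt_pos.2 (by nlinarith)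
  have hn : ‖psi y - ⟪p, psi y⟫_ℝ • p‖ ^ 2 = 1 - ⟪p, psi y⟫_ℝ ^ 2 := by
    rw [norm_sub_sq_real, norm_smul, hp, hpsi, inner_smul_right, real_inner_comm, mul_one,
      Real.norm_eq_abs, sq_abs]
    ring
  have hX : ‖halfX p y‖ ^ 2 =
      (1 - ⟪p, psi y⟫_ℝ ^ 2) / (√(1 - tau y ^ 2) + ⟪p, psi y⟫_ℝ) ^ 2 := by
    rw [halfX, norm_smul, mul_pow, hn, norm_inv, Real.norm_eq_abs, abs_of_pos hD]
    field_simp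
  have hX' : halfX p y = (√(1 - tau y ^ 2) + ⟪p, psi y⟫_ℝ)⁻¹ •
      (psi y - ⟪p, psi y⟫_ℝ • p) := rfl
  have hT : halfTau p y = tau y / (√(1 - tau y ^ 2) + ⟪p, psi y⟫_ℝ) := rfl
  generalize hc : ⟪p, psi y⟫_ℝ = c at *
  generalize √(1 - tau y ^ 2) = s at *
  generalize tau y = t at *
  constructor
  · have h1 : (1 - (halfTau p y ^ 2 - ‖halfX p y‖ ^ 2)) / (2 * halfTau p y) = s / t := by
      rw [hX, hT]
      field_simp
      linear_combination -hs
    have h2 : (s / t) ^ 2 + 1 = (t⁻¹) ^ 2 := by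
      field_simp
      linear_combination hs
    rw [h1, h2, Real.sqrt_sq (by positivity), inv_inv]
  · have h1 : t / halfTau p y = s + c := by
      rw [hT]; field_simp
    have h2 : (s + c) * ((1 + halfTau p y ^ 2 - ‖halfX p y‖ ^ 2) / 2) = c := by
      rw [hX, hT]
      field_simp
      linear_combination hs
    rw [h1, smul_add, smul_smul, h2, hX', smul_smul, mul_inv_cancel₀ hD.ne', one_smul]
    abel

/-- For a rotation `R`, `g_{p,𝔪}` is the pull-back of `g_{Rp,𝔪}` along `(τ, ψ) ↦ (τ, Rψ)`. -/
theorem sds_rotate (R : E4 ≃ₗᵢ[ℝ] E4) (Λ : ℝ) (p : E4) (m : ℝ) (y v w : E4) :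
    sds Λ (R p) m (R y) (R v) (R w) = sds Λ p m y v w := by
  have htau : ∀ z, tau (R z) = tau z := fun z => by simp [tau]
  have hpsi : ∀ z, psi (R z) = R (psi z) := fun z => by simp [psi]
  have hT : ∀ z, halfTau (R p) (R z) = halfTau p z := fun z => by
    simp [halfTau, htau, hpsi]
  have hX : ∀ z, halfX (R p) (R z) = R (halfX p z) := fun z => by
    simp [halfX, htau, hpsi]
  have ht : (tCoord Λ (R p)) ∘ R.toContinuousLinearEquiv = tCoord Λ p := by
    funext z; simp [tCoord, hT, hX]
  have hr : (rCoord Λ (R p)) ∘ R.toContinuousLinearEquiv = rCoord Λ p := by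
    funext z; simp [rCoord, hT, hX]
  have ho : (omegaCoord (R p)) ∘ R.toContinuousLinearEquiv
      = R.toContinuousLinearEquiv ∘ omegaCoord p := by
    funext z; simp [omegaCoord, hX]
  have hr0 : rCoord Λ (R p) (R y) = rCoord Λ p y := congrFun hr y
  have dt : ∀ u, fderiv ℝ (tCoord Λ (R p)) (R y) (R u) = fderiv ℝ (tCoord Λ p) y u := fun u => by
    rw [← ht, ContinuousLinearEquiv.comp_right_fderiv]; rfl
  have dr : ∀ u, fderiv ℝ (rCoord Λ (R p)) (R y) (R u) = fderiv ℝ (rCoord Λ p) y u := fun u => by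
    rw [← hr, ContinuousLinearEquiv.comp_right_fderiv]; rfl
  have dom : ∀ u, fderiv ℝ (omegaCoord (R p)) (R y) (R u) = R (fderiv ℝ (omegaCoord p) y u) :=
    fun u => by
      have h := congrArg (fun f => fderiv ℝ f y u) ho
      simp only [ContinuousLinearEquiv.comp_right_fderiv, ContinuousLinearEquiv.comp_fderiv] at h
      exact h
  simp [sds, sq, pullInner, hr0, dt, dr, dom]

/-! # Function spaces

The 0-cotangent bundle has the frame `dyⁱ/τ`, so sections of `S² ⁰T*M` are the symmetric 2-tensors
`u` for which `τ² u` has coefficients of the stated regularity in the Cartesian chart. -/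

/-- `u ∈ C^∞(U; S² ⁰T*M)`, where `U = O ∩ M`; smoothness holds up to the boundary. -/
def IsSmooth0Section (O : Set E4) (u : E4 → Bil) : Prop :=
  (∀ y ∈ O ∩ intM, IsSymm (u y)) ∧
    ∃ a : E4 → Bil, ContDiffOn ℝ ∞ a (O ∩ M) ∧ ∀ y ∈ O ∩ intM, tau y ^ 2 • u y = a y

/-- A b-vector field: a smooth vector field which is tangent to the boundary.  (Only its restriction to
compact subsets of `M` is used, so it may as well be defined on all of `ℝ⁴`.) -/
def IsBVectorField (Y : E4 → E4) : Prop :=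
  ContDiff ℝ ∞ Y ∧ ∀ y ∈ bdryM, ⟪Y y, y⟫_ℝ = 0

/-- Repeated differentiation `Y₁ (Y₂ (⋯ (Y_k f)))` along vector fields. -/
def iterDeriv {F : Type*} [NormedAddCommGroup F] [NormedSpace ℝ F] :
    List (E4 → E4) → (E4 → F) → E4 → F
  | [], f => f
  | Y :: L, f => fun y => fderiv ℝ (iterDeriv L f) y (Y y)

/-- `u ∈ 𝒜^α(U; S² ⁰T*M)`, where `U = O ∩ M`: `u` is smooth in the interior, and all derivatives of
`τ^{-α} u` (in the frame `dyⁱ/τ`) along b-vector fields are bounded on compact subsets of `U`, thus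
uniformly up to the boundary. -/
def IsConormal0Section (O : Set E4) (α : ℝ) (u : E4 → Bil) : Prop :=
  (∀ y ∈ O ∩ intM, IsSymm (u y)) ∧ ContDiffOn ℝ ∞ u (O ∩ intM) ∧
    ∀ L : List (E4 → E4), (∀ Y ∈ L, IsBVectorField Y) →
      ∀ K : Set E4, IsCompact K → K ⊆ O ∩ M →
        ∃ C : ℝ, ∀ y ∈ K ∩ intM,
          ‖iterDeriv L (fun z => (tau z ^ (-α) * tau z ^ 2) • u z) y‖ ≤ C

/-! # Gluing -/

/-- The set `U_p = 𝕊³ ∖ {p, -p}`. -/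
def Udom (p : E4) : Set E4 := bdryM \ {p, -p}

/-- The ball in `𝕊³` of radius `ρ` around `p`, with `p` removed. -/
def puncturedBall (p : E4) (ρ : ℝ) : Set E4 := (bdryM ∩ Metric.ball p ρ) \ {p}

/-- `g` is a smooth Lorentzian metric on the interior of `U = O ∩ M` which solves the Einstein
vacuum equation `Ric(g) - Λ g = 0`. -/
def IsEinstein (Λ : ℝ) (O : Set E4) (g : E4 → Bil) : Prop :=
  ContDiffOn ℝ ∞ g (O ∩ intM) ∧ (∀ y ∈ O ∩ intM, IsLorentzian (g y)) ∧
    ∀ y ∈ O ∩ intM, ∀ i j, ricci g i j y - Λ * g y (ev i) (ev j) = 0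

/-- The collection `(p_i, 𝔪_i)` is balanced. -/
def IsBalanced {N : ℕ} (p : Fin N → E4) (m : Fin N → ℝ) : Prop :=
  Function.Injective p ∧ ∑ i, m i • p i = 0

end

end SdSGluing

open SdSGluing

namespace SdSGluing

noncomputable section

/-! # Traces and coordinate expansions on `ℝ⁴` -/

/-! Put k = g - g_dS. Heuristically, the leading coefficient of k at the conformal boundary is a
trace-free, divergence-free tensor on the sphere minus the points p_i. The field T_q, the gradient
of ⟨q, ψ⟩, is conformal Killing on the sphere, so contracting the tensor with it gives a
divergence-free vector field. Its flux around p_i is read off from the Schwarzschild-de Sitter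
metric and is a universal multiple of m_i ⟨p_i, q⟩. The fluxes add up to zero for every q, which is
the balance condition.

The proof turns this into an argument with the full Einstein equation in thin shells δ ≤ τ ≤ 2δ. It
only uses k = O(τ^{1/2}), with one derivative costing a factor 1/τ; no coefficient of the expansion
has to be identified. The field N = √(1 - τ²) ∂_τ satisfies ∇N = φ for the de Sitter metric
(`nabla_Nf`). For g, the deviation S = ∇N - φ (`Sp`) is, after lowering an index with g, an exact
linear expression in k and its first derivatives (`metric_Sp`). The contracted Ricci identity
(`ricci_nab`) turns the Einstein equation into an equation of the form div S - d tr S = Λ k(·, N)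
(`einstein_Sp`).

This equation is paired with Y = ζ T_q + η N, where ζ and η contain an angular cutoff χ vanishing
near all p_i and a radial profile V(τ) = v(τ/δ). After integration by parts (`divg_fluxC`,
`divg_Psi_Tf_Tf`), the choice of ζ and η makes the linear terms cancel to the required order
wherever χ is locally constant, and the quadratic terms are small. There remain the annuli around
the p_i where χ varies. There g is Schwarzschild-de Sitter, and `exists_sds_bounds` supplies the
components of k. The outcome is `divg_testX`: the divergence of the compactly supported field
`testX` is μ τ⁴ V times the angular function `obs`, up to a constant and the factor 1 - 2τ², plus μ
times an error `testErr` = o(τ⁴).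

Integrating over the shell, the divergence theorem shows that the obstruction integral is o(δ)
(`abs_integral_obsDensity_le`). By symmetry of the sphere it equals ⟨∑ m_i p_i, q⟩ times a
normalization (`integral_obsDensity`) which is at least κ δ with κ > 0 (`exists_obsNorm_ge`).
Letting δ → 0 forces ⟨∑ m_i p_i, q⟩ = 0. -/

/-- The trace of an endomorphism of `ℝ⁴`. -/
def trE (A : E4 →L[ℝ] E4) : ℝ := ∑ i, (A (ev i)) i

/-- The `i`-th coordinate as a continuous linear form. -/
def pr (i : Fin 4) : E4 →L[ℝ] ℝ := EuclideanSpace.proj i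

@[simp] theorem pr_apply (i : Fin 4) (v : E4) : pr i v = v i := rfl

theorem ev_apply (i j : Fin 4) : (ev i) j = if j = i then (1 : ℝ) else 0 := by
  simp [ev]

theorem sum_smul_ev (v : E4) : ∑ i, v i • ev i = v := by
  ext j
  simp [ev_apply]

theorem inner_ev (i : Fin 4) (v : E4) : ⟪ev i, v⟫_ℝ = v i := by
  simp [ev, EuclideanSpace.inner_single_left]

theorem map_eq_sum {F : Type*} [NormedAddCommGroup F] [NormedSpace ℝ F] (A : E4 →L[ℝ] F) (v : E4) :
    A v = ∑ i, v i • A (ev i) := by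
  conv_lhs => rw [← sum_smul_ev v]
  simp

theorem bil_eq_sum (B : Bil) (v w : E4) : B v w = ∑ i, ∑ j, v i * w j * B (ev i) (ev j) := by
  rw [map_eq_sum B v]
  simp only [_root_.sum_apply, _root_.smul_apply, smul_eq_mul]
  refine Finset.sum_congr rfl fun i _ => ?_
  rw [map_eq_sum (B (ev i)) w, Finset.mul_sum]
  refine Finset.sum_congr rfl fun j _ => ?_
  simp only [smul_eq_mul]; ring

theorem trE_add (A B : E4 →L[ℝ] E4) : trE (A + B) = trE A + trE B := by
  simp [trE, Finset.sum_add_distrib]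

theorem trE_sub (A B : E4 →L[ℝ] E4) : trE (A - B) = trE A - trE B := by
  simp [trE, Finset.sum_sub_distrib]

theorem trE_neg (A : E4 →L[ℝ] E4) : trE (-A) = -trE A := by
  simp [trE]

theorem trE_smul (c : ℝ) (A : E4 →L[ℝ] E4) : trE (c • A) = c * trE A := by
  simp [trE, Finset.mul_sum]

theorem trE_id : trE (ContinuousLinearMap.id ℝ E4) = 4 := by
  simp [trE, ev_apply]

theorem trE_smulRight (α : E4 →L[ℝ] ℝ) (v : E4) : trE (α.smulRight v) = α v := by
  rw [map_eq_sum α v]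
  simp [trE, mul_comm]

/-- The trace as a continuous linear form. -/
def trL : (E4 →L[ℝ] E4) →L[ℝ] ℝ :=
  LinearMap.toContinuousLinearMap
    { toFun := trE
      map_add' := trE_add
      map_smul' := fun c A => by simp [trE_smul] }

@[simp] theorem trL_apply (A : E4 →L[ℝ] E4) : trL A = trE A := rfl

theorem trE_comp_comm (A B : E4 →L[ℝ] E4) : trE (A.comp B) = trE (B.comp A) := by
  have h : ∀ A B : E4 →L[ℝ] E4, trE (A.comp B) = ∑ i, ∑ j, (A (ev j)) i * (B (ev i)) j := by
    intro A B
    refine Finset.sum_congr rfl fun i _ => ?_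
    rw [ContinuousLinearMap.comp_apply, map_eq_sum A]
    simp [mul_comm]
  rw [h, h, Finset.sum_comm]
  simp only [mul_comm]

/-- The divergence of a vector field. -/
def divg (X : E4 → E4) (y : E4) : ℝ := trE (fderiv ℝ X y)

theorem divg_smul {f : E4 → ℝ} {X : E4 → E4} {y : E4} (hf : DifferentiableAt ℝ f y)
    (hX : DifferentiableAt ℝ X y) :
    divg (fun z => f z • X z) y = f y * divg X y + fderiv ℝ f y (X y) := by
  rw [divg, fderiv_fun_smul hf hX, trE_add, trE_smul, trE_smulRight]; rfl

theorem divg_add {X Y : E4 → E4} {y : E4} (hX : DifferentiableAt ℝ X y)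
    (hY : DifferentiableAt ℝ Y y) :
    divg (fun z => X z + Y z) y = divg X y + divg Y y := by
  rw [divg, fderiv_fun_add hX hY, trE_add]; rfl

theorem divg_sub {X Y : E4 → E4} {y : E4} (hX : DifferentiableAt ℝ X y)
    (hY : DifferentiableAt ℝ Y y) :
    divg (fun z => X z - Y z) y = divg X y - divg Y y := by
  rw [divg, fderiv_fun_sub hX hY, trE_sub]; rfl

open MeasureTheory in
/-- A special case of the divergence theorem. -/
theorem integral_divg_eq_zero {X : E4 → E4} (hX : ContDiff ℝ 1 X) (hc : HasCompactSupport X) :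
    ∫ y, divg X y = 0 := by
  have hcoord : ∀ i : Fin 4, ContDiff ℝ 1 fun y => X y i := fun i => (pr i).contDiff.comp hX
  have hci : ∀ i : Fin 4, HasCompactSupport fun y => X y i := fun i =>
    hc.comp_left (g := fun v : E4 => v i) rfl
  have hcf : ∀ i : Fin 4, HasCompactSupport fun y => fderiv ℝ (fun y => X y i) y (ev i) := fun i =>
    ((hci i).fderiv ℝ).comp_left (g := fun A : E4 →L[ℝ] ℝ => A (ev i)) rfl
  have hint : ∀ i : Fin 4, Integrable fun y => fderiv ℝ (fun y => X y i) y (ev i) := fun i =>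
    (((hcoord i).continuous_fderiv one_ne_zero).clm_apply continuous_const).integrable_of_hasCompactSupport
      (hcf i)
  have hd : ∀ y, divg X y = ∑ i, fderiv ℝ (fun y => X y i) y (ev i) := by
    intro y
    unfold divg trE
    refine Finset.sum_congr rfl fun i _ => ?_
    have := ((pr i).hasFDerivAt.comp y
      (hX.differentiable one_ne_zero y).hasFDerivAt).fderiv
    change _ = fderiv ℝ (pr i ∘ X) y (ev i)
    rw [this]; rfl
  simp_rw [hd]
  rw [integral_finsetSum _ fun i _ => hint i]
  refine Finset.sum_eq_zero fun i _ => ?_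
  -- Integration by parts against the constant function 1 shows that each ∂_i X^i has integral zero.
  have := integral_mul_fderiv_eq_neg_fderiv_mul_of_integrable (μ := (volume : Measure E4))
    (f := fun _ : E4 => (1 : ℝ)) (g := fun y => X y i) (v := ev i) (by simp)
    (by simpa using hint i)
    (by simpa using (hcoord i).continuous.integrable_of_hasCompactSupport (hci i))
    (fun x _ => differentiableAt_const _)
    (fun x _ => ((hcoord i).differentiable one_ne_zero) x)
  simpa using this

/-! # Christoffel symbols as a field of bilinear maps -/

/-- The Christoffel symbols as a bilinear map: `(Γ(u,v))^k = Γ^k_{ij} u^i v^j`. -/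
def Gam (g : E4 → Bil) (y : E4) : E4 →L[ℝ] E4 →L[ℝ] E4 :=
  ∑ k, ∑ i, ∑ j, christoffel g k i j y • (pr i).smulRight ((pr j).smulRight (ev k))

theorem Gam_apply (g : E4 → Bil) (y u v : E4) :
    Gam g y u v = ∑ k, (∑ i, ∑ j, christoffel g k i j y * (u i * v j)) • ev k := by
  simp only [Gam, _root_.sum_apply, _root_.smul_apply,
    ContinuousLinearMap.smulRight_apply, pr_apply, Finset.sum_smul, smul_smul, mul_assoc]

theorem Gam_coord (g : E4 → Bil) (y u v : E4) (k : Fin 4) :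
    (Gam g y u v) k = ∑ i, ∑ j, christoffel g k i j y * (u i * v j) := by
  rw [Gam_apply]; simp [ev_apply]

theorem Gam_ev (g : E4 → Bil) (y : E4) (i j k : Fin 4) :
    (Gam g y (ev i) (ev j)) k = christoffel g k i j y := by
  rw [Gam_coord]; simp [ev_apply]

/-- The Koszul expression `½ (D_u B(v,w) + D_v B(u,w) - D_w B(u,v))`. -/
def koszul (D : E4 →L[ℝ] Bil) (u v w : E4) : ℝ := (1 / 2) * (D u v w + D v u w - D w u v)

theorem pd_comps {g : E4 → Bil} {y : E4} (hg : DifferentiableAt ℝ g y) (l i j : Fin 4) :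
    pd l (fun z => comps g z i j) y = fderiv ℝ g y (ev l) (ev i) (ev j) := by
  have h := (((hg.hasFDerivAt).clm_apply (hasFDerivAt_const (ev i) y)).clm_apply
    (hasFDerivAt_const (ev j) y)).fderiv
  change fderiv ℝ (fun z => g z (ev i) (ev j)) y (ev l) = _
  rw [h]; simp

/-- A vector in the kernel of the component matrix is g-orthogonal to everything; testing against
the orthonormal basis of `IsLorentzian` shows that all its coefficients vanish. -/
theorem comps_isUnit_det {g : E4 → Bil} {y : E4} (hL : IsLorentzian (g y)) :
    IsUnit (comps g y).det := by
  obtain ⟨hs, b, hb⟩ := hL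
  rw [isUnit_iff_ne_zero]
  intro h0
  obtain ⟨v, hv, hv0⟩ := Matrix.exists_mulVec_eq_zero_iff.2 h0
  let x : E4 := WithLp.toLp 2 v
  have hx : ∀ w, g y w x = 0 := by
    intro w
    rw [bil_eq_sum]
    have : ∀ i, ∑ j, g y (ev i) (ev j) * v j = 0 := fun i => congrFun hv0 i
    refine Finset.sum_eq_zero fun i _ => ?_
    have h2 := this i
    calc ∑ j, w i * x j * g y (ev i) (ev j) = w i * ∑ j, g y (ev i) (ev j) * v j := by
          rw [Finset.mul_sum]; refine Finset.sum_congr rfl fun j _ => ?_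
          change w i * v j * _ = _; ring
      _ = 0 := by rw [h2, mul_zero]
  have hxr : x = 0 := by
    apply b.repr.injective
    ext i
    have h1 := hx (b i)
    rw [← b.sum_repr x] at h1
    simp only [map_sum, map_smul, smul_eq_mul, hb] at h1
    rw [Finset.sum_eq_single i] at h1
    · by_cases hi : i = 0 <;> simp_all
    · intro j _ hj; simp [hj.symm]
    · simp
  apply hv
  exact congrArg (WithLp.ofLp) hxr

/-- On basis vectors, contracting with g cancels the inverse matrix in `christoffel`; the general
case follows by expanding one slot at a time. This characterizes `Gam` without an inverse metric, so
two metrics can be compared by subtracting Koszul formulas. -/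
theorem koszul_Gam {g : E4 → Bil} {y : E4} (hg : DifferentiableAt ℝ g y)
    (hs : IsSymm (g y)) (hu : IsUnit (comps g y).det) (u v w : E4) :
    g y (Gam g y u v) w = koszul (fderiv ℝ g y) u v w := by
  have hm : ∀ l l', ∑ k, comps g y l' k * (comps g y)⁻¹ k l = if l' = l then 1 else 0 := by
    intro l l'
    have := congrFun (congrFun (Matrix.mul_nonsing_inv _ hu) l') l
    rwa [Matrix.mul_apply, Matrix.one_apply] at this
  have key : ∀ i j l, g y (Gam g y (ev i) (ev j)) (ev l) =
      koszul (fderiv ℝ g y) (ev i) (ev j) (ev l) := by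
    intro i j l
    rw [hs, map_eq_sum (g y (ev l))]
    simp only [Gam_ev, christoffel, smul_eq_mul, pd_comps hg]
    have : ∀ k, (1 / 2 * ∑ l', (comps g y)⁻¹ k l' *
        (fderiv ℝ g y (ev i) (ev j) (ev l') + fderiv ℝ g y (ev j) (ev i) (ev l')
          - fderiv ℝ g y (ev l') (ev i) (ev j))) * g y (ev l) (ev k)
        = ∑ l', (comps g y l k * (comps g y)⁻¹ k l') * koszul (fderiv ℝ g y) (ev i) (ev j) (ev l') := by
      intro k
      rw [Finset.mul_sum, Finset.sum_mul]
      refine Finset.sum_congr rfl fun l' _ => ?_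
      simp only [koszul, comps, Matrix.of_apply]; ring
    rw [Finset.sum_congr rfl fun k _ => this k, Finset.sum_comm]
    simp_rw [← Finset.sum_mul, hm]
    simp
  have e1 : ∀ i j, g y (Gam g y (ev i) (ev j)) w = koszul (fderiv ℝ g y) (ev i) (ev j) w := by
    intro i j
    rw [map_eq_sum _ w]
    simp only [key, koszul, smul_eq_mul]
    rw [map_eq_sum (fderiv ℝ g y (ev i) (ev j)) w, map_eq_sum (fderiv ℝ g y (ev j) (ev i)) w,
      map_eq_sum (fderiv ℝ g y) w]
    simp only [_root_.sum_apply, _root_.smul_apply, smul_eq_mul]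
    rw [← Finset.sum_add_distrib, ← Finset.sum_sub_distrib, Finset.mul_sum]
    refine Finset.sum_congr rfl fun k _ => ?_
    ring
  have e2 : ∀ i, g y (Gam g y (ev i) v) w = koszul (fderiv ℝ g y) (ev i) v w := by
    intro i
    rw [map_eq_sum (Gam g y (ev i)) v]
    simp only [map_sum, map_smul, _root_.sum_apply, _root_.smul_apply,
      smul_eq_mul, e1]
    simp only [koszul]
    rw [map_eq_sum (fderiv ℝ g y (ev i)) v, map_eq_sum (fderiv ℝ g y) v,
      map_eq_sum (fderiv ℝ g y w (ev i)) v]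
    simp only [_root_.sum_apply, _root_.smul_apply, smul_eq_mul]
    rw [← Finset.sum_add_distrib, ← Finset.sum_sub_distrib, Finset.mul_sum]
    refine Finset.sum_congr rfl fun k _ => ?_
    ring
  rw [map_eq_sum (Gam g y) u]
  simp only [map_sum, map_smul, _root_.sum_apply, _root_.smul_apply,
      smul_eq_mul, e2]
  simp only [koszul]
  rw [map_eq_sum (fderiv ℝ g y v) u, map_eq_sum (fderiv ℝ g y) u,
      map_eq_sum (fderiv ℝ g y w) u]
  simp only [_root_.sum_apply, _root_.smul_apply, smul_eq_mul]
  rw [← Finset.sum_add_distrib, ← Finset.sum_sub_distrib, Finset.mul_sum]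
  refine Finset.sum_congr rfl fun k _ => ?_
  ring

/-- The derivatives of g_ij and g_ji are compared, so symmetry is needed on a neighborhood and not
only at the point. -/
theorem christoffel_symm {g : E4 → Bil} {y : E4} (hs : ∀ᶠ z in 𝓝 y, IsSymm (g z)) (k i j : Fin 4) :
    christoffel g k i j y = christoffel g k j i y := by
  have h : ∀ l, pd l (fun z => comps g z i j) y = pd l (fun z => comps g z j i) y := by
    intro l
    have : (fun z => comps g z i j) =ᶠ[𝓝 y] fun z => comps g z j i := by
      filter_upwards [hs] with z hz
      exact hz _ _
    rw [pd, pd, this.fderiv_eq]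
  simp only [christoffel, h]
  congr 1
  refine Finset.sum_congr rfl fun l _ => ?_
  ring

theorem Gam_symm {g : E4 → Bil} {y : E4} (hs : ∀ᶠ z in 𝓝 y, IsSymm (g z)) (u v : E4) :
    Gam g y u v = Gam g y v u := by
  rw [Gam_apply, Gam_apply]
  refine Finset.sum_congr rfl fun k _ => ?_
  congr 1
  rw [Finset.sum_comm]
  refine Finset.sum_congr rfl fun i _ => Finset.sum_congr rfl fun j _ => ?_
  rw [christoffel_symm hs]; ring

/-- The inverse matrix is smooth by Cramer's rule: determinants are polynomials in the entries and
`comps_isUnit_det` keeps the denominator away from zero. -/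
theorem contDiffOn_christoffel {g : E4 → Bil} {Ω : Set E4} (hΩ : IsOpen Ω)
    (hg : ContDiffOn ℝ ∞ g Ω) (hL : ∀ y ∈ Ω, IsLorentzian (g y)) (k i j : Fin 4) :
    ContDiffOn ℝ ∞ (christoffel g k i j) Ω := by
  have hc : ∀ i j, ContDiffOn ℝ ∞ (fun z => comps g z i j) Ω := fun i j =>
    (hg.clm_apply contDiffOn_const).clm_apply contDiffOn_const
  have hpd : ∀ l i j, ContDiffOn ℝ ∞ (pd l (fun z => comps g z i j)) Ω := fun l i j =>
    ((hc i j).fderiv_of_isOpen hΩ (m := ∞) (by simp)).clm_apply contDiffOn_const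
  have hdet : ∀ A : E4 → Matrix (Fin 4) (Fin 4) ℝ, (∀ i j, ContDiffOn ℝ ∞ (fun z => A z i j) Ω) →
      ContDiffOn ℝ ∞ (fun z => (A z).det) Ω := by
    intro A hA
    simp only [Matrix.det_apply]
    refine ContDiffOn.sum fun σ _ => ?_
    simp only [Units.smul_def, zsmul_eq_mul]
    exact contDiffOn_const.mul (contDiffOn_prod fun x _ => hA _ _)
  have hinv : ∀ k l, ContDiffOn ℝ ∞ (fun z => (comps g z)⁻¹ k l) Ω := by
    intro k l
    simp only [Matrix.inv_def, Ring.inverse_eq_inv', Matrix.smul_apply, smul_eq_mul,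
      Matrix.adjugate_apply]
    refine ((hdet _ hc).inv fun z hz => (comps_isUnit_det (hL z hz)).ne_zero).mul (hdet _ ?_)
    intro i j
    by_cases hi : i = l
    · subst hi; simp only [Matrix.updateRow_self]; exact contDiffOn_const
    · simp only [Matrix.updateRow_ne hi]; exact hc i j
  unfold christoffel
  refine contDiffOn_const.mul (ContDiffOn.sum fun l _ => (hinv k l).mul ?_)
  exact ((hpd _ _ _).add (hpd _ _ _)).sub (hpd _ _ _)

theorem contDiffOn_Gam {g : E4 → Bil} {Ω : Set E4} (hΩ : IsOpen Ω)
    (hg : ContDiffOn ℝ ∞ g Ω) (hL : ∀ y ∈ Ω, IsLorentzian (g y)) : ContDiffOn ℝ ∞ (Gam g) Ω := by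
  rw [contDiffOn_clm_apply]
  intro u
  rw [contDiffOn_clm_apply]
  intro v
  simp only [Gam_apply]
  exact ContDiffOn.sum fun k _ => (ContDiffOn.sum fun i _ => ContDiffOn.sum fun j _ =>
    (contDiffOn_christoffel hΩ hg hL k i j).mul contDiffOn_const).smul contDiffOn_const

theorem differentiableAt_christoffel {g : E4 → Bil} {y : E4} (hG : DifferentiableAt ℝ (Gam g) y)
    (k i j : Fin 4) : DifferentiableAt ℝ (christoffel g k i j) y := by
  have h1 := (((hG.hasFDerivAt).clm_apply (hasFDerivAt_const (ev i) y)).clm_apply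
    (hasFDerivAt_const (ev j) y))
  have h2 := ((pr k).hasFDerivAt.comp y h1).differentiableAt
  refine h2.congr_of_eventuallyEq (Filter.Eventually.of_forall fun z => ?_)
  exact (Gam_ev g z i j k).symm

/-! # The contracted Ricci identity -/

/-- The covariant derivative `u ↦ ∇_u X` of a vector field. -/
def nab (g : E4 → Bil) (X : E4 → E4) (y : E4) : E4 →L[ℝ] E4 :=
  fderiv ℝ X y + (Gam g y).flip (X y)

theorem nab_apply (g : E4 → Bil) (X : E4 → E4) (y u : E4) :
    nab g X y u = fderiv ℝ X y u + Gam g y u (X y) := rfl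

theorem hasFDerivAt_clm_apply {E F G : Type*} [NormedAddCommGroup E] [NormedSpace ℝ E]
    [NormedAddCommGroup F] [NormedSpace ℝ F] [NormedAddCommGroup G] [NormedSpace ℝ G]
    (L : F →L[ℝ] G) {f : E → F} {y : E} (hf : DifferentiableAt ℝ f y) :
    HasFDerivAt (fun z => L (f z)) (L.comp (fderiv ℝ f y)) y :=
  L.hasFDerivAt.comp y hf.hasFDerivAt

/-- The trace of a vector-valued bilinear map in its first argument. -/
def trG (G : E4 →L[ℝ] E4 →L[ℝ] E4) (v : E4) : ℝ := trE (G.flip v)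

theorem fderiv_Gam_coord {g : E4 → Bil} {y : E4}
    (hG : DifferentiableAt ℝ (Gam g) y) (u v w : E4) (k : Fin 4) :
    (fderiv ℝ (Gam g) y w u v) k = ∑ i, ∑ j, (fderiv ℝ (christoffel g k i j) y w) * (u i * v j) := by
  have h1 := (((hG.hasFDerivAt).clm_apply (hasFDerivAt_const u y)).clm_apply
    (hasFDerivAt_const v y))
  have h2 := ((pr k).hasFDerivAt.comp y h1).fderiv
  have h3 : HasFDerivAt (fun z => (Gam g z u v) k)
      (∑ i, ∑ j, (u i * v j) • fderiv ℝ (christoffel g k i j) y) y := by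
    simp only [Gam_coord]
    exact HasFDerivAt.fun_sum fun i _ => HasFDerivAt.fun_sum fun j _ =>
      (differentiableAt_christoffel hG k i j).hasFDerivAt.mul_const _
  have h4 := h3.fderiv
  change fderiv ℝ (pr k ∘ fun z => Gam g z u v) y = _ at h4
  rw [h2] at h4
  have h5 := congrArg (fun A => A w) h4
  simpa [mul_comm] using h5

/-- Each contraction in the index formula of `ricci` is the trace of an endomorphism built from
`Gam` and its derivative. This index-free form is the one to compare with the derivative of `nab`.
-/
theorem ricci_eq {g : E4 → Bil} {y : E4}
    (hG : DifferentiableAt ℝ (Gam g) y) (u v : E4) :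
    ∑ i, ∑ j, ricci g i j y * (u i * v j) =
      trE ((fderiv ℝ (Gam g) y).flip u |>.flip v) - trE ((fderiv ℝ (Gam g) y u).flip v)
      + trG (Gam g y) (Gam g y u v) - trE ((Gam g y u).comp ((Gam g y).flip v)) := by
  have e1 : trE ((fderiv ℝ (Gam g) y).flip u |>.flip v) =
      ∑ i, ∑ j, (∑ k, pd k (christoffel g k i j) y) * (u i * v j) := by
    simp only [trE, ContinuousLinearMap.flip_apply, fderiv_Gam_coord hG, pd, Finset.sum_mul]
    rw [Finset.sum_comm]
    refine Finset.sum_congr rfl fun i _ => ?_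
    rw [Finset.sum_comm]
  have e2 : trE ((fderiv ℝ (Gam g) y u).flip v) =
      ∑ i, ∑ j, (∑ k, pd i (christoffel g k k j) y) * (u i * v j) := by
    rw [map_eq_sum (fderiv ℝ (Gam g) y) u]
    simp only [trE, ContinuousLinearMap.flip_apply, _root_.sum_apply, WithLp.ofLp_sum,
      Finset.sum_apply,
      _root_.smul_apply, PiLp.smul_apply, smul_eq_mul,
      fderiv_Gam_coord hG, pd, Finset.sum_mul]
    rw [Finset.sum_comm]
    refine Finset.sum_congr rfl fun i _ => ?_
    rw [Finset.sum_comm]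
    refine Finset.sum_congr rfl fun k _ => ?_
    rw [Finset.sum_eq_single k (fun j _ hj => by simp [ev_apply, hj]) (by simp), Finset.mul_sum]
    refine Finset.sum_congr rfl fun j _ => ?_
    simp only [ev_apply, if_true]
    ring
  have e3 : trG (Gam g y) (Gam g y u v) =
      ∑ i, ∑ j, (∑ k, ∑ l, christoffel g k k l y * christoffel g l i j y) * (u i * v j) := by
    simp only [trG, trE, ContinuousLinearMap.flip_apply]
    have : ∀ k, (Gam g y (ev k) (Gam g y u v)) k =
        ∑ l, ∑ i, ∑ j, christoffel g k k l y * christoffel g l i j y * (u i * v j) := by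
      intro k
      rw [Gam_coord]
      simp only [ev_apply, Gam_coord, ite_mul, one_mul, zero_mul, mul_ite, mul_zero,
        Finset.sum_ite_irrel, Finset.sum_const_zero, Finset.sum_ite_eq', Finset.mem_univ, if_true,
        Finset.mul_sum, mul_assoc]
    simp only [this, Finset.sum_mul]
    rw [Finset.sum_congr rfl fun k _ => Finset.sum_comm, Finset.sum_comm]
    refine Finset.sum_congr rfl fun i _ => ?_
    rw [Finset.sum_congr rfl fun k _ => Finset.sum_comm, Finset.sum_comm]
  have e4 : trE ((Gam g y u).comp ((Gam g y).flip v)) =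
      ∑ i, ∑ j, (∑ k, ∑ l, christoffel g k i l y * christoffel g l k j y) * (u i * v j) := by
    simp only [trE, ContinuousLinearMap.flip_apply, ContinuousLinearMap.comp_apply]
    have : ∀ k, (Gam g y u (Gam g y (ev k) v)) k =
        ∑ i, ∑ l, ∑ j, christoffel g k i l y * christoffel g l k j y * (u i * v j) := by
      intro k
      rw [Gam_coord]
      refine Finset.sum_congr rfl fun i _ => Finset.sum_congr rfl fun l _ => ?_
      simp only [Gam_coord, ev_apply, ite_mul, one_mul, zero_mul, mul_ite, mul_zero,
        Finset.sum_ite_irrel, Finset.sum_const_zero, Finset.sum_ite_eq', Finset.mem_univ, if_true,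
        Finset.mul_sum]
      refine Finset.sum_congr rfl fun j _ => ?_
      ring
    simp only [this, Finset.sum_mul]
    rw [Finset.sum_comm]
    refine Finset.sum_congr rfl fun i _ => ?_
    rw [Finset.sum_congr rfl fun k _ => Finset.sum_comm, Finset.sum_comm]
  rw [e1, e2, e3, e4]
  simp only [← Finset.sum_add_distrib, ← Finset.sum_sub_distrib]
  refine Finset.sum_congr rfl fun i _ => Finset.sum_congr rfl fun j _ => ?_
  simp only [ricci, Finset.sum_sub_distrib]
  ring

/-- `Ric(u, X)` as a divergence of `∇X`. -/
theorem ricci_nab {g : E4 → Bil} {X : E4 → E4} {y : E4}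
    (hG : DifferentiableAt ℝ (Gam g) y)
    (hX : ContDiffAt ℝ 2 X y) (u : E4) :
    ∑ i, ∑ j, ricci g i j y * (u i * X y j) =
      trE ((fderiv ℝ (nab g X) y).flip u) - trE (fderiv ℝ (nab g X) y u)
      + trG (Gam g y) (nab g X y u) - trE ((Gam g y u).comp (nab g X y)) := by
  have hX1 : DifferentiableAt ℝ X y := hX.differentiableAt two_ne_zero
  have hX2 : DifferentiableAt ℝ (fderiv ℝ X) y :=
    (hX.fderiv_right (m := 1) (by norm_num)).differentiableAt one_ne_zero
  -- The second derivatives of X enter the two traces with their arguments exchanged, so they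
  -- cancel; what survives is curvature.
  have hsymm : ∀ v w, fderiv ℝ (fderiv ℝ X) y v w = fderiv ℝ (fderiv ℝ X) y w v :=
    fun v w => (hX.isSymmSndFDerivAt (by simp)) v w
  have hnab : ∀ w v, fderiv ℝ (nab g X) y w v = fderiv ℝ (fderiv ℝ X) y w v
      + fderiv ℝ (Gam g) y w v (X y) + Gam g y v (fderiv ℝ X y w) := by
    intro w v
    let F : (E4 →L[ℝ] E4 →L[ℝ] E4) →L[ℝ] (E4 →L[ℝ] E4 →L[ℝ] E4) :=
      (ContinuousLinearMap.flipₗᵢ ℝ E4 E4 E4).toContinuousLinearEquiv.toContinuousLinearMap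
    have hf : HasFDerivAt (fun z => F (Gam g z)) (F.comp (fderiv ℝ (Gam g) y)) y :=
      hasFDerivAt_clm_apply (E := E4) (F := E4 →L[ℝ] E4 →L[ℝ] E4) (G := E4 →L[ℝ] E4 →L[ℝ] E4) F hG
    have h := (hX2.hasFDerivAt.add (hf.clm_apply hX1.hasFDerivAt)).fderiv
    have h' : fderiv ℝ (nab g X) y = _ := h
    rw [h']
    simp only [F, _root_.add_apply, ContinuousLinearMap.comp_apply, ContinuousLinearMap.flip_apply]
    simp
    abel
  rw [ricci_eq hG]
  simp only [trG, trE, ContinuousLinearMap.flip_apply, ContinuousLinearMap.comp_apply, hnab,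
    nab_apply, map_add, PiLp.add_apply, _root_.add_apply, Finset.sum_add_distrib, hsymm u]
  ring

end

end SdSGluing

namespace SdSGluing

noncomputable section

/-! # Coordinate functions and vector fields on de Sitter space -/

/-- The function `√(1 - τ²)`. -/
def sT (y : E4) : ℝ := √(1 - tau y ^ 2)

/-- The function `⟨q, ψ⟩`. -/
def cq (q y : E4) : ℝ := ⟪q, psi y⟫_ℝ

/-- The vector field `√(1 - τ²) ∂_τ`. -/
def Nf (y : E4) : E4 := (-(sT y / ‖y‖)) • y

/-- The conformal vector field `∇⟨q, ψ⟩` of the sphere. -/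
def Tf (q y : E4) : E4 := ‖y‖ • q - (⟪q, y⟫_ℝ / ‖y‖) • y

/-- The conformal factor: `∇N = φ` for the de Sitter metric. -/
def phi (y : E4) : ℝ := -sT y / tau y

/-- The density of the de Sitter metric, up to a constant factor. -/
def mu (y : E4) : ℝ := (‖y‖ ^ 3 * tau y ^ 4 * sT y)⁻¹

/-- The differential of `τ`. -/
def dTau (y : E4) : E4 →L[ℝ] ℝ := -(‖y‖⁻¹ • innerSL ℝ y)

/-- The differential of `⟨q, ψ⟩`. -/
def dC (q y : E4) : E4 →L[ℝ] ℝ := ‖y‖⁻¹ • innerSL ℝ q - (⟪q, y⟫_ℝ / ‖y‖ ^ 3) • innerSL ℝ y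

theorem dTau_apply (y v : E4) : dTau y v = -(⟪y, v⟫_ℝ / ‖y‖) := by
  simp [dTau, div_eq_inv_mul]

theorem dC_apply (q y v : E4) :
    dC q y v = ⟪q, v⟫_ℝ / ‖y‖ - ⟪q, y⟫_ℝ * ⟪y, v⟫_ℝ / ‖y‖ ^ 3 := by
  simp [dC, div_eq_inv_mul, mul_assoc]

theorem cq_eq (q y : E4) : cq q y = ⟪q, y⟫_ℝ / ‖y‖ := by
  simp [cq, psi, inner_smul_right, div_eq_inv_mul]

section

variable {y : E4}

theorem tau_pos (hy : y ∈ intM) : 0 < tau y := by simp only [tau]; linarith [hy.2]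

theorem tau_lt_one (hy : y ∈ intM) : tau y < 1 := by simp only [tau]; linarith [hy.1]

theorem sT_sq (hy : y ∈ intM) : sT y ^ 2 = 1 - tau y ^ 2 :=
  Real.sq_sqrt (by nlinarith [tau_pos hy, tau_lt_one hy])

theorem sT_sq' (hy : y ∈ intM) : sT y ^ 2 = ‖y‖ * (2 - ‖y‖) := by
  rw [sT_sq hy, tau]; ring

theorem sT_pos (hy : y ∈ intM) : 0 < sT y :=
  Real.sqrt_pos.2 (by nlinarith [tau_pos hy, tau_lt_one hy])

theorem isOpen_intM : IsOpen intM :=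
  (isOpen_lt continuous_const continuous_norm).inter (isOpen_lt continuous_norm continuous_const)

theorem ne_zero_of_intM (hy : y ∈ intM) : y ≠ 0 := norm_pos_iff.1 hy.1

theorem hasFDerivAt_norm' (hy : y ≠ 0) : HasFDerivAt (fun z : E4 => ‖z‖) (‖y‖⁻¹ • innerSL ℝ y) y := by
  have h := (hasStrictFDerivAt_norm_sq y).hasFDerivAt.sqrt (by simpa using hy)
  simp only [Real.sqrt_sq (norm_nonneg _)] at h
  refine h.congr_fderiv ?_
  ext v
  simp; ring

theorem hasFDerivAt_inv_comp {f : E4 → ℝ} {f' : E4 →L[ℝ] ℝ} (h : HasFDerivAt f f' y)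
    (h0 : f y ≠ 0) : HasFDerivAt (fun z => (f z)⁻¹) (-(f y ^ 2)⁻¹ • f') y :=
  (hasDerivAt_inv h0).comp_hasFDerivAt y h

theorem hasFDerivAt_tau (hy : y ∈ intM) : HasFDerivAt tau (dTau y) y := by
  have := (hasFDerivAt_norm' (ne_zero_of_intM hy)).const_sub 1
  exact this

theorem hasFDerivAt_sT (hy : y ∈ intM) : HasFDerivAt sT ((-(tau y / sT y)) • dTau y) y := by
  have h1 : 1 - tau y ^ 2 ≠ 0 := by rw [← sT_sq hy]; exact (pow_pos (sT_pos hy) 2).ne'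
  have h := (((hasFDerivAt_tau hy).pow 2).const_sub 1).sqrt h1
  refine h.congr_fderiv ?_
  ext v
  simp [sT]
  ring

theorem hasFDerivAt_inner (q y : E4) : HasFDerivAt (fun z : E4 => ⟪q, z⟫_ℝ) (innerSL ℝ q) y :=
  (innerSL ℝ q).hasFDerivAt

theorem hasFDerivAt_cq (q : E4) (hy : y ∈ intM) : HasFDerivAt (cq q) (dC q y) y := by
  have h0 := hy.1
  have h := (hasFDerivAt_inner q y).mul
    (hasFDerivAt_inv_comp (hasFDerivAt_norm' (ne_zero_of_intM hy)) h0.ne')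
  have he : cq q = fun z => ⟪q, z⟫_ℝ * ‖z‖⁻¹ := by funext z; rw [cq_eq, div_eq_mul_inv]
  rw [he]
  refine h.congr_fderiv ?_
  ext v
  simp [dC_apply]
  field_simp
  ring

theorem hasFDerivAt_phi (hy : y ∈ intM) :
    HasFDerivAt phi ((1 / (sT y * tau y ^ 2)) • dTau y) y := by
  have hs := sT_pos hy
  have ht := tau_pos hy
  have h := (hasFDerivAt_sT hy).neg.mul (hasFDerivAt_inv_comp (hasFDerivAt_tau hy) ht.ne')
  have he : phi = fun z => -sT z * (tau z)⁻¹ := by funext z; rw [phi, div_eq_mul_inv]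
  rw [he]
  refine h.congr_fderiv ?_
  ext v
  simp
  field_simp
  linear_combination (dTau y v) * sT_sq hy

theorem hasFDerivAt_mu (hy : y ∈ intM) :
    HasFDerivAt mu ((mu y * (3 / ‖y‖ - 4 / tau y + tau y / sT y ^ 2)) • dTau y) y := by
  have hs := sT_pos hy
  have ht := tau_pos hy
  have h0 := hy.1
  have h := hasFDerivAt_inv_comp ((((hasFDerivAt_norm' (ne_zero_of_intM hy)).pow 3).mul
    ((hasFDerivAt_tau hy).pow 4)).mul (hasFDerivAt_sT hy))
    (mul_pos (mul_pos (pow_pos h0 3) (pow_pos ht 4)) hs).ne'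
  refine h.congr_fderiv ?_
  ext v
  simp [dTau_apply, mu]
  field_simp
  ring

theorem hasFDerivAt_Nf (hy : y ∈ intM) :
    HasFDerivAt Nf ((-(sT y / ‖y‖)) • ContinuousLinearMap.id ℝ E4
      + (-(tau y / (sT y * ‖y‖ ^ 2) - sT y / ‖y‖ ^ 3)) • (innerSL ℝ y).smulRight y) y := by
  have hs := sT_pos hy
  have h0 := hy.1
  have h := ((hasFDerivAt_sT hy).mul
    (hasFDerivAt_inv_comp (hasFDerivAt_norm' (ne_zero_of_intM hy)) h0.ne')).neg.smul (hasFDerivAt_id y)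
  have he : Nf = fun z => (-(sT z * ‖z‖⁻¹)) • z := by funext z; rw [Nf, div_eq_mul_inv]
  rw [he]
  refine h.congr_fderiv ?_
  ext1 v
  simp [dTau_apply]
  match_scalars <;> field_simp
  ring

theorem hasFDerivAt_Tf (q : E4) (hy : y ∈ intM) :
    HasFDerivAt (Tf q) ((dC q y).smulRight (-y) + (⟪q, y⟫_ℝ / ‖y‖) • (-ContinuousLinearMap.id ℝ E4)
      + (innerSL ℝ y).smulRight (‖y‖⁻¹ • q)) y := by
  have h0 := hy.1
  have h := ((hasFDerivAt_norm' (ne_zero_of_intM hy)).smul_const q).sub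
    ((hasFDerivAt_cq q hy).smul (hasFDerivAt_id y))
  have he : Tf q = fun z => ‖z‖ • q - cq q z • z := by funext z; rw [Tf, cq_eq]
  rw [he]
  refine h.congr_fderiv ?_
  ext1 v
  simp [cq_eq]
  module

theorem dTau_Nf (hy : y ∈ intM) : dTau y (Nf y) = sT y := by
  have h0 := hy.1
  simp only [dTau_apply, Nf, inner_smul_right, real_inner_self_eq_norm_sq]
  field_simp

theorem dTau_Tf (q : E4) (hy : y ∈ intM) : dTau y (Tf q y) = 0 := by
  have h0 := hy.1
  simp only [dTau_apply, Tf, inner_sub_right, inner_smul_right, real_inner_self_eq_norm_sq,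
    real_inner_comm y q]
  field_simp
  ring

theorem dC_Nf (q : E4) (hy : y ∈ intM) : dC q y (Nf y) = 0 := by
  have h0 := hy.1
  simp only [dC_apply, Nf, inner_smul_right, real_inner_self_eq_norm_sq]
  field_simp
  ring

theorem dC_Tf (p q : E4) (hy : y ∈ intM) :
    dC p y (Tf q y) = ⟪p, q⟫_ℝ - cq p y * cq q y := by
  have h0 := hy.1
  simp only [dC_apply, Tf, cq_eq, inner_sub_right, inner_smul_right, real_inner_self_eq_norm_sq,
    real_inner_comm y q]
  field_simp
  ring

theorem inner_Tf (q : E4) (hy : y ∈ intM) : ⟪y, Tf q y⟫_ℝ = 0 := by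
  have h0 := hy.1
  simp only [Tf, inner_sub_right, inner_smul_right, real_inner_self_eq_norm_sq,
    real_inner_comm y q]
  field_simp
  ring

theorem fderiv_Nf_Tf (q : E4) (hy : y ∈ intM) :
    fderiv ℝ Nf y (Tf q y) = -(sT y / ‖y‖) • Tf q y := by
  rw [(hasFDerivAt_Nf hy).fderiv]
  simp [inner_Tf q hy]

/-- The value agrees with `fderiv_Nf_Tf`: N and T_q commute, because T_q acts on the sphere factor
only. -/
theorem fderiv_Tf_Nf (q : E4) (hy : y ∈ intM) :
    fderiv ℝ (Tf q) y (Nf y) = -(sT y / ‖y‖) • Tf q y := by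
  have h0 := hy.1
  have hs := sT_pos hy
  rw [(hasFDerivAt_Tf q hy).fderiv]
  simp [dC_Nf q hy]
  simp [Nf, Tf, inner_smul_right]
  match_scalars <;> field_simp

/-- The left side is the commutator of T_p and T_q. It is needed when Ψ(T_q, T_p) is written through
derivatives of frame components. -/
theorem fderiv_Tf_Tf (p q : E4) (hy : y ∈ intM) :
    fderiv ℝ (Tf q) y (Tf p y) - fderiv ℝ (Tf p) y (Tf q y)
      = cq p y • Tf q y - cq q y • Tf p y := by
  have h0 := hy.1
  rw [(hasFDerivAt_Tf q hy).fderiv, (hasFDerivAt_Tf p hy).fderiv]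
  simp [dC_Tf _ _ hy, inner_Tf _ hy, real_inner_comm p q, ← cq_eq]
  module

theorem divg_Nf (hy : y ∈ intM) :
    divg Nf y = -(3 * (sT y / ‖y‖)) - tau y / sT y := by
  have h0 := hy.1
  have hs := sT_pos hy
  rw [divg, (hasFDerivAt_Nf hy).fderiv, trE_add, trE_smul, trE_smul, trE_id, trE_smulRight]
  simp
  field_simp
  ring

theorem divg_Tf (q : E4) (hy : y ∈ intM) : divg (Tf q) y = -3 * cq q y := by
  have h0 := hy.1
  rw [divg, (hasFDerivAt_Tf q hy).fderiv, trE_add, trE_add, trE_smul, trE_smulRight, trE_smulRight,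
    trE_neg, trE_id, map_neg, dC_apply, cq_eq]
  simp [real_inner_comm y q]
  field_simp
  ring

/-! # The background metric -/

/-- The coefficient of the Euclidean metric in the de Sitter metric. -/
def bA (Λ : ℝ) (y : E4) : ℝ := (3 / Λ) * ((tau y ^ 2)⁻¹ * (‖y‖ ^ 2)⁻¹)

/-- The coefficient of `⟨y, dy⟩²` in the de Sitter metric. -/
def bB (Λ : ℝ) (y : E4) : ℝ :=
  -((3 / Λ) * ((tau y ^ 2)⁻¹ * ((‖y‖ ^ 3 * (2 - ‖y‖))⁻¹ + (‖y‖ ^ 4)⁻¹)))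

theorem fderiv_psi (hy : y ∈ intM) (v : E4) :
    fderiv ℝ psi y v = ‖y‖⁻¹ • v - (⟪y, v⟫_ℝ / ‖y‖ ^ 3) • y := by
  have h0 := hy.1
  have h : HasFDerivAt psi _ y := (hasFDerivAt_inv_comp (hasFDerivAt_norm' (ne_zero_of_intM hy))
    h0.ne').smul (hasFDerivAt_id y)
  rw [h.fderiv]
  simp
  match_scalars <;> field_simp

theorem two_sub_norm_pos (hy : y ∈ intM) : 0 < 2 - ‖y‖ := by linarith [hy.2]

theorem deSitter_apply (Λ : ℝ) (hy : y ∈ intM) (v w : E4) :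
    deSitter Λ y v w = bA Λ y * ⟪v, w⟫_ℝ + bB Λ y * (⟪y, v⟫_ℝ * ⟪y, w⟫_ℝ) := by
  have h0 := hy.1
  have ht := tau_pos hy
  have h2 := two_sub_norm_pos hy
  have hs : 1 - tau y ^ 2 = ‖y‖ * (2 - ‖y‖) := by rw [tau]; ring
  simp only [deSitter, sq, pullInner, _root_.smul_apply, _root_.add_apply,
    ContinuousLinearMap.smulRight_apply, ContinuousLinearMap.bilinearComp_apply, innerSL_apply_apply,
    fderiv_psi hy, (hasFDerivAt_tau hy).fderiv, dTau_apply, smul_eq_mul, hs, inner_sub_left,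
    inner_sub_right, inner_smul_left, inner_smul_right, real_inner_self_eq_norm_sq, bA, bB,
    real_inner_comm y v]
  simp
  field_simp
  ring

/-- The coefficients of the Christoffel symbols of the de Sitter metric. -/
def g1 (y : E4) : ℝ := ((tau y)⁻¹ - ‖y‖⁻¹) * ‖y‖⁻¹

/-- The coefficient of `⟨u, v⟩ y` in the Christoffel symbols of the de Sitter metric. -/
def g2 (y : E4) : ℝ := 2 * (‖y‖ ^ 3)⁻¹ + (2 - ‖y‖) * g1 y * ‖y‖⁻¹

/-- The coefficient of `⟨y, u⟩ ⟨y, v⟩ y` in the Christoffel symbols of the de Sitter metric. -/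
def g3 (y : E4) : ℝ :=
  ((4 * (‖y‖ ^ 3)⁻¹ * (tau y)⁻¹ + (‖y‖ ^ 3)⁻¹ - 8 * (‖y‖ ^ 4)⁻¹ + (‖y‖ ^ 2 * (2 - ‖y‖))⁻¹)
    * (2 * ‖y‖)⁻¹ - 4 * g1 y * (‖y‖ ^ 3)⁻¹)

/-- The Christoffel symbols of the de Sitter metric. -/
def GamB (y : E4) : E4 →L[ℝ] E4 →L[ℝ] E4 :=
  g1 y • ((innerSL ℝ y).smulRight (ContinuousLinearMap.id ℝ E4)
      + ((innerSL ℝ y).smulRight (ContinuousLinearMap.id ℝ E4)).flip)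
    + g2 y • (∑ i, (pr i).smulRight ((pr i).smulRight y))
    + g3 y • (innerSL ℝ y).smulRight ((innerSL ℝ y).smulRight y)

theorem GamB_apply (y u v : E4) : GamB y u v = g1 y • (⟪y, u⟫_ℝ • v + ⟪y, v⟫_ℝ • u)
    + (g2 y * ⟪u, v⟫_ℝ + g3 y * (⟪y, u⟫_ℝ * ⟪y, v⟫_ℝ)) • y := by
  have h : (∑ i, (pr i).smulRight ((pr i).smulRight y)) u v = ⟪u, v⟫_ℝ • y := by
    simp [PiLp.inner_apply, Finset.sum_smul, smul_smul, mul_comm]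
  simp only [GamB, _root_.add_apply, _root_.smul_apply, h]
  simp
  module

theorem hasFDerivAt_bA (Λ : ℝ) (hy : y ∈ intM) :
    HasFDerivAt (bA Λ) ((bA Λ y * (2 / ‖y‖ - 2 / tau y)) • dTau y) y := by
  have h0 := hy.1
  have ht := tau_pos hy
  have h := ((hasFDerivAt_inv_comp ((hasFDerivAt_tau hy).pow 2) (by positivity)).mul
    (hasFDerivAt_inv_comp ((hasFDerivAt_norm' (ne_zero_of_intM hy)).pow 2)
      (by positivity))).const_mul (3 / Λ)
  refine h.congr_fderiv ?_
  ext v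
  simp [dTau_apply, bA]
  field_simp
  ring

/-- The radial derivative of `bB`. -/
def bB' (Λ : ℝ) (y : E4) : ℝ :=
  2 * bB Λ y * (tau y)⁻¹ - (3 / Λ) * ((tau y ^ 2)⁻¹ * (-3 * (‖y‖ ^ 4 * (2 - ‖y‖))⁻¹
    + (‖y‖ ^ 3 * (2 - ‖y‖) ^ 2)⁻¹ - 4 * (‖y‖ ^ 5)⁻¹))

theorem hasFDerivAt_bB (Λ : ℝ) (hy : y ∈ intM) :
    HasFDerivAt (bB Λ) (-bB' Λ y • dTau y) y := by
  have h0 := hy.1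
  have ht := tau_pos hy
  have h2 := two_sub_norm_pos hy
  have hn := hasFDerivAt_norm' (ne_zero_of_intM hy)
  have h := (((hasFDerivAt_inv_comp ((hasFDerivAt_tau hy).pow 2) (pow_pos ht 2).ne').mul
    ((hasFDerivAt_inv_comp ((hn.pow 3).mul (hn.const_sub 2)) (mul_pos (pow_pos h0 3) h2).ne').add
      (hasFDerivAt_inv_comp (hn.pow 4) (pow_pos h0 4).ne'))).const_mul (3 / Λ)).neg
  refine h.congr_fderiv ?_
  ext v
  simp [dTau_apply, bB', bB]
  field_simp
  ring

theorem contDiffAt_bA (Λ : ℝ) (hy : y ∈ intM) : ContDiffAt ℝ ∞ (bA Λ) y := by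
  have h0 := hy.1
  have ht := tau_pos hy
  have hn : ContDiffAt ℝ ∞ (fun z : E4 => ‖z‖) y := contDiffAt_norm ℝ (ne_zero_of_intM hy)
  have hτ : ContDiffAt ℝ ∞ tau y := contDiffAt_const.sub hn
  exact contDiffAt_const.mul (((hτ.pow 2).inv (pow_pos ht 2).ne').mul
    ((hn.pow 2).inv (pow_pos h0 2).ne'))

theorem contDiffAt_bB (Λ : ℝ) (hy : y ∈ intM) : ContDiffAt ℝ ∞ (bB Λ) y := by
  have h0 := hy.1
  have ht := tau_pos hy
  have h2 := two_sub_norm_pos hy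
  have hn : ContDiffAt ℝ ∞ (fun z : E4 => ‖z‖) y := contDiffAt_norm ℝ (ne_zero_of_intM hy)
  have hτ : ContDiffAt ℝ ∞ tau y := contDiffAt_const.sub hn
  exact (contDiffAt_const.mul (((hτ.pow 2).inv (pow_pos ht 2).ne').mul
    ((((hn.pow 3).mul (contDiffAt_const.sub hn)).inv (mul_pos (pow_pos h0 3) h2).ne').add
    ((hn.pow 4).inv (pow_pos h0 4).ne')))).neg

theorem contDiffOn_deSitter (Λ : ℝ) : ContDiffOn ℝ ∞ (deSitter Λ) intM := by
  rw [contDiffOn_clm_apply]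
  intro v
  rw [contDiffOn_clm_apply]
  intro w
  refine ContDiffOn.congr (f := fun y => bA Λ y * ⟪v, w⟫_ℝ + bB Λ y * (⟪y, v⟫_ℝ * ⟪y, w⟫_ℝ)) ?_
    fun y hy => deSitter_apply Λ hy v w
  intro y hy
  refine ContDiffAt.contDiffWithinAt ?_
  exact ((contDiffAt_bA Λ hy).mul contDiffAt_const).add ((contDiffAt_bB Λ hy).mul
    ((contDiffAt_id.inner ℝ contDiffAt_const).mul (contDiffAt_id.inner ℝ contDiffAt_const)))

theorem differentiableAt_deSitter (Λ : ℝ) (hy : y ∈ intM) : DifferentiableAt ℝ (deSitter Λ) y :=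
  ((contDiffOn_deSitter Λ).contDiffAt (isOpen_intM.mem_nhds hy)).differentiableAt (by simp)

theorem fderiv_deSitter (Λ : ℝ) (hy : y ∈ intM) (u v w : E4) :
    fderiv ℝ (deSitter Λ) y u v w = bA Λ y * (2 / ‖y‖ - 2 / tau y) * dTau y u * ⟪v, w⟫_ℝ
      - bB' Λ y * dTau y u * (⟪y, v⟫_ℝ * ⟪y, w⟫_ℝ)
      + bB Λ y * (⟪u, v⟫_ℝ * ⟪y, w⟫_ℝ + ⟪y, v⟫_ℝ * ⟪u, w⟫_ℝ) := by
  have h1 := (((differentiableAt_deSitter Λ hy).hasFDerivAt.clm_apply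
    (hasFDerivAt_const v y)).clm_apply (hasFDerivAt_const w y))
  have h2 := ((hasFDerivAt_bA Λ hy).mul_const ⟪v, w⟫_ℝ).add ((hasFDerivAt_bB Λ hy).mul
    (((hasFDerivAt_id y).inner ℝ (hasFDerivAt_const v y)).mul
      ((hasFDerivAt_id y).inner ℝ (hasFDerivAt_const w y))))
  have h3 := h2.congr_of_eventuallyEq (f₁ := fun z => deSitter Λ z v w) (by
    filter_upwards [isOpen_intM.mem_nhds hy] with z hz
    simp [deSitter_apply Λ hz])
  have h4 := congrArg (fun A => A u) (h1.unique h3)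
  simp at h4
  rw [h4]
  ring

/-- The coefficients `g1`, `g2`, `g3` solve the Koszul equation for a metric of the form A ⟨·,·⟩ + B
⟨y,·⟩² with radial A and B; only this verification is needed, since `GamB` enters solely through its
Koszul formula and explicit value. -/
theorem koszul_deSitter (Λ : ℝ) (hy : y ∈ intM) (u v w : E4) :
    deSitter Λ y (GamB y u v) w = koszul (fderiv ℝ (deSitter Λ) y) u v w := by
  have h0 := hy.1
  have ht := tau_pos hy
  have h2 := two_sub_norm_pos hy
  simp only [koszul, fderiv_deSitter Λ hy, deSitter_apply Λ hy, GamB_apply, dTau_apply,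
    inner_add_left, inner_add_right, inner_smul_left, inner_smul_right,
    real_inner_self_eq_norm_sq, real_inner_comm v u, real_inner_comm w u, real_inner_comm w v]
  simp [bA, bB, bB', g1, g2, g3]
  generalize ⟪y, u⟫_ℝ = yu
  generalize ⟪y, v⟫_ℝ = yv
  generalize ⟪y, w⟫_ℝ = yw
  have ht' : tau y = 1 - ‖y‖ := rfl
  rw [ht'] at ht ⊢
  generalize ‖y‖ = r at *
  field_simp
  ring

theorem GamB_symm (y u v : E4) : GamB y u v = GamB y v u := by
  rw [GamB_apply, GamB_apply, real_inner_comm v u]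
  module

/-- De Sitter space is a warped product over the τ-interval, and N is the unit time direction scaled
by the warping function 1/τ up to a constant. Such a field is closed and conformal. -/
theorem nabla_Nf (hy : y ∈ intM) (u : E4) :
    fderiv ℝ Nf y u + GamB y u (Nf y) = phi y • u := by
  have h0 := hy.1
  have ht := tau_pos hy
  have h2 := two_sub_norm_pos hy
  have hs := sT_pos hy
  have hss := sT_sq' hy
  rw [(hasFDerivAt_Nf hy).fderiv, GamB_apply]
  simp [Nf, inner_smul_right, phi, real_inner_comm y u]
  have ht' : tau y = 1 - ‖y‖ := rfl
  have e1 : -(sT y / ‖y‖) + g1 y * (-(sT y / ‖y‖) * ‖y‖ ^ 2) = -sT y / tau y := by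
    simp only [g1]; rw [ht'] at ht ⊢; field_simp; ring
  have e2 : (-(tau y / (sT y * ‖y‖ ^ 2) - sT y / ‖y‖ ^ 3) * ⟪y, u⟫_ℝ
    + g1 y * ⟪y, u⟫_ℝ * (-(sT y / ‖y‖)) + (g2 y * (-(sT y / ‖y‖) * ⟪y, u⟫_ℝ)
      + g3 y * (⟪y, u⟫_ℝ * (-(sT y / ‖y‖) * ‖y‖ ^ 2)))) = 0 := by
    -- Moving `sT` to the numerator by sT² = ‖y‖ (2 - ‖y‖) makes the identity linear in `sT`.
    have : tau y / (sT y * ‖y‖ ^ 2) = tau y * sT y / (‖y‖ ^ 3 * (2 - ‖y‖)) := by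
      field_simp; rw [hss]
    rw [this]
    simp only [g1, g2, g3]
    rw [ht'] at ht ⊢
    field_simp
    ring
  match_scalars
  · linear_combination e1
  · linear_combination e2

/-- The trace of the Christoffel symbols is the logarithmic differential of the volume density: the
coefficient is the one in `hasFDerivAt_mu`. This lets `mu` absorb the background Christoffel terms
in a Euclidean divergence. -/
theorem trG_GamB (hy : y ∈ intM) (v : E4) :
    trG (GamB y) v = (3 / ‖y‖ - 4 / tau y + tau y / sT y ^ 2) * dTau y v := by
  have h0 := hy.1
  have ht := tau_pos hy
  have h2 := two_sub_norm_pos hy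
  have hs := sT_pos hy
  have hss := sT_sq' hy
  have : (GamB y).flip v = g1 y • ((innerSL ℝ y).smulRight v + ⟪y, v⟫_ℝ • ContinuousLinearMap.id ℝ E4)
    + (g2 y • innerSL ℝ v + (g3 y * ⟪y, v⟫_ℝ) • innerSL ℝ y).smulRight y := by
    ext1 u
    simp [GamB_apply, real_inner_comm v u]
    module
  rw [trG, this, trE_add, trE_smul, trE_add, trE_smulRight, trE_smul, trE_id, trE_smulRight, hss]
  simp [dTau_apply, real_inner_comm y v, g1, g2, g3]
  have ht' : tau y = 1 - ‖y‖ := rfl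
  rw [ht'] at ht ⊢
  field_simp
  ring

/-- On the sphere the Hessian of ⟨q, ψ⟩ is -⟨q, ψ⟩ times the metric, which gives the first term. The
other terms come from the warping; for u = N they combine to ∇_N T_q = φ T_q. -/
theorem nabla_Tf (q : E4) (hy : y ∈ intM) (u : E4) :
    fderiv ℝ (Tf q) y u + GamB y u (Tf q y) = -cq q y • u
      + (dTau y u / sT y) • (cq q y • Nf y + phi y • Tf q y) + (phi y * dC q y u) • Nf y := by
  have h0 := hy.1
  have ht := tau_pos hy
  have h2 := two_sub_norm_pos hy
  have hs := sT_pos hy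
  have hss := sT_sq' hy
  have ht' : tau y = 1 - ‖y‖ := rfl
  rw [(hasFDerivAt_Tf q hy).fderiv, GamB_apply, inner_Tf q hy]
  simp only [Tf, Nf, phi, cq_eq, dC_apply, dTau_apply, g1, g2]
  simp [inner_sub_right, inner_smul_right, real_inner_comm y u, dC_apply, real_inner_comm u q]
  match_scalars
  · have e : ∀ X, -(-sT y / tau y * X * (sT y / ‖y‖ * 1)) = ‖y‖ * (2 - ‖y‖) / (tau y * ‖y‖) * X := by
      intro X; rw [← hss]; field_simp
    rw [e, ht']
    rw [ht'] at ht
    field_simp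
    ring
  · rfl
  · field_simp
    ring

/-- This and `deSitter_Tf` identify the covectors dual to N and T_q. Inverted, they turn dτ and
d⟨q,ψ⟩ of a vector into inner products with N and T_q. -/
theorem deSitter_Nf (Λ : ℝ) (hy : y ∈ intM) (v : E4) :
    deSitter Λ y (Nf y) v = -((3 / Λ) / (tau y ^ 2 * sT y)) * dTau y v := by
  have h0 := hy.1
  have ht := tau_pos hy
  have h2 := two_sub_norm_pos hy
  have hs := sT_pos hy
  have hss := sT_sq' hy
  have : (3 / Λ) / (tau y ^ 2 * sT y) = (3 / Λ) * sT y / (tau y ^ 2 * (‖y‖ * (2 - ‖y‖))) := by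
    rw [← hss]; field_simp
  rw [this, deSitter_apply Λ hy, dTau_apply, Nf]
  simp [inner_smul_left, inner_smul_right, bA, bB]
  field_simp
  ring

theorem deSitter_Tf (Λ : ℝ) (q : E4) (hy : y ∈ intM) (v : E4) :
    deSitter Λ y (Tf q y) v = ((3 / Λ) / tau y ^ 2) * dC q y v := by
  have h0 := hy.1
  have ht := tau_pos hy
  rw [deSitter_apply Λ hy, inner_Tf q hy]
  simp [Tf, inner_sub_left, inner_smul_left, bA, dC_apply]
  field_simp

end

end

end SdSGluing

namespace SdSGluing

noncomputable section

/-! # The trace-free part of `∇N` -/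

/-- The deviation `∇N - φ` of the covariant derivative of `N` from its de Sitter value. -/
def Sp (g : E4 → Bil) (y : E4) : E4 →L[ℝ] E4 := nab g Nf y - phi y • ContinuousLinearMap.id ℝ E4

/-- The bilinear form `g(∇N - φ, ·)`, in terms of `k = g - g_{dS}`. -/
def Psi (k : E4 → Bil) (y u w : E4) : ℝ :=
  koszul (fderiv ℝ k y) u (Nf y) w + k y (fderiv ℝ Nf y u - phi y • u) w

/-- The difference of the Christoffel symbols of `g` and of the de Sitter metric. -/
def dGam (g : E4 → Bil) (y : E4) : E4 →L[ℝ] E4 →L[ℝ] E4 := Gam g y - GamB y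

theorem deSitter_symm (Λ : ℝ) {y : E4} (hy : y ∈ intM) (v w : E4) :
    deSitter Λ y v w = deSitter Λ y w v := by
  rw [deSitter_apply Λ hy, deSitter_apply Λ hy, real_inner_comm v w]; ring

section

variable {Λ : ℝ} {O : Set E4} {g : E4 → Bil} {y : E4}

theorem IsEinstein.differentiableAt (hE : IsEinstein Λ O g) (hO : IsOpen O) (hy : y ∈ O ∩ intM) :
    DifferentiableAt ℝ g y :=
  (hE.1.contDiffAt ((hO.inter isOpen_intM).mem_nhds hy)).differentiableAt (by simp)

theorem IsEinstein.koszul_Gam (hE : IsEinstein Λ O g) (hO : IsOpen O) (hy : y ∈ O ∩ intM)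
    (u v w : E4) : g y (Gam g y u v) w = koszul (fderiv ℝ g y) u v w :=
  SdSGluing.koszul_Gam (hE.differentiableAt hO hy) (hE.2.1 y hy).1 (comps_isUnit_det (hE.2.1 y hy)) u v w

theorem fderiv_bil_apply {k : E4 → Bil} (hk : DifferentiableAt ℝ k y) (u v w : E4) :
    fderiv ℝ (fun z => k z v w) y u = fderiv ℝ k y u v w := by
  rw [((hk.hasFDerivAt.clm_apply (hasFDerivAt_const v y)).clm_apply
    (hasFDerivAt_const w y)).fderiv]
  simp

theorem koszul_sub_deSitter (hd : DifferentiableAt ℝ g y) (hy : y ∈ intM) (u v w : E4) :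
    koszul (fderiv ℝ (fun z => g z - deSitter Λ z) y) u v w
      = koszul (fderiv ℝ g y) u v w - koszul (fderiv ℝ (deSitter Λ) y) u v w := by
  have hd2 := differentiableAt_deSitter Λ hy
  have h : ∀ u v w, fderiv ℝ (fun z => g z - deSitter Λ z) y u v w
      = fderiv ℝ g y u v w - fderiv ℝ (deSitter Λ) y u v w := by
    intro u v w
    have hk : DifferentiableAt ℝ (fun z => g z - deSitter Λ z) y :=
      DifferentiableAt.fun_sub (𝕜 := ℝ) (E := E4) (F := Bil) hd hd2
    rw [← fderiv_bil_apply hk, ← fderiv_bil_apply hd, ← fderiv_bil_apply hd2]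
    have h1 := ((hd.clm_apply (differentiableAt_const v)).clm_apply (differentiableAt_const w))
    have h2 := ((hd2.clm_apply (differentiableAt_const v)).clm_apply (differentiableAt_const w))
    have := fderiv_fun_sub h1 h2
    simp only [_root_.sub_apply]
    rw [this]
    rfl
  simp only [koszul, h]
  ring

/-- Subtracting the Koszul formulas of g and of de Sitter, together with ∇N = φ for the latter,
leaves an expression linear in k. The index is lowered with g itself, so the formula is exact;
replacing g by the de Sitter metric later costs a quadratic term. -/
theorem metric_Sp (hE : IsEinstein Λ O g) (hO : IsOpen O) (hy : y ∈ O ∩ intM) (u w : E4) :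
    g y (Sp g y u) w = Psi (fun z => g z - deSitter Λ z) y u w := by
  have h1 := hE.koszul_Gam hO hy u (Nf y) w
  have h2 := koszul_deSitter Λ hy.2 u (Nf y) w
  have h3 : deSitter Λ y (fderiv ℝ Nf y u + GamB y u (Nf y)) w = deSitter Λ y (phi y • u) w := by
    rw [nabla_Nf hy.2]
  simp only [map_add, map_smul, _root_.add_apply, _root_.smul_apply, smul_eq_mul] at h3
  simp only [Psi, koszul_sub_deSitter (hE.differentiableAt hO hy) hy.2, Sp,
    nab_apply, _root_.sub_apply, _root_.smul_apply, map_sub, map_add, map_smul, _root_.add_apply,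
    ContinuousLinearMap.id_apply, smul_eq_mul]
  linear_combination h1 - h2 + h3

theorem metric_dGam (hE : IsEinstein Λ O g) (hO : IsOpen O) (hy : y ∈ O ∩ intM) (u v w : E4) :
    g y (dGam g y u v) w = koszul (fderiv ℝ (fun z => g z - deSitter Λ z) y) u v w
      - (g y - deSitter Λ y) (GamB y u v) w := by
  have h1 := hE.koszul_Gam hO hy u v w
  have h2 := koszul_deSitter Λ hy.2 u v w
  simp only [koszul_sub_deSitter (hE.differentiableAt hO hy) hy.2, dGam,
    _root_.sub_apply, map_sub]
  linear_combination h1 - h2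

theorem contDiffAt_Nf (hy : y ∈ intM) : ContDiffAt ℝ ∞ Nf y := by
  have hn : ContDiffAt ℝ ∞ (fun z : E4 => ‖z‖) y := contDiffAt_norm ℝ (ne_zero_of_intM hy)
  have hτ : ContDiffAt ℝ ∞ tau y := contDiffAt_const.sub hn
  have hs : ContDiffAt ℝ ∞ sT y := by
    refine (contDiffAt_const.sub (hτ.pow 2)).sqrt ?_
    have := sT_sq hy
    rw [← this]
    exact (pow_pos (sT_pos hy) 2).ne'
  exact ((hs.div hn hy.1.ne').neg).smul contDiffAt_id

theorem contDiffAt_phi (hy : y ∈ intM) : ContDiffAt ℝ ∞ phi y := by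
  have hn : ContDiffAt ℝ ∞ (fun z : E4 => ‖z‖) y := contDiffAt_norm ℝ (ne_zero_of_intM hy)
  have hτ : ContDiffAt ℝ ∞ tau y := contDiffAt_const.sub hn
  have hs : ContDiffAt ℝ ∞ sT y := by
    refine (contDiffAt_const.sub (hτ.pow 2)).sqrt ?_
    have := sT_sq hy
    rw [← this]
    exact (pow_pos (sT_pos hy) 2).ne'
  exact hs.neg.div hτ (tau_pos hy).ne'

theorem IsEinstein.contDiffAt_Sp (hE : IsEinstein Λ O g) (hO : IsOpen O) (hy : y ∈ O ∩ intM) :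
    ContDiffAt ℝ ∞ (Sp g) y := by
  have hopen := hO.inter isOpen_intM
  have hN : ContDiffOn ℝ ∞ Nf (O ∩ intM) := fun z hz => (contDiffAt_Nf hz.2).contDiffWithinAt
  have h : ContDiffOn ℝ ∞ (Sp g) (O ∩ intM) := by
    rw [contDiffOn_clm_apply]
    intro u
    simp only [Sp, _root_.sub_apply, nab_apply, _root_.smul_apply]
    refine ContDiffOn.sub (ContDiffOn.add ?_ ?_) ?_
    · exact (hN.fderiv_of_isOpen hopen (m := ∞) (by simp)).clm_apply contDiffOn_const
    · exact ((contDiffOn_Gam hopen hE.1 hE.2.1).clm_apply contDiffOn_const).clm_apply hN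
    · exact ContDiffOn.smul (fun z hz => (contDiffAt_phi hz.2).contDiffWithinAt) contDiffOn_const
  exact h.contDiffAt (hopen.mem_nhds hy)

theorem trG_smul (G : E4 →L[ℝ] E4 →L[ℝ] E4) (c : ℝ) (v : E4) : trG G (c • v) = c * trG G v := by
  rw [trG, map_smul, trE_smul]; rfl

theorem trG_add (G : E4 →L[ℝ] E4 →L[ℝ] E4) (v w : E4) : trG G (v + w) = trG G v + trG G w := by
  rw [trG, map_add, trE_add]; rfl

/-- The Einstein equation contracted with `N`, as an equation for `∇N - φ`. -/
theorem einstein_Sp (hΛ : 0 < Λ) (hE : IsEinstein Λ O g) (hO : IsOpen O) (hy : y ∈ O ∩ intM)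
    (u : E4) :
    trE ((fderiv ℝ (Sp g) y).flip u) - trE (fderiv ℝ (Sp g) y u)
      + trG (Gam g y) (Sp g y u) - trE ((Gam g y u).comp (Sp g y))
      = Λ * (g y - deSitter Λ y) u (Nf y) := by
  have hopen := hO.inter isOpen_intM
  have hG : DifferentiableAt ℝ (Gam g) y :=
    ((contDiffOn_Gam hopen hE.1 hE.2.1).contDiffAt (hopen.mem_nhds hy)).differentiableAt (by simp)
  have hr := ricci_nab hG ((contDiffAt_Nf hy.2).of_le (WithTop.coe_le_coe.2 (le_top : (2 : ℕ∞) ≤ ⊤))) u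
  have hric : ∑ i, ∑ j, ricci g i j y * (u i * Nf y j) = Λ * g y u (Nf y) := by
    rw [bil_eq_sum (g y) u, Finset.mul_sum]
    refine Finset.sum_congr rfl fun i _ => ?_
    rw [Finset.mul_sum]
    refine Finset.sum_congr rfl fun j _ => ?_
    linear_combination (u i * Nf y j) * (hE.2.2 y hy i j)
  have hnab : nab g Nf = fun z => Sp g z + phi z • ContinuousLinearMap.id ℝ E4 := by
    funext z; simp [Sp]
  have hd : fderiv ℝ (nab g Nf) y = fderiv ℝ (Sp g) y
      + (fderiv ℝ phi y).smulRight (ContinuousLinearMap.id ℝ E4) := by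
    rw [hnab]
    have h1 : DifferentiableAt ℝ (Sp g) y := (hE.contDiffAt_Sp hO hy).differentiableAt (by simp)
    have h2 := (hasFDerivAt_phi hy.2).differentiableAt.hasFDerivAt.smul_const
      (ContinuousLinearMap.id ℝ E4)
    exact (h1.hasFDerivAt.add h2).fderiv
  have hsymm : (Gam g y).flip u = Gam g y u := by
    ext1 v
    exact Gam_symm (Filter.eventually_of_mem (hopen.mem_nhds hy) fun z hz => (hE.2.1 z hz).1) v u
  have e1 : trE (((fderiv ℝ phi y).smulRight (ContinuousLinearMap.id ℝ E4)).flip u)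
      = fderiv ℝ phi y u := by
    have : ((fderiv ℝ phi y).smulRight (ContinuousLinearMap.id ℝ E4)).flip u
      = (fderiv ℝ phi y).smulRight u := by ext1 v; simp
    rw [this, trE_smulRight]
  have hflip : (fderiv ℝ (Sp g) y + (fderiv ℝ phi y).smulRight (ContinuousLinearMap.id ℝ E4)).flip u
      = (fderiv ℝ (Sp g) y).flip u
        + ((fderiv ℝ phi y).smulRight (ContinuousLinearMap.id ℝ E4)).flip u := by
    ext1 v; simp
  have e3 : nab g Nf y = Sp g y + phi y • ContinuousLinearMap.id ℝ E4 := congrFun hnab y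
  have e4 : (Gam g y u).comp (Sp g y + phi y • ContinuousLinearMap.id ℝ E4)
      = (Gam g y u).comp (Sp g y) + phi y • Gam g y u := by
    ext1 v; simp
  have e5 : fderiv ℝ phi y u = (1 / (sT y * tau y ^ 2)) * dTau y u := by
    rw [(hasFDerivAt_phi hy.2).fderiv]; simp
  have e6 := deSitter_Nf Λ hy.2 u
  rw [deSitter_symm Λ hy.2] at e6
  -- This is the de Sitter Einstein equation in direction N: the Ricci identity for ∇N = φ gives
  -- Ric(u, N) = -3 dφ(u). It cancels the background part of Λ g(u, N).
  have e7 : Λ * deSitter Λ y u (Nf y) = -3 * fderiv ℝ phi y u := by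
    rw [e6, e5]
    have := tau_pos hy.2
    have := sT_pos hy.2
    field_simp
  rw [hric, hd, hflip, trE_add, e1, e3, e4, trE_add, trE_smul] at hr
  simp only [_root_.add_apply, ContinuousLinearMap.smulRight_apply, trE_add, trE_smul, trE_id,
    trG_add, _root_.smul_apply, ContinuousLinearMap.id_apply, trG_smul] at hr
  have e8 : trG (Gam g y) u = trE (Gam g y u) := by rw [trG, hsymm]
  rw [e8] at hr
  rw [_root_.sub_apply, _root_.sub_apply, mul_sub, e7]
  linear_combination -hr

/-! # The divergence identity -/

/-- The vector field `μ ((∇N - φ) Y - tr(∇N - φ) Y)`. -/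
def flux (g : E4 → Bil) (Y : E4 → E4) (y : E4) : E4 :=
  Sp g y (mu y • Y y) - trE (Sp g y) • (mu y • Y y)

/-- With the density `mu`, the Euclidean divergence is the background covariant divergence, so Y
enters through its de Sitter covariant derivative. Since `einstein_Sp` involves the connection of g,
the difference `dGam` remains, always multiplied by S and hence quadratic. -/
theorem divg_flux (hΛ : 0 < Λ) (hE : IsEinstein Λ O g) (hO : IsOpen O) (hy : y ∈ O ∩ intM)
    {Y : E4 → E4} {Y' : E4 →L[ℝ] E4} (hY : HasFDerivAt Y Y' y) :
    divg (flux g Y) y = mu y * (Λ * (g y - deSitter Λ y) (Y y) (Nf y)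
      + trE ((Sp g y).comp (Y' + (GamB y).flip (Y y)))
      - trE (Sp g y) * trE (Y' + (GamB y).flip (Y y))
      - trG (dGam g y) (Sp g y (Y y)) + trE ((dGam g y (Y y)).comp (Sp g y))) := by
  have hS : HasFDerivAt (Sp g) (fderiv ℝ (Sp g) y) y :=
    ((hE.contDiffAt_Sp hO hy).differentiableAt (by simp)).hasFDerivAt
  have hZ := (hasFDerivAt_mu hy.2).smul hY
  have htr : HasFDerivAt (fun z => trE (Sp g z)) (trL.comp (fderiv ℝ (Sp g) y)) y :=
    hasFDerivAt_clm_apply trL hS.differentiableAt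
  have hX := (hS.clm_apply hZ).sub (htr.smul hZ)
  have hE' := einstein_Sp hΛ hE hO hy (mu y • Y y)
  have hmu : ∀ v, (mu y * (3 / ‖y‖ - 4 / tau y + tau y / sT y ^ 2)) * dTau y v
      = mu y * trG (GamB y) v := by
    intro v; rw [trG_GamB hy.2]; ring
  -- The derivative of `mu` becomes the trace of the background Christoffel symbols.
  have hdm : (mu y * (3 / ‖y‖ - 4 / tau y + tau y / sT y ^ 2)) • dTau y
    = mu y • (trL.comp ((GamB y).flip)) := by
    ext v; exact hmu v
  rw [hdm] at hX
  have : divg (flux g Y) y = _ := congrArg trE hX.fderiv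
  rw [this]
  have hcomp : ∀ A B C : E4 →L[ℝ] E4, A.comp (B + C) = A.comp B + A.comp C := fun A B C => by
    ext1; simp
  have hcomps : ∀ (A B : E4 →L[ℝ] E4) (c : ℝ), A.comp (c • B) = c • A.comp B := fun A B C => by
    ext1; simp
  have hcompr : ∀ (A : E4 →L[ℝ] E4) (α : E4 →L[ℝ] ℝ) (v : E4), A.comp (α.smulRight v)
    = α.smulRight (A v) := fun A α v => by ext1; simp
  have hsymm : (GamB y).flip (Y y) = GamB y (Y y) := by ext1 v; exact GamB_symm y v (Y y)
  have hc2 := trE_comp_comm (GamB y (Y y)) (Sp g y)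
  have hG : ∀ v, trG (Gam g y) v = trG (GamB y) v + trG (dGam g y) v := by
    intro v; simp only [trG, dGam, ← trE_add]; congr 1; ext1; simp
  have hG2 : (Gam g y (Y y)).comp (Sp g y) = (GamB y (Y y)).comp (Sp g y)
    + (dGam g y (Y y)).comp (Sp g y) := by ext1; simp [dGam]
  have htG : ∀ v, trL.comp ((GamB y).flip) v = trG (GamB y) v := fun v => rfl
  simp only [map_smul, _root_.smul_apply, ContinuousLinearMap.smul_comp, trG_smul, trE_smul, hG2,
    trE_add, hG] at hE'
  simp only [trE_add, trE_sub, trE_smul, hcomp, hcomps, hcompr, trE_smulRight,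
    ContinuousLinearMap.comp_apply, trL_apply, map_smul, hsymm, _root_.smul_apply, smul_eq_mul, htG, Pi.smul_apply']
  have htY : trG (GamB y) (Y y) = trE (GamB y (Y y)) := by rw [trG, hsymm]
  simp only [smul_eq_mul] at hE'
  linear_combination hE' + mu y * hc2 - mu y * trE (Sp g y) * htY

theorem dTau_eq_deSitter (hΛ : 0 < Λ) (hy : y ∈ intM) (v : E4) :
    dTau y v = -(Λ / 3 * tau y ^ 2 * sT y) * deSitter Λ y v (Nf y) := by
  have h1 := tau_pos hy
  have h2 := sT_pos hy
  rw [deSitter_symm Λ hy, deSitter_Nf Λ hy]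
  field_simp

theorem dC_eq_deSitter (hΛ : 0 < Λ) (p : E4) (hy : y ∈ intM) (v : E4) :
    dC p y v = (Λ / 3 * tau y ^ 2) * deSitter Λ y v (Tf p y) := by
  have h1 := tau_pos hy
  rw [deSitter_symm Λ hy, deSitter_Tf Λ p hy]
  field_simp

/-- In the hypotheses a and b are the derivatives of ζ and η along N, while P and Q represent their
tangential gradients. The background ∇Y is then a combination of the identity and rank-one terms,
whose traces against S are frame components of S. -/
theorem divg_flux_frame (hΛ : 0 < Λ) (hE : IsEinstein Λ O g) (hO : IsOpen O) (hy : y ∈ O ∩ intM)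
    (q : E4) {ζ η : E4 → ℝ} {a b : ℝ} {P Q : E4}
    (hζ : HasFDerivAt ζ ((a / sT y) • dTau y + dC P y) y)
    (hη : HasFDerivAt η ((b / sT y) • dTau y + dC Q y) y) :
    divg (flux g fun z => ζ z • Tf q z + η z • Nf z) y = mu y * (
      Λ * (ζ y * (g y - deSitter Λ y) (Nf y) (Tf q y) + η y * (g y - deSitter Λ y) (Nf y) (Nf y))
      + Λ / 3 * tau y ^ 2 * (
        - (a + phi y * ζ y) * deSitter Λ y (Sp g y (Tf q y)) (Nf y)
        + deSitter Λ y (Sp g y (Tf q y)) (Tf P y)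
        - (b + ζ y * cq q y) * deSitter Λ y (Sp g y (Nf y)) (Nf y)
        + deSitter Λ y (Sp g y (Nf y)) (Tf Q y)
        + ζ y * phi y * deSitter Λ y (Sp g y (Nf y)) (Tf q y))
      - trE (Sp g y) * (dC P y (Tf q y) + b + 3 * phi y * η y - 2 * cq q y * ζ y)
      - trG (dGam g y) (Sp g y (ζ y • Tf q y + η y • Nf y))
      + trE ((dGam g y (ζ y • Tf q y + η y • Nf y)).comp (Sp g y))) := by
  have ht := tau_pos hy.2
  have hs := sT_pos hy.2
  have hT := (hasFDerivAt_Tf q hy.2).differentiableAt.hasFDerivAt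
  have hN := (hasFDerivAt_Nf hy.2).differentiableAt.hasFDerivAt
  have hY := (hζ.smul hT).add (hη.smul hN)
  have hmain := divg_flux hΛ hE hO hy hY
  have hnab : (ζ y • fderiv ℝ (Tf q) y + ((a / sT y) • dTau y + dC P y).smulRight (Tf q y)
      + (η y • fderiv ℝ Nf y + ((b / sT y) • dTau y + dC Q y).smulRight (Nf y)))
      + (GamB y).flip (ζ y • Tf q y + η y • Nf y)
      = ((a / sT y) • dTau y + dC P y).smulRight (Tf q y)
        + ((b / sT y) • dTau y + dC Q y).smulRight (Nf y)
        + (ζ y • (-cq q y • ContinuousLinearMap.id ℝ E4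
          + ((1 / sT y) • dTau y).smulRight (cq q y • Nf y + phi y • Tf q y)
          + (phi y • dC q y).smulRight (Nf y)) + (η y * phi y) • ContinuousLinearMap.id ℝ E4) := by
    ext1 u
    have h1 := nabla_Tf q hy.2 u
    have h2 := nabla_Nf hy.2 u
    simp only [_root_.add_apply, _root_.smul_apply, ContinuousLinearMap.smulRight_apply,
      ContinuousLinearMap.flip_apply, map_add, map_smul, ContinuousLinearMap.id_apply]
    have h3 := congrArg (fun v => ζ y • v) h1
    have h4 := congrArg (fun v => η y • v) h2
    simp only [smul_add] at h3 h4
    have h5 := congrArg₂ (· + ·) h3 h4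
    rw [← sub_eq_zero] at h5 ⊢
    rw [← h5]
    module
  have hcomp : ∀ A B C : E4 →L[ℝ] E4, A.comp (B + C) = A.comp B + A.comp C := fun A B C => by
    ext1; simp
  have hcomps : ∀ (A B : E4 →L[ℝ] E4) (c : ℝ), A.comp (c • B) = c • A.comp B := fun A B C => by
    ext1; simp
  have hcompr : ∀ (A : E4 →L[ℝ] E4) (α : E4 →L[ℝ] ℝ) (v : E4), A.comp (α.smulRight v)
    = α.smulRight (A v) := fun A α v => by ext1; simp
  have hid : (Sp g y).comp (ContinuousLinearMap.id ℝ E4) = Sp g y := by ext1; simp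
  refine hmain.trans ?_
  simp only [Pi.add_apply, Pi.smul_apply'] at *
  rw [hnab]
  simp only [trE_add, trE_smul, hcomp, hcomps, hcompr, trE_smulRight, trE_id, hid, _root_.add_apply,
    _root_.smul_apply, smul_eq_mul, map_add, map_smul, dTau_Nf hy.2, dTau_Tf q hy.2, dC_Nf _ hy.2]
  simp only [dTau_eq_deSitter hΛ hy.2 (Sp g y _), dC_eq_deSitter hΛ _ hy.2 (Sp g y _)]
  have hk : ∀ v, (g y - deSitter Λ y) v (Nf y) = (g y - deSitter Λ y) (Nf y) v := by
    intro v
    simp only [_root_.sub_apply]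
    rw [deSitter_symm Λ hy.2, (hE.2.1 y hy).1]
  rw [hk (Tf q y)]
  field_simp
  ring

end

end

end SdSGluing

namespace SdSGluing

noncomputable section

/-! # Frame components of the perturbation -/

/-- The trace of a bilinear form with respect to the de Sitter metric. -/
def trV (Λ : ℝ) (y : E4) (f : E4 → E4 → ℝ) : ℝ :=
  Λ / 3 * (tau y ^ 2 * ‖y‖ ^ 2) * (∑ i, f (ev i) (ev i) - 2 / ‖y‖ ^ 3 * f y y)

section

variable {Λ : ℝ} {y : E4}

/-- The inverse de Sitter metric is a multiple of I - 2 y yᵀ/‖y‖³, the second term accounting for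
the timelike radial direction; `trV` contracts with it. -/
theorem trE_eq_trV (hΛ : 0 < Λ) (hy : y ∈ intM) (A : E4 →L[ℝ] E4) :
    trE A = trV Λ y fun u v => deSitter Λ y (A u) v := by
  have h0 := hy.1
  have ht := tau_pos hy
  have h2 := two_sub_norm_pos hy
  have e1 : ∑ i, deSitter Λ y (A (ev i)) (ev i) = bA Λ y * trE A + bB Λ y * ⟪y, A y⟫_ℝ := by
    have : ⟪y, A y⟫_ℝ = ∑ i, y i * ⟪y, A (ev i)⟫_ℝ := by
      rw [map_eq_sum A y, inner_sum]
      simp [inner_smul_right]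
    rw [this, trE, Finset.mul_sum, Finset.mul_sum, ← Finset.sum_add_distrib]
    refine Finset.sum_congr rfl fun i _ => ?_
    rw [deSitter_apply Λ hy, real_inner_comm (ev i) (A (ev i)), inner_ev,
      real_inner_comm (ev i) y, inner_ev]
    ring
  have e2 : deSitter Λ y (A y) y = (bA Λ y + bB Λ y * ‖y‖ ^ 2) * ⟪y, A y⟫_ℝ := by
    rw [deSitter_apply Λ hy, real_inner_comm y (A y), real_inner_self_eq_norm_sq]; ring
  rw [trV, e1, e2]
  simp only [bA, bB]
  generalize trE A = t
  generalize ⟪y, A y⟫_ℝ = x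
  have ht' : tau y = 1 - ‖y‖ := rfl
  rw [ht'] at ht ⊢
  field_simp
  ring

theorem hasFDerivAt_bil_apply {k : E4 → Bil} (hk : DifferentiableAt ℝ k y) {A B : E4 → E4}
    (hA : DifferentiableAt ℝ A y) (hB : DifferentiableAt ℝ B y) :
    ∃ D : E4 →L[ℝ] ℝ, HasFDerivAt (fun z => k z (A z) (B z)) D y ∧ ∀ u, D u =
      fderiv ℝ k y u (A y) (B y) + k y (fderiv ℝ A y u) (B y) + k y (A y) (fderiv ℝ B y u) := by
  refine ⟨_, (hk.hasFDerivAt.clm_apply hA.hasFDerivAt).clm_apply hB.hasFDerivAt, fun u => ?_⟩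
  simp
  ring

theorem fderiv_bil_apply' {k : E4 → Bil} (hk : DifferentiableAt ℝ k y) {A B : E4 → E4}
    (hA : DifferentiableAt ℝ A y) (hB : DifferentiableAt ℝ B y) (u : E4) :
    fderiv ℝ (fun z => k z (A z) (B z)) y u =
      fderiv ℝ k y u (A y) (B y) + k y (fderiv ℝ A y u) (B y) + k y (A y) (fderiv ℝ B y u) := by
  obtain ⟨D, h1, h2⟩ := hasFDerivAt_bil_apply hk hA hB
  rw [h1.fderiv, h2]

variable {k : E4 → Bil}

theorem fderiv_bil_symm (hk : DifferentiableAt ℝ k y) (hs : ∀ᶠ z in 𝓝 y, IsSymm (k z))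
    (u v w : E4) : fderiv ℝ k y u v w = fderiv ℝ k y u w v := by
  rw [← fderiv_bil_apply hk, ← fderiv_bil_apply hk]
  have : (fun z => k z v w) =ᶠ[𝓝 y] fun z => k z w v := by
    filter_upwards [hs] with z hz using hz v w
  rw [this.fderiv_eq]

theorem differentiableAt_Nf (hy : y ∈ intM) : DifferentiableAt ℝ Nf y :=
  (hasFDerivAt_Nf hy).differentiableAt

theorem differentiableAt_Tf (q : E4) (hy : y ∈ intM) : DifferentiableAt ℝ (Tf q) y :=
  (hasFDerivAt_Tf q hy).differentiableAt

/-- The frame formulas for Ψ isolate derivatives of scalar components of k, which can then be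
integrated by parts. Derivatives falling on the frame cancel against the zeroth-order term of Ψ up
to multiples of φ. -/
theorem Psi_Nf_Nf (hk : DifferentiableAt ℝ k y) (hs : ∀ᶠ z in 𝓝 y, IsSymm (k z)) (hy : y ∈ intM) :
    Psi k y (Nf y) (Nf y) = (1 / 2) * fderiv ℝ (fun z => k z (Nf z) (Nf z)) y (Nf y)
      - phi y * k y (Nf y) (Nf y) := by
  rw [fderiv_bil_apply' hk (differentiableAt_Nf hy) (differentiableAt_Nf hy), Psi, koszul,
    hs.self_of_nhds (Nf y) (fderiv ℝ Nf y (Nf y))]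
  simp
  ring

theorem Psi_Tf_Nf (hk : DifferentiableAt ℝ k y) (hs : ∀ᶠ z in 𝓝 y, IsSymm (k z)) (hy : y ∈ intM)
    (q : E4) :
    Psi k y (Tf q y) (Nf y) = (1 / 2) * fderiv ℝ (fun z => k z (Nf z) (Nf z)) y (Tf q y)
      - phi y * k y (Nf y) (Tf q y) := by
  rw [fderiv_bil_apply' hk (differentiableAt_Nf hy) (differentiableAt_Nf hy), Psi, koszul,
    hs.self_of_nhds (Nf y) (fderiv ℝ Nf y (Tf q y)), hs.self_of_nhds (Nf y) (Tf q y)]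
  simp
  ring

theorem Psi_Nf_Tf (hk : DifferentiableAt ℝ k y) (hs : ∀ᶠ z in 𝓝 y, IsSymm (k z)) (hy : y ∈ intM)
    (q : E4) :
    Psi k y (Nf y) (Tf q y) = fderiv ℝ (fun z => k z (Nf z) (Tf q z)) y (Nf y)
      - (1 / 2) * fderiv ℝ (fun z => k z (Nf z) (Nf z)) y (Tf q y)
      - phi y * k y (Nf y) (Tf q y) := by
  rw [fderiv_bil_apply' hk (differentiableAt_Nf hy) (differentiableAt_Nf hy),
    fderiv_bil_apply' hk (differentiableAt_Nf hy) (differentiableAt_Tf q hy), Psi, koszul,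
    fderiv_Tf_Nf q hy, fderiv_Nf_Tf q hy, hs.self_of_nhds (-(sT y / ‖y‖) • Tf q y) (Nf y)]
  simp
  ring

/-- Here the frame derivatives do not cancel entirely: they leave k(N, [T_q, T_p]), which
`fderiv_Tf_Tf` evaluates. -/
theorem Psi_Tf_Tf (hk : DifferentiableAt ℝ k y) (hs : ∀ᶠ z in 𝓝 y, IsSymm (k z)) (hy : y ∈ intM)
    (p q : E4) :
    Psi k y (Tf q y) (Tf p y) = (1 / 2) * (fderiv ℝ (fun z => k z (Tf q z) (Tf p z)) y (Nf y)
      + fderiv ℝ (fun z => k z (Nf z) (Tf p z)) y (Tf q y)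
      - fderiv ℝ (fun z => k z (Nf z) (Tf q z)) y (Tf p y)
      + cq p y * k y (Nf y) (Tf q y) - cq q y * k y (Nf y) (Tf p y))
      - phi y * k y (Tf q y) (Tf p y) := by
  have hT := fderiv_Tf_Tf p q hy
  have hT2 := congrArg (k y (Nf y)) hT
  simp only [map_sub, map_smul, smul_eq_mul] at hT2
  rw [fderiv_bil_apply' hk (differentiableAt_Nf hy) (differentiableAt_Tf q hy),
    fderiv_bil_apply' hk (differentiableAt_Nf hy) (differentiableAt_Tf p hy),
    fderiv_bil_apply' hk (differentiableAt_Tf q hy) (differentiableAt_Tf p hy), Psi, koszul,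
    fderiv_Tf_Nf q hy, fderiv_Nf_Tf q hy, fderiv_Tf_Nf p hy, fderiv_Nf_Tf p hy,
    fderiv_bil_symm hk hs (Tf p y) (Tf q y) (Nf y)]
  simp only [map_sub, map_smul, _root_.sub_apply, _root_.smul_apply, smul_eq_mul]
  rw [hs.self_of_nhds (Tf p y) (Tf q y)]
  linear_combination (1 / 2) * hT2

/-- In terms of the background connection, Ψ(u, w) is half of (∇_u k)(N, w) + (∇_N k)(u, w) - (∇_w
k)(u, N). The outer terms are antisymmetric in u and w, and the trace commutes with ∇_N. -/
theorem trV_Psi (hk : DifferentiableAt ℝ k y) (hs : ∀ᶠ z in 𝓝 y, IsSymm (k z)) (hy : y ∈ intM) :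
    trV Λ y (Psi k y) =
      (1 / 2) * fderiv ℝ (fun z => trV Λ z fun u v => k z u v) y (Nf y) := by
  have h0 := hy.1
  have ht := tau_pos hy
  have hsT := sT_pos hy
  have hP : ∀ u, Psi k y u u = (1 / 2) * fderiv ℝ k y (Nf y) u u
      + k y (fderiv ℝ Nf y u) u - phi y * k y u u := by
    intro u
    rw [Psi, koszul, fderiv_bil_symm hk hs u u (Nf y)]
    simp
    ring
  have hD : ∀ v w, HasFDerivAt (fun z => k z v w)
      ((fderiv ℝ (fun z => k z v w) y)) y := fun v w =>
    ((hk.clm_apply (differentiableAt_const v)).clm_apply (differentiableAt_const w)).hasFDerivAt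
  obtain ⟨D, hD1, hD2⟩ := hasFDerivAt_bil_apply hk (differentiableAt_id (x := y))
    (differentiableAt_id (x := y))
  simp only [id] at hD1 hD2
  have hn := hasFDerivAt_norm' (ne_zero_of_intM hy)
  have hX := ((((hasFDerivAt_tau hy).pow 2).mul (hn.pow 2)).const_mul (Λ / 3)).mul
    ((HasFDerivAt.fun_sum (u := Finset.univ) fun i _ => hD (ev i) (ev i)).sub
      (((hasFDerivAt_inv_comp (hn.pow 3) (pow_pos h0 3).ne').const_mul 2).mul hD1))
  have hX' : HasFDerivAt (fun z => trV Λ z fun u v => k z u v) _ y :=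
    hX.congr_of_eventuallyEq (Filter.Eventually.of_forall fun z => by
      simp [trV, div_eq_mul_inv])
  rw [hX'.fderiv, trV]
  simp only [hP, (hasFDerivAt_Nf hy).fderiv]
  have hN : ⟪y, Nf y⟫_ℝ = -(sT y * ‖y‖) := by
    simp only [Nf, inner_smul_right, real_inner_self_eq_norm_sq]; field_simp
  have hk1 : k y (Nf y) y = -(sT y / ‖y‖) * k y y y := by simp [Nf]
  have hk2 : k y y (Nf y) = -(sT y / ‖y‖) * k y y y := by simp [Nf]
  have hsum : ∑ i, ⟪y, ev i⟫_ℝ * k y y (ev i) = k y y y := by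
    conv_rhs => rw [map_eq_sum (k y y) y]
    simp only [smul_eq_mul]
    exact Finset.sum_congr rfl fun i _ => by rw [real_inner_comm, inner_ev]
  simp [dTau_Nf hy, hN, Finset.sum_add_distrib, hD2, fderiv_bil_apply hk, hk1, hk2,
    Finset.sum_sub_distrib, ← Finset.mul_sum, hsum]
  generalize ∑ i, k y (ev i) (ev i) = S
  generalize ∑ i, fderiv ℝ k y (Nf y) (ev i) (ev i) = DS
  have hτ : tau y = 1 - ‖y‖ := rfl
  rw [phi]
  field_simp
  have h2 := sT_sq' hy
  rw [hτ]
  linear_combination (-2 * Λ * (1 - ‖y‖) ^ 2 * k y y y) * h2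

end

end

end SdSGluing

namespace SdSGluing

noncomputable section

/-! # Integration by parts for the frame components -/

/-- The factor `-1 / g_{dS}(N, N)`, up to a power of `√(1 - τ²)`. -/
def wf (Λ : ℝ) (y : E4) : ℝ := Λ / 3 * tau y ^ 2

section

variable {Λ : ℝ} {y : E4}

theorem hasFDerivAt_wf (Λ : ℝ) (hy : y ∈ intM) :
    HasFDerivAt (wf Λ) ((2 * Λ / 3 * tau y) • dTau y) y := by
  refine (((hasFDerivAt_tau hy).pow 2).const_mul (Λ / 3)).congr_fderiv ?_
  ext v
  simp
  ring

theorem differentiableAt_mu (hy : y ∈ intM) : DifferentiableAt ℝ mu y :=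
  (hasFDerivAt_mu hy).differentiableAt

/-- The number 4φ is the background divergence of N, the trace of φ times the identity. Likewise
-3⟨q, ψ⟩ in `divg_mul_Tf` is the divergence of T_q. -/
theorem divg_mul_Nf (hy : y ∈ intM) {F : E4 → ℝ} (hF : DifferentiableAt ℝ F y) :
    divg (fun z => (mu z * F z) • Nf z) y = mu y * (fderiv ℝ F y (Nf y) + 4 * phi y * F y) := by
  have h0 := hy.1
  have ht := tau_pos hy
  have hs := sT_pos hy
  rw [divg_smul (f := fun z => mu z * F z) ((differentiableAt_mu hy).mul hF)
    (differentiableAt_Nf hy), divg_Nf hy, ((hasFDerivAt_mu hy).fun_mul hF.hasFDerivAt).fderiv]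
  simp only [_root_.add_apply, _root_.smul_apply, smul_eq_mul, dTau_Nf hy, phi]
  have h2 := sT_sq hy
  field_simp
  ring

theorem divg_mul_Tf (q : E4) (hy : y ∈ intM) {F : E4 → ℝ} (hF : DifferentiableAt ℝ F y) :
    divg (fun z => (mu z * F z) • Tf q z) y
      = mu y * (fderiv ℝ F y (Tf q y) - 3 * cq q y * F y) := by
  rw [divg_smul (f := fun z => mu z * F z) ((differentiableAt_mu hy).mul hF)
    (differentiableAt_Tf q hy), divg_Tf q hy, ((hasFDerivAt_mu hy).fun_mul hF.hasFDerivAt).fderiv]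
  simp only [_root_.add_apply, _root_.smul_apply, smul_eq_mul, dTau_Tf q hy]
  ring

variable {k : E4 → Bil}

theorem differentiableAt_trV (Λ : ℝ) (hk : DifferentiableAt ℝ k y) (hy : y ∈ intM) :
    DifferentiableAt ℝ (fun z => trV Λ z fun u v => k z u v) y := by
  have h0 := hy.1
  have hn := (hasFDerivAt_norm' (ne_zero_of_intM hy)).differentiableAt
  have hτ := (hasFDerivAt_tau hy).differentiableAt
  have hkd : ∀ i, DifferentiableAt ℝ (fun z => k z (ev i) (ev i)) y := fun i =>
    (hk.clm_apply (differentiableAt_const _)).clm_apply (differentiableAt_const _)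
  have hyy : DifferentiableAt ℝ (fun z => k z z z) y :=
    (hk.clm_apply differentiableAt_id).clm_apply differentiableAt_id
  have hi : DifferentiableAt ℝ (fun z : E4 => 2 / ‖z‖ ^ 3) y := by
    simpa only [div_eq_mul_inv] using
      ((hasFDerivAt_inv_comp (hn.hasFDerivAt.pow 3) (pow_pos h0 3).ne').const_mul 2).differentiableAt
  exact (((hτ.pow 2).mul (hn.pow 2)).const_mul (Λ / 3)).mul
    ((DifferentiableAt.fun_sum fun i _ => hkd i).sub (hi.mul hyy))

/-- Integration by parts for `f Ψ(T_q, T_p)`. -/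
theorem divg_Psi_Tf_Tf (hk : DifferentiableAt ℝ k y) (hs : ∀ᶠ z in 𝓝 y, IsSymm (k z))
    (hy : y ∈ intM) (p q : E4) {f : E4 → ℝ} (hf : DifferentiableAt ℝ f y) :
    divg (fun z => (mu z * (1 / 2 * f z * k z (Tf q z) (Tf p z))) • Nf z
        + (mu z * (1 / 2 * f z * k z (Nf z) (Tf p z))) • Tf q z
        - (mu z * (1 / 2 * f z * k z (Nf z) (Tf q z))) • Tf p z) y
      = mu y * (f y * Psi k y (Tf q y) (Tf p y)
        + k y (Tf q y) (Tf p y) * (1 / 2 * fderiv ℝ f y (Nf y) + 3 * phi y * f y)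
        + 1 / 2 * k y (Nf y) (Tf p y) * (fderiv ℝ f y (Tf q y) - 2 * cq q y * f y)
        - 1 / 2 * k y (Nf y) (Tf q y) * (fderiv ℝ f y (Tf p y) - 2 * cq p y * f y)) := by
  have hN := differentiableAt_Nf hy
  have hT := fun q => differentiableAt_Tf q hy
  have hm := differentiableAt_mu hy
  have h1 : DifferentiableAt ℝ (fun z => k z (Tf q z) (Tf p z)) y :=
    (hk.clm_apply (hT q)).clm_apply (hT p)
  have h2 : ∀ q, DifferentiableAt ℝ (fun z => k z (Nf z) (Tf q z)) y := fun q =>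
    (hk.clm_apply hN).clm_apply (hT q)
  have hf' : DifferentiableAt ℝ (fun z => 1 / 2 * f z) y := hf.const_mul (1 / 2)
  have g1 : DifferentiableAt ℝ (fun z => 1 / 2 * f z * k z (Tf q z) (Tf p z)) y := hf'.mul h1
  have g2 : ∀ q, DifferentiableAt ℝ (fun z => 1 / 2 * f z * k z (Nf z) (Tf q z)) y :=
    fun q => hf'.mul (h2 q)
  have g3 : DifferentiableAt ℝ
      (fun z => (mu z * (1 / 2 * f z * k z (Tf q z) (Tf p z))) • Nf z) y := (hm.mul g1).smul hN
  have g4 : ∀ p q, DifferentiableAt ℝ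
      (fun z => (mu z * (1 / 2 * f z * k z (Nf z) (Tf p z))) • Tf q z) y :=
    fun p q => (hm.mul (g2 p)).smul (hT q)
  rw [divg_sub (g3.fun_add (g4 p q)) (g4 q p), divg_add g3 (g4 p q), divg_mul_Nf hy g1,
    divg_mul_Tf q hy (g2 p), divg_mul_Tf p hy (g2 q), Psi_Tf_Tf hk hs hy p q]
  have e1 := (hf'.hasFDerivAt.fun_mul h1.hasFDerivAt).fderiv
  have e2 := fun q => (hf'.hasFDerivAt.fun_mul (h2 q).hasFDerivAt).fderiv
  have e3 : fderiv ℝ (fun z => 1 / 2 * f z) y = (1 / 2 : ℝ) • fderiv ℝ f y :=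
    (hf.hasFDerivAt.const_mul (1 / 2)).fderiv
  rw [e1, e2, e2, e3]
  simp only [_root_.add_apply, _root_.smul_apply, smul_eq_mul]
  ring

end

section

variable {Λ : ℝ} {O : Set E4} {g : E4 → Bil} {y : E4}

theorem IsEinstein.differentiableAt_sub (hE : IsEinstein Λ O g) (hO : IsOpen O)
    (hy : y ∈ O ∩ intM) : DifferentiableAt ℝ (fun z => g z - deSitter Λ z) y :=
  DifferentiableAt.fun_sub (𝕜 := ℝ) (E := E4) (F := Bil) (hE.differentiableAt hO hy)
    (differentiableAt_deSitter Λ hy.2)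

theorem IsEinstein.symm_sub (hE : IsEinstein Λ O g) (hO : IsOpen O)
    (hy : y ∈ O ∩ intM) : ∀ᶠ z in 𝓝 y, IsSymm (g z - deSitter Λ z) := by
  filter_upwards [(hO.inter isOpen_intM).mem_nhds hy] with z hz v w
  simp only [_root_.sub_apply]
  rw [(hE.2.1 z hz).1 v w, deSitter_symm Λ hz.2]

/-- The terms in the divergence identity which are quadratic in the perturbation. -/
def quadErr (Λ : ℝ) (g : E4 → Bil) (y q P Q : E4) (ζ η a b : ℝ) : ℝ :=
  - (wf Λ y * (
      - (a + phi y * ζ) * (g y - deSitter Λ y) (Sp g y (Tf q y)) (Nf y)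
      + (g y - deSitter Λ y) (Sp g y (Tf q y)) (Tf P y)
      - (b + ζ * cq q y) * (g y - deSitter Λ y) (Sp g y (Nf y)) (Nf y)
      + (g y - deSitter Λ y) (Sp g y (Nf y)) (Tf Q y)
      + ζ * phi y * (g y - deSitter Λ y) (Sp g y (Nf y)) (Tf q y)))
    + dC P y (Tf q y) * trV Λ y (fun u v => (g y - deSitter Λ y) (Sp g y u) v)
    - trG (dGam g y) (Sp g y (ζ • Tf q y + η • Nf y))
    + trE ((dGam g y (ζ • Tf q y + η • Nf y)).comp (Sp g y))

/-- The flux of a vector field `ζ T_q + η N`, corrected by multiples of the perturbation such that the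
divergence contains derivatives of the perturbation only in terms of lower order. -/
def fluxC (Λ : ℝ) (g : E4 → Bil) (q : E4) (ζ η A B E : E4 → ℝ) (y : E4) : E4 :=
  flux g (fun z => ζ z • Tf q z + η z • Nf z) y
    + (mu y * (-(wf Λ y * phi y * ζ y) * (g y - deSitter Λ y) (Nf y) (Tf q y)
      + 1 / 2 * A y * (g y - deSitter Λ y) (Nf y) (Nf y)
      + 1 / 2 * E y * trV Λ y fun u v => (g y - deSitter Λ y) u v)) • Nf y
    + (mu y * (B y * (g y - deSitter Λ y) (Nf y) (Nf y))) • Tf q y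

theorem deSitter_Sp (hE : IsEinstein Λ O g) (hO : IsOpen O) (hy : y ∈ O ∩ intM) (u v : E4) :
    deSitter Λ y (Sp g y u) v = Psi (fun z => g z - deSitter Λ z) y u v
      - (g y - deSitter Λ y) (Sp g y u) v := by
  rw [← metric_Sp hE hO hy]
  simp

theorem trV_sub (f h : E4 → E4 → ℝ) :
    trV Λ y (fun u v => f u v - h u v) = trV Λ y f - trV Λ y h := by
  simp only [trV, Finset.sum_sub_distrib]
  ring

/-- The conditions on A, B and E are the choices that cancel the derivatives of k(N, N), k(N, T_q)
and tr k coming from `divg_flux_frame`; the condition on b removes the remaining multiple of tr S.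
Two Ψ-terms survive: the one with T_Q will be small by its order, the one with T_P lives on the
annuli. -/
theorem divg_fluxC (hΛ : 0 < Λ) (hE : IsEinstein Λ O g) (hO : IsOpen O) (hy : y ∈ O ∩ intM)
    (q : E4) {ζ η A B E : E4 → ℝ} {a b : ℝ} {P Q : E4}
    (hζ : HasFDerivAt ζ ((a / sT y) • dTau y + dC P y) y)
    (hη : HasFDerivAt η ((b / sT y) • dTau y + dC Q y) y)
    (hA : DifferentiableAt ℝ A y) (hB : DifferentiableAt ℝ B y) (hC : DifferentiableAt ℝ E y)
    (hAy : A y = wf Λ y * (b + ζ y * cq q y)) (hBy : B y = wf Λ y * (a / 2 + phi y * ζ y))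
    (hEy : E y = dC P y (Tf q y)) (hb : b + 3 * phi y * η y - 2 * cq q y * ζ y = 0) :
    divg (fluxC Λ g q ζ η A B E) y = mu y * (
      2 * Λ / 3 * tau y ^ 2 * ζ y * (g y - deSitter Λ y) (Nf y) (Tf q y)
      + (Λ * η y + 3 * phi y * A y + 1 / 2 * fderiv ℝ A y (Nf y) + fderiv ℝ B y (Tf q y)
        - 3 * cq q y * B y) * (g y - deSitter Λ y) (Nf y) (Nf y)
      + (1 / 2 * fderiv ℝ E y (Nf y) + 2 * phi y * E y)
        * trV Λ y (fun u v => (g y - deSitter Λ y) u v)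
      + wf Λ y * Psi (fun z => g z - deSitter Λ z) y (Nf y) (Tf Q y)
      + wf Λ y * Psi (fun z => g z - deSitter Λ z) y (Tf q y) (Tf P y)
      + quadErr Λ g y q P Q (ζ y) (η y) a b) := by
  have hk := hE.differentiableAt_sub hO hy
  have hsy := hE.symm_sub hO hy
  have hN := differentiableAt_Nf hy.2
  have hT := differentiableAt_Tf q hy.2
  have hm := differentiableAt_mu hy.2
  have hζd := hζ.differentiableAt
  have hηd := hη.differentiableAt
  have hS : DifferentiableAt ℝ (Sp g) y := (hE.contDiffAt_Sp hO hy).differentiableAt (by simp)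
  have hw := hasFDerivAt_wf Λ hy.2
  have hφ := hasFDerivAt_phi hy.2
  have hκ : DifferentiableAt ℝ (fun z => (g z - deSitter Λ z) (Nf z) (Tf q z)) y :=
    (hk.clm_apply hN).clm_apply hT
  have hν : DifferentiableAt ℝ (fun z => (g z - deSitter Λ z) (Nf z) (Nf z)) y :=
    (hk.clm_apply hN).clm_apply hN
  have ht := differentiableAt_trV Λ hk hy.2
  have hY : DifferentiableAt ℝ (fun z => ζ z • Tf q z + η z • Nf z) y :=
    (hζd.smul hT).add (hηd.smul hN)
  have hflux : DifferentiableAt ℝ (flux g (fun z => ζ z • Tf q z + η z • Nf z)) y :=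
    (hS.clm_apply (hm.smul hY)).sub ((hasFDerivAt_clm_apply trL hS).differentiableAt.smul (hm.smul hY))
  have hF1 : HasFDerivAt (fun z => -(wf Λ z * phi z * ζ z) * (g z - deSitter Λ z) (Nf z) (Tf q z)
      + 1 / 2 * A z * (g z - deSitter Λ z) (Nf z) (Nf z)
      + 1 / 2 * E z * trV Λ z fun u v => (g z - deSitter Λ z) u v) _ y :=
    (((((hw.fun_mul hφ).fun_mul hζ).fun_neg).fun_mul hκ.hasFDerivAt).fun_add
      ((hA.hasFDerivAt.const_mul (1 / 2)).fun_mul hν.hasFDerivAt)).fun_add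
      ((hC.hasFDerivAt.const_mul (1 / 2)).mul ht.hasFDerivAt)
  have hF2 : HasFDerivAt (fun z => B z * (g z - deSitter Λ z) (Nf z) (Nf z)) _ y :=
    hB.hasFDerivAt.mul hν.hasFDerivAt
  have hX1 : DifferentiableAt ℝ (fun z => (mu z * (-(wf Λ z * phi z * ζ z)
      * (g z - deSitter Λ z) (Nf z) (Tf q z)
      + 1 / 2 * A z * (g z - deSitter Λ z) (Nf z) (Nf z)
      + 1 / 2 * E z * trV Λ z fun u v => (g z - deSitter Λ z) u v)) • Nf z) y :=
    (hm.mul hF1.differentiableAt).smul hN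
  have hX2 : DifferentiableAt ℝ (fun z => (mu z * (B z * (g z - deSitter Λ z) (Nf z) (Nf z)))
      • Tf q z) y := (hm.mul hF2.differentiableAt).smul hT
  have hdiv := divg_add (hflux.fun_add hX1) hX2
  rw [divg_add hflux hX1] at hdiv
  refine hdiv.trans ?_
  rw [divg_flux_frame hΛ hE hO hy q hζ hη, divg_mul_Nf hy.2 hF1.differentiableAt,
    divg_mul_Tf q hy.2 hF2.differentiableAt, hF1.fderiv, hF2.fderiv]
  -- The trace of S is an exact N-derivative plus the quadratic cost of lowering the index with the
  -- de Sitter metric instead of g.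
  have htr : trE (Sp g y) = 1 / 2 * fderiv ℝ (fun z => trV Λ z fun u v =>
      (g z - deSitter Λ z) u v) y (Nf y)
      - trV Λ y (fun u v => (g y - deSitter Λ y) (Sp g y u) v) := by
    rw [trE_eq_trV hΛ hy.2, ← trV_Psi hk hsy hy.2, ← trV_sub]
    simp only [deSitter_Sp hE hO hy]
  rw [htr]
  simp only [deSitter_Sp hE hO hy, Psi_Nf_Nf hk hsy hy.2, Psi_Tf_Nf hk hsy hy.2,
    Psi_Nf_Tf hk hsy hy.2 q, quadErr]
  simp only [_root_.add_apply, _root_.smul_apply, _root_.neg_apply, smul_eq_mul, dTau_Nf hy.2,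
    dC_Nf P hy.2, hEy]
  have hs := sT_pos hy.2
  have hτ := tau_pos hy.2
  have hsq := sT_sq hy.2
  have e1 : a / sT y * sT y = a := div_mul_cancel₀ _ hs.ne'
  have e2 : wf Λ y * (1 / (sT y * tau y ^ 2) * sT y) = Λ / 3 := by
    rw [wf]; field_simp
  have e3 : phi y * (2 * Λ / 3 * tau y * sT y) = -(2 * Λ / 3 * (1 - tau y ^ 2)) := by
    rw [phi, ← hsq]; field_simp
  have e4 : wf Λ y * phi y ^ 2 = Λ / 3 * (1 - tau y ^ 2) := by
    rw [wf, phi, ← hsq]; field_simp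
  rw [e1, e2, e3, hAy, hBy]
  generalize fderiv ℝ (fun z => trV Λ z fun u v => (g z - deSitter Λ z) u v) y (Nf y) = D1
  generalize fderiv ℝ (fun z => (g z - deSitter Λ z) (Nf z) (Nf z)) y (Nf y) = D2
  generalize fderiv ℝ (fun z => (g z - deSitter Λ z) (Nf z) (Nf z)) y (Tf q y) = D3
  generalize fderiv ℝ (fun z => (g z - deSitter Λ z) (Nf z) (Tf q z)) y (Nf y) = D4
  generalize (g y - deSitter Λ y) (Nf y) (Tf q y) = κ
  generalize (g y - deSitter Λ y) (Nf y) (Nf y) = ν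
  generalize (trV Λ y fun u v => (g y - deSitter Λ y) (Sp g y u) v) = T1
  generalize (trV Λ y fun u v => (g y - deSitter Λ y) u v) = T2
  have ew : Λ / 3 * tau y ^ 2 = wf Λ y := rfl
  rw [ew]
  -- By `e4` the leading part of the coefficient of k(N, T_q) cancels and 2Λ/3 τ² ζ is left.
  linear_combination (-4 * mu y * ζ y * κ) * e4 - mu y * (1 / 2 * D1 - T1) * hb

end

end

end SdSGluing

namespace SdSGluing

noncomputable section

/-! # The test fields -/

theorem Tf_smul (c : ℝ) (q y : E4) : Tf (c • q) y = c • Tf q y := by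
  simp only [Tf, inner_smul_left]
  simp
  module

theorem Tf_sum {ι : Type*} (s : Finset ι) (q : ι → E4) (y : E4) :
    Tf (∑ i ∈ s, q i) y = ∑ i ∈ s, Tf (q i) y := by
  simp only [Tf, sum_inner, Finset.smul_sum, Finset.sum_sub_distrib, Finset.sum_div, Finset.sum_smul]

theorem dC_add (p q y : E4) : dC (p + q) y = dC p y + dC q y := by
  ext v
  simp only [dC_apply, inner_add_left, _root_.add_apply]
  ring

theorem dC_smul (c : ℝ) (q y : E4) : dC (c • q) y = c • dC q y := by
  ext v
  simp [dC_apply, inner_smul_left]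
  ring

theorem dC_sum {ι : Type*} (s : Finset ι) (q : ι → E4) (y : E4) :
    dC (∑ i ∈ s, q i) y = ∑ i ∈ s, dC (q i) y := by
  ext v
  simp only [dC_apply, sum_inner, _root_.sum_apply, Finset.sum_sub_distrib, Finset.sum_div,
    Finset.sum_mul]

theorem Psi_add (k : E4 → Bil) (y u v w : E4) : Psi k y u (v + w) = Psi k y u v + Psi k y u w := by
  simp only [Psi, koszul, map_add, _root_.add_apply]
  ring

theorem Psi_smul (k : E4 → Bil) (y u : E4) (c : ℝ) (v : E4) : Psi k y u (c • v) = c * Psi k y u v := by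
  simp only [Psi, koszul, map_smul, _root_.smul_apply, smul_eq_mul]
  ring

theorem Psi_sum {ι : Type*} (k : E4 → Bil) (y u : E4) (s : Finset ι) (v : ι → E4) :
    Psi k y u (∑ i ∈ s, v i) = ∑ i ∈ s, Psi k y u (v i) := by
  classical
  induction s using Finset.induction_on with
  | empty => simpa using Psi_smul k y u 0 0
  | insert i s hi ih => rw [Finset.sum_insert hi, Finset.sum_insert hi, Psi_add, ih]

/-- The derivative of `⟨p, ψ⟩` along `T_q`. -/
def theta (p q y : E4) : ℝ := ⟪p, q⟫_ℝ - cq p y * cq q y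

section

variable {y : E4}

theorem dC_Tf' (p q : E4) (hy : y ∈ intM) : dC p y (Tf q y) = theta p q y := dC_Tf p q hy

theorem hasFDerivAt_theta (p q : E4) (hy : y ∈ intM) :
    HasFDerivAt (theta p q) (-(cq p y • dC q y + cq q y • dC p y)) y :=
  ((hasFDerivAt_cq p hy).mul (hasFDerivAt_cq q hy)).const_sub _

/-- The unreduced fraction keeps the derivative along N in the numerator, because dτ(N) = `sT`. This
is the shape of differential that `divg_fluxC` and `fderiv_radial_mul` take. -/
theorem hasFDerivAt_comp_tau (hy : y ∈ intM) {a : ℝ → ℝ} {a' : ℝ} (h : HasDerivAt a a' (tau y)) :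
    HasFDerivAt (fun z => a (tau z)) ((a' * sT y / sT y) • dTau y) y := by
  rw [mul_div_cancel_right₀ _ (sT_pos hy).ne']
  exact h.comp_hasFDerivAt y (hasFDerivAt_tau hy)

theorem hasFDerivAt_sT_mul_comp_tau (hy : y ∈ intM) {a : ℝ → ℝ} {a' : ℝ}
    (h : HasDerivAt a a' (tau y)) :
    HasFDerivAt (fun z => sT z * a (tau z))
      (((-tau y * a (tau y) + sT y ^ 2 * a') / sT y) • dTau y) y := by
  have hs := sT_pos hy
  refine ((hasFDerivAt_sT hy).mul (h.comp_hasFDerivAt y (hasFDerivAt_tau hy))).congr_fderiv ?_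
  ext v
  simp
  field_simp
  ring

/-- N differentiates only the radial factor and T_q only the angular one, so derivatives of the
product coefficients need no product rule. -/
theorem fderiv_radial_mul (hy : y ∈ intM) {R Θ : E4 → ℝ} {n : ℝ} {Θ' : E4 →L[ℝ] ℝ}
    (hR : HasFDerivAt R ((n / sT y) • dTau y) y) (hΘ : HasFDerivAt Θ Θ' y) (hN : Θ' (Nf y) = 0) :
    fderiv ℝ (fun z => R z * Θ z) y (Nf y) = n * Θ y ∧
      ∀ q, fderiv ℝ (fun z => R z * Θ z) y (Tf q y) = R y * Θ' (Tf q y) := by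
  have hs := sT_pos hy
  rw [(hR.fun_mul hΘ).fderiv]
  constructor
  · simp [hN, dTau_Nf hy]
    field_simp
  · intro q
    simp [dTau_Tf q hy]

end

section

variable {N : ℕ} (Λ : ℝ) (p : Fin N → E4) (m : Fin N → ℝ) (β V : ℝ → ℝ) (q : E4)

/-- The cutoff function on the sphere. -/
def chi (y : E4) : ℝ := 1 - ∑ i, β (cq (p i) y)

/-- The vector `∑ β'(⟨p_i, ψ⟩) p_i`, which is dual to minus the differential of the cutoff. -/
def Pf (y : E4) : E4 := ∑ i, deriv β (cq (p i) y) • p i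

/-- The derivative of minus the cutoff along `T_q`. -/
def Th (y : E4) : ℝ := ∑ i, deriv β (cq (p i) y) * theta (p i) q y

/-- The radial profile of the tangential test field. -/
def zr (t : ℝ) : ℝ := t ^ 3 * deriv V t / 2

/-- The radial profile of the normal test field. -/
def ur (t : ℝ) : ℝ := t ^ 3 * V t

/-- A radial coefficient. -/
def ar (t : ℝ) : ℝ := Λ / 3 * (3 * t ^ 4 * V t + 3 / 2 * t ^ 5 * deriv V t)

/-- A radial coefficient. -/
def br (t : ℝ) : ℝ :=
  Λ / 12 * (-(t ^ 6 * deriv V t) + (1 - t ^ 2) * (t ^ 4 * deriv V t + t ^ 5 * deriv (deriv V) t))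

/-- A radial coefficient. -/
def wzr (t : ℝ) : ℝ := Λ / 6 * (t ^ 5 * deriv V t)

/-- The angular weight in the obstruction integral. -/
def Hc (c : ℝ) : ℝ := deriv β c * (√(1 - c ^ 2) ^ 3)⁻¹

/-- The function multiplying `T_q` in the test field. -/
def zetaF (y : E4) : ℝ := sT y * zr V (tau y) * chi p β y

/-- The function multiplying `N` in the test field. -/
def etaF (y : E4) : ℝ := ur V (tau y) * (cq q y * chi p β y)

/-- The normal derivative of the radial factor of `zetaF`. -/
def zN (y : E4) : ℝ :=
  -tau y * zr V (tau y) + sT y ^ 2 * ((3 * tau y ^ 2 * deriv V (tau y)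
    + tau y ^ 3 * deriv (deriv V) (tau y)) / 2)

/-- The normal derivative of `etaF`. -/
def etaN (y : E4) : ℝ :=
  (3 * tau y ^ 2 * V (tau y) + tau y ^ 3 * deriv V (tau y)) * sT y * (cq q y * chi p β y)

/-- The normal derivative of the function `√(1 - τ²) wzr`. -/
def wzN (y : E4) : ℝ :=
  -tau y * wzr Λ V (tau y) + sT y ^ 2 * (Λ / 6 * (5 * tau y ^ 4 * deriv V (tau y)
    + tau y ^ 5 * deriv (deriv V) (tau y)))

/-- The function multiplying `Ψ(T_q, T_{p_i})` in the divergence. -/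
def fF (i : Fin N) (y : E4) : ℝ := sT y * wzr Λ V (tau y) * deriv β (cq (p i) y)

/-- The angular part of the obstruction integrand. -/
def obs (y : E4) : ℝ := ∑ i, m i * (Hc β (cq (p i) y) * theta (p i) q y)

/-- The vector field dual to the tangential gradient of `etaF`. -/
def Qf (y : E4) : E4 := ur V (tau y) • (chi p β y • q - cq q y • Pf p β y)

/-- The vector field whose divergence gives the obstruction. -/
def testX (g : E4 → Bil) (y : E4) : E4 :=
  fluxC Λ g q (zetaF p β V) (etaF p β V q)
      (fun z => sT z * ar Λ V (tau z) * (cq q z * chi p β z))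
      (fun z => br Λ V (tau z) * chi p β z)
      (fun z => sT z * zr V (tau z) * -Th p β q z) y
    + ∑ i, ((mu y * (1 / 2 * fF Λ p β V i y * (g y - deSitter Λ y) (Tf q y) (Tf (p i) y))) • Nf y
        + (mu y * (1 / 2 * fF Λ p β V i y * (g y - deSitter Λ y) (Nf y) (Tf (p i) y))) • Tf q y
        - (mu y * (1 / 2 * fF Λ p β V i y * (g y - deSitter Λ y) (Nf y) (Tf q y))) • Tf (p i) y)
    + (mu y * (sT y * (tau y ^ 5 * V (tau y)) * (Λ / 3 * √(3 / Λ) * obs p m β q y))) • Nf y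

/-- The leading part of a component of the Schwarzschild-de Sitter perturbation. -/
def lead (i : Fin N) (y : E4) : ℝ :=
  2 * m i * √(3 / Λ) * tau y * (√(1 - cq (p i) y ^ 2) ^ 3)⁻¹

/-- The remainder from the annulus around `p_i`. -/
def annErr (g : E4 → Bil) (i : Fin N) (y : E4) : ℝ :=
  deriv β (cq (p i) y) * (
      ((g y - deSitter Λ y) (Tf q y) (Tf (p i) y) - lead Λ p m i y * theta (p i) q y)
        * (1 / 2 * wzN Λ V y + 3 * phi y * (sT y * wzr Λ V (tau y)))
      - br Λ V (tau y) * theta (p i) q y * ((g y - deSitter Λ y) (Nf y) (Nf y) - lead Λ p m i y)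
      - theta (p i) q y * (1 / 2 * zN V y + 2 * phi y * (sT y * zr V (tau y)))
        * trV Λ y (fun u v => (g y - deSitter Λ y) u v))
    + 1 / 2 * (g y - deSitter Λ y) (Nf y) (Tf (p i) y) * (sT y * wzr Λ V (tau y))
        * (deriv (deriv β) (cq (p i) y) * theta (p i) q y - 2 * cq q y * deriv β (cq (p i) y))
    - 1 / 2 * (g y - deSitter Λ y) (Nf y) (Tf q y) * (sT y * wzr Λ V (tau y))
        * (deriv (deriv β) (cq (p i) y) * theta (p i) (p i) y
          - 2 * cq (p i) y * deriv β (cq (p i) y))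

/-- The part of the divergence of `testX` which is negligible near the conformal boundary. -/
def testErr (g : E4 → Bil) (y : E4) : ℝ :=
  2 * Λ / 3 * tau y ^ 2 * zetaF p β V y * (g y - deSitter Λ y) (Nf y) (Tf q y)
    + Λ / 2 * tau y ^ 2 * etaF p β V q y * (g y - deSitter Λ y) (Nf y) (Nf y)
    + wf Λ y * Psi (fun z => g z - deSitter Λ z) y (Nf y) (Tf (Qf p β V q y) y)
    + quadErr Λ g y q (-(sT y * zr V (tau y)) • Pf p β y) (Qf p β V q y)
        (zetaF p β V y) (etaF p β V q y) (zN V y * chi p β y) (etaN p β V q y)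
    + ∑ i, annErr Λ p m β V q g i y

end

/-! ### Differentials of the coefficients of the test field -/

section

variable {N : ℕ} {Λ : ℝ} {p : Fin N → E4} {m : Fin N → ℝ} {β V : ℝ → ℝ} {q : E4} {O : Set E4}
  {g : E4 → Bil} {y : E4}

theorem contDiff_deriv {f : ℝ → ℝ} (hf : ContDiff ℝ ∞ f) : ContDiff ℝ ∞ (deriv f) :=
  (contDiff_infty_iff_deriv.1 hf).2

theorem hasDerivAt_of_contDiff {f : ℝ → ℝ} (hf : ContDiff ℝ ∞ f) (t : ℝ) :
    HasDerivAt f (deriv f t) t :=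
  (hf.differentiable (by simp) t).hasDerivAt

theorem hasFDerivAt_comp_cq {f : ℝ → ℝ} (hf : ContDiff ℝ ∞ f) (p : E4) (hy : y ∈ intM) :
    HasFDerivAt (fun z => f (cq p z)) (deriv f (cq p y) • dC p y) y :=
  (hasDerivAt_of_contDiff hf _).comp_hasFDerivAt y (hasFDerivAt_cq p hy)

theorem hasFDerivAt_chi (hβ : ContDiff ℝ ∞ β) (hy : y ∈ intM) :
    HasFDerivAt (chi p β) (-dC (Pf p β y) y) y := by
  refine ((HasFDerivAt.fun_sum fun i _ => hasFDerivAt_comp_cq hβ (p i) hy).const_sub 1).congr_fderiv ?_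
  simp only [Pf, dC_sum, dC_smul]

theorem hasDerivAt_zr (hV : ContDiff ℝ ∞ V) (t : ℝ) :
    HasDerivAt (zr V) ((3 * t ^ 2 * deriv V t + t ^ 3 * deriv (deriv V) t) / 2) t := by
  have h := ((hasDerivAt_pow 3 t).mul (hasDerivAt_of_contDiff (contDiff_deriv hV) t)).div_const 2
  exact h.congr_deriv (by simp)

theorem hasDerivAt_ur (hV : ContDiff ℝ ∞ V) (t : ℝ) :
    HasDerivAt (ur V) (3 * t ^ 2 * V t + t ^ 3 * deriv V t) t := by
  have h := ((hasDerivAt_pow 3 t).mul (hasDerivAt_of_contDiff hV t))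
  exact h.congr_deriv (by simp)

theorem hasDerivAt_ar (hV : ContDiff ℝ ∞ V) (t : ℝ) :
    HasDerivAt (ar Λ V) (Λ / 3 * (12 * t ^ 3 * V t + 21 / 2 * t ^ 4 * deriv V t
      + 3 / 2 * t ^ 5 * deriv (deriv V) t)) t := by
  have h := ((((hasDerivAt_pow 4 t).const_mul 3).mul (hasDerivAt_of_contDiff hV t)).add
    (((hasDerivAt_pow 5 t).const_mul (3 / 2)).mul
      (hasDerivAt_of_contDiff (contDiff_deriv hV) t))).const_mul (Λ / 3)
  refine h.congr_deriv ?_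
  rw [show 4 - 1 = 3 from rfl, show 5 - 1 = 4 from rfl]
  push_cast
  ring

theorem hasDerivAt_wzr (hV : ContDiff ℝ ∞ V) (t : ℝ) :
    HasDerivAt (wzr Λ V) (Λ / 6 * (5 * t ^ 4 * deriv V t + t ^ 5 * deriv (deriv V) t)) t := by
  have h := ((hasDerivAt_pow 5 t).mul
      (hasDerivAt_of_contDiff (contDiff_deriv hV) t)).const_mul (Λ / 6)
  exact h.congr_deriv (by simp)

theorem hasDerivAt_pow_mul (hV : ContDiff ℝ ∞ V) (t : ℝ) :
    HasDerivAt (fun t => t ^ 5 * V t) (5 * t ^ 4 * V t + t ^ 5 * deriv V t) t := by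
  have h := ((hasDerivAt_pow 5 t).mul (hasDerivAt_of_contDiff hV t))
  exact h.congr_deriv (by simp)

theorem differentiable_br (hV : ContDiff ℝ ∞ V) : Differentiable ℝ (br Λ V) := by
  have h0 := hV.differentiable (by simp)
  have h1 := (contDiff_deriv hV).differentiable (by simp)
  have h2 := (contDiff_deriv (contDiff_deriv hV)).differentiable (by simp)
  unfold br
  fun_prop

/-- The tangential part comes from the cutoff alone, whose differential is represented by -`Pf`.
Hence the P-term of `divg_fluxC` is supported on the annuli. -/
theorem hasFDerivAt_zetaF (hβ : ContDiff ℝ ∞ β) (hV : ContDiff ℝ ∞ V) (hy : y ∈ intM) :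
    HasFDerivAt (zetaF p β V) ((zN V y * chi p β y / sT y) • dTau y
      + dC (-(sT y * zr V (tau y)) • Pf p β y) y) y := by
  refine ((hasFDerivAt_sT_mul_comp_tau hy (hasDerivAt_zr hV (tau y))).mul
    (hasFDerivAt_chi hβ hy)).congr_fderiv ?_
  rw [dC_smul, zN]
  ext v
  simp
  ring

theorem hasFDerivAt_etaF (hβ : ContDiff ℝ ∞ β) (hV : ContDiff ℝ ∞ V) (hy : y ∈ intM) :
    HasFDerivAt (etaF p β V q) ((etaN p β V q y / sT y) • dTau y + dC (Qf p β V q y) y) y := by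
  refine ((hasFDerivAt_comp_tau hy (hasDerivAt_ur hV (tau y))).mul
    ((hasFDerivAt_cq q hy).mul (hasFDerivAt_chi hβ hy))).congr_fderiv ?_
  rw [Qf, dC_smul, sub_eq_add_neg, dC_add, ← neg_smul, dC_smul, dC_smul, etaN]
  ext v
  simp
  ring

theorem hasFDerivAt_Th (hβ : ContDiff ℝ ∞ β) (hy : y ∈ intM) :
    ∃ D : E4 →L[ℝ] ℝ, HasFDerivAt (Th p β q) D y ∧ D (Nf y) = 0 := by
  refine ⟨_, HasFDerivAt.fun_sum fun i _ =>
    (hasFDerivAt_comp_cq (contDiff_deriv hβ) (p i) hy).mul (hasFDerivAt_theta (p i) q hy), ?_⟩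
  simp [dC_Nf _ hy]

theorem hasFDerivAt_obs (hH : ContDiff ℝ ∞ (Hc β)) (hy : y ∈ intM) :
    ∃ D : E4 →L[ℝ] ℝ, HasFDerivAt (obs p m β q) D y ∧ D (Nf y) = 0 := by
  refine ⟨_, HasFDerivAt.fun_sum fun i _ =>
    ((hasFDerivAt_comp_cq hH (p i) hy).mul (hasFDerivAt_theta (p i) q hy)).const_mul (m i), ?_⟩
  simp [dC_Nf _ hy]

theorem divg_sum {ι : Type*} (s : Finset ι) {X : ι → E4 → E4}
    (hX : ∀ i ∈ s, DifferentiableAt ℝ (X i) y) :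
    divg (fun z => ∑ i ∈ s, X i z) y = ∑ i ∈ s, divg (X i) y := by
  rw [divg, fderiv_fun_sum hX]
  simp only [divg, ← trL_apply, map_sum]

end

end

end SdSGluing

/-! ### Smoothness of the test field and its divergence identity -/

namespace SdSGluing

noncomputable section

section

variable {N : ℕ} {Λ : ℝ} {p : Fin N → E4} {m : Fin N → ℝ} {β V : ℝ → ℝ} {q : E4} {O : Set E4}
  {g : E4 → Bil} {y : E4}

theorem contDiffAt_tau (hy : y ∈ intM) : ContDiffAt ℝ ∞ tau y :=
  contDiffAt_const.sub (contDiffAt_norm ℝ (ne_zero_of_intM hy))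

theorem contDiffAt_sT (hy : y ∈ intM) : ContDiffAt ℝ ∞ sT y := by
  refine (contDiffAt_const.sub ((contDiffAt_tau hy).pow 2)).sqrt ?_
  rw [← sT_sq hy]
  exact (pow_pos (sT_pos hy) 2).ne'

theorem contDiffAt_mu (hy : y ∈ intM) : ContDiffAt ℝ ∞ mu y := by
  have h0 := hy.1
  have ht := tau_pos hy
  have hs := sT_pos hy
  exact ((((contDiffAt_norm ℝ (ne_zero_of_intM hy)).pow 3).mul ((contDiffAt_tau hy).pow 4)).mul
    (contDiffAt_sT hy)).inv (by positivity)

theorem contDiffAt_cq (q : E4) (hy : y ∈ intM) : ContDiffAt ℝ ∞ (cq q) y := by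
  have he : cq q = fun z => ⟪q, z⟫_ℝ * ‖z‖⁻¹ := by funext z; rw [cq_eq, div_eq_mul_inv]
  rw [he]
  exact (innerSL ℝ q).contDiff.contDiffAt.mul
    ((contDiffAt_norm ℝ (ne_zero_of_intM hy)).inv hy.1.ne')

theorem contDiffAt_Tf (q : E4) (hy : y ∈ intM) : ContDiffAt ℝ ∞ (Tf q) y := by
  have he : Tf q = fun z => ‖z‖ • q - cq q z • z := by funext z; rw [Tf, cq_eq]
  rw [he]
  exact ((contDiffAt_norm ℝ (ne_zero_of_intM hy)).smul contDiffAt_const).sub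
    ((contDiffAt_cq q hy).smul contDiffAt_id)

theorem contDiffAt_wf (Λ : ℝ) (hy : y ∈ intM) : ContDiffAt ℝ ∞ (wf Λ) y :=
  contDiffAt_const.mul ((contDiffAt_tau hy).pow 2)

theorem contDiffAt_trV (Λ : ℝ) {k : E4 → Bil} (hk : ContDiffAt ℝ ∞ k y) (hy : y ∈ intM) :
    ContDiffAt ℝ ∞ (fun z => trV Λ z fun u v => k z u v) y := by
  have h0 := hy.1
  have hn : ContDiffAt ℝ ∞ (fun z : E4 => ‖z‖) y := contDiffAt_norm ℝ (ne_zero_of_intM hy)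
  have hτ := contDiffAt_tau hy
  exact (contDiffAt_const.mul ((hτ.pow 2).mul (hn.pow 2))).mul
    ((ContDiffAt.sum fun i _ => (hk.clm_apply contDiffAt_const).clm_apply contDiffAt_const).sub
      ((contDiffAt_const.div (hn.pow 3) (pow_pos h0 3).ne').mul
        ((hk.clm_apply contDiffAt_id).clm_apply contDiffAt_id)))

theorem contDiffAt_theta (p q : E4) (hy : y ∈ intM) : ContDiffAt ℝ ∞ (theta p q) y :=
  contDiffAt_const.sub ((contDiffAt_cq p hy).mul (contDiffAt_cq q hy))

theorem contDiffAt_chi (hβ : ContDiff ℝ ∞ β) (hy : y ∈ intM) : ContDiffAt ℝ ∞ (chi p β) y :=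
  contDiffAt_const.sub (ContDiffAt.sum fun i _ => hβ.contDiffAt.comp y (contDiffAt_cq (p i) hy))

theorem contDiffAt_Th (hβ : ContDiff ℝ ∞ β) (hy : y ∈ intM) : ContDiffAt ℝ ∞ (Th p β q) y :=
  ContDiffAt.sum fun i _ => ((contDiff_deriv hβ).contDiffAt.comp y (contDiffAt_cq (p i) hy)).mul
    (contDiffAt_theta (p i) q hy)

theorem contDiffAt_obs (hH : ContDiff ℝ ∞ (Hc β)) (hy : y ∈ intM) :
    ContDiffAt ℝ ∞ (obs p m β q) y :=
  ContDiffAt.sum fun i _ => contDiffAt_const.mul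
    ((hH.contDiffAt.comp y (contDiffAt_cq (p i) hy)).mul (contDiffAt_theta (p i) q hy))

theorem contDiffAt_comp_tau {a : ℝ → ℝ} (ha : ContDiff ℝ ∞ a) (hy : y ∈ intM) :
    ContDiffAt ℝ ∞ (fun z => a (tau z)) y := ha.contDiffAt.comp y (contDiffAt_tau hy)

theorem contDiff_zr (hV : ContDiff ℝ ∞ V) : ContDiff ℝ ∞ (zr V) :=
  ((contDiff_id.pow 3).mul (contDiff_deriv hV)).div_const 2

theorem contDiff_ur (hV : ContDiff ℝ ∞ V) : ContDiff ℝ ∞ (ur V) := (contDiff_id.pow 3).mul hV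

theorem contDiff_ar (hV : ContDiff ℝ ∞ V) : ContDiff ℝ ∞ (ar Λ V) :=
  contDiff_const.mul (((contDiff_const.mul (contDiff_id.pow 4)).mul hV).add
    ((contDiff_const.mul (contDiff_id.pow 5)).mul (contDiff_deriv hV)))

theorem contDiff_wzr (hV : ContDiff ℝ ∞ V) : ContDiff ℝ ∞ (wzr Λ V) :=
  contDiff_const.mul ((contDiff_id.pow 5).mul (contDiff_deriv hV))

theorem contDiff_br (hV : ContDiff ℝ ∞ V) : ContDiff ℝ ∞ (br Λ V) :=
  contDiff_const.mul (((contDiff_id.pow 6).mul (contDiff_deriv hV)).neg.add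
    ((contDiff_const.sub (contDiff_id.pow 2)).mul (((contDiff_id.pow 4).mul (contDiff_deriv hV)).add
      ((contDiff_id.pow 5).mul (contDiff_deriv (contDiff_deriv hV))))))

theorem contDiffAt_sub_deSitter (hE : IsEinstein Λ O g) (hO : IsOpen O) (hy : y ∈ O ∩ intM) :
    ContDiffAt ℝ ∞ (fun z => g z - deSitter Λ z) y :=
  (hE.1.contDiffAt ((hO.inter isOpen_intM).mem_nhds hy)).sub
    ((contDiffOn_deSitter Λ).contDiffAt (isOpen_intM.mem_nhds hy.2))

theorem contDiffAt_fluxC (hE : IsEinstein Λ O g) (hO : IsOpen O) (hy : y ∈ O ∩ intM)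
    {ζ η A B E : E4 → ℝ} (hζ : ContDiffAt ℝ ∞ ζ y) (hη : ContDiffAt ℝ ∞ η y)
    (hA : ContDiffAt ℝ ∞ A y) (hB : ContDiffAt ℝ ∞ B y) (hE' : ContDiffAt ℝ ∞ E y) :
    ContDiffAt ℝ ∞ (fluxC Λ g q ζ η A B E) y := by
  have hk := contDiffAt_sub_deSitter hE hO hy
  have hN := contDiffAt_Nf hy.2
  have hT := contDiffAt_Tf q hy.2
  have hm := contDiffAt_mu hy.2
  have hS := hE.contDiffAt_Sp hO hy
  have hY := (hζ.smul hT).add (hη.smul hN)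
  have hν := (hk.clm_apply hN).clm_apply hN
  have hflux : ContDiffAt ℝ ∞ (flux g (fun z => ζ z • Tf q z + η z • Nf z)) y :=
    (hS.clm_apply (hm.smul hY)).sub ((trL.contDiff.contDiffAt.comp y hS).smul (hm.smul hY))
  exact (hflux.add ((hm.mul ((((((contDiffAt_wf Λ hy.2).mul (contDiffAt_phi hy.2)).mul hζ).neg).mul
    ((hk.clm_apply hN).clm_apply hT)).add ((contDiffAt_const.mul hA).mul hν) |>.add
      ((contDiffAt_const.mul hE').mul (contDiffAt_trV Λ hk hy.2)))).smul hN)).add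
    ((hm.mul (hB.mul hν)).smul hT)

theorem contDiffAt_zetaF (hβ : ContDiff ℝ ∞ β) (hV : ContDiff ℝ ∞ V) (hy : y ∈ intM) :
    ContDiffAt ℝ ∞ (zetaF p β V) y :=
  ((contDiffAt_sT hy).mul (contDiffAt_comp_tau (contDiff_zr hV) hy)).mul (contDiffAt_chi hβ hy)

theorem contDiffAt_testX_flux (hE : IsEinstein Λ O g) (hO : IsOpen O) (hy : y ∈ O ∩ intM)
    (hβ : ContDiff ℝ ∞ β) (hV : ContDiff ℝ ∞ V) :
    ContDiffAt ℝ ∞ (fluxC Λ g q (zetaF p β V) (etaF p β V q)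
      (fun z => sT z * ar Λ V (tau z) * (cq q z * chi p β z))
      (fun z => br Λ V (tau z) * chi p β z)
      (fun z => sT z * zr V (tau z) * -Th p β q z)) y := by
  have hs := contDiffAt_sT hy.2
  have hχ := contDiffAt_chi (p := p) hβ hy.2
  have hc := contDiffAt_cq q hy.2
  exact contDiffAt_fluxC hE hO hy (contDiffAt_zetaF hβ hV hy.2)
    ((contDiffAt_comp_tau (contDiff_ur hV) hy.2).mul (hc.mul hχ))
    ((hs.mul (contDiffAt_comp_tau (contDiff_ar hV) hy.2)).mul (hc.mul hχ))
    ((contDiffAt_comp_tau (contDiff_br hV) hy.2).mul hχ)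
    ((hs.mul (contDiffAt_comp_tau (contDiff_zr hV) hy.2)).mul (contDiffAt_Th hβ hy.2).neg)

theorem contDiffAt_testX (hE : IsEinstein Λ O g) (hO : IsOpen O) (hy : y ∈ O ∩ intM)
    (hβ : ContDiff ℝ ∞ β) (hH : ContDiff ℝ ∞ (Hc β)) (hV : ContDiff ℝ ∞ V) :
    ContDiffAt ℝ ∞ (testX Λ p m β V q g) y := by
  have hk := contDiffAt_sub_deSitter hE hO hy
  have hN := contDiffAt_Nf hy.2
  have hT := fun q => contDiffAt_Tf q hy.2
  have hm := contDiffAt_mu hy.2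
  have hs := contDiffAt_sT hy.2
  have hf : ∀ i, ContDiffAt ℝ ∞ (fF Λ p β V i) y := fun i =>
    (hs.mul (contDiffAt_comp_tau (contDiff_wzr hV) hy.2)).mul
      ((contDiff_deriv hβ).contDiffAt.comp y (contDiffAt_cq (p i) hy.2))
  have hki : ∀ i, ∀ u v : E4 → E4, ContDiffAt ℝ ∞ u y → ContDiffAt ℝ ∞ v y →
      ContDiffAt ℝ ∞ (fun z => mu z * (1 / 2 * fF Λ p β V i z
        * (g z - deSitter Λ z) (u z) (v z))) y := fun i u v hu hv =>
    hm.mul ((contDiffAt_const.mul (hf i)).mul ((hk.clm_apply hu).clm_apply hv))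
  exact ((contDiffAt_testX_flux hE hO hy hβ hV).add (ContDiffAt.sum fun i _ =>
    (((hki i _ _ (hT q) (hT (p i))).smul hN).add ((hki i _ _ hN (hT (p i))).smul (hT q))).sub
      ((hki i _ _ hN (hT q)).smul (hT (p i))))).add
    ((hm.mul ((hs.mul (((contDiffAt_tau hy.2).pow 5).mul (contDiffAt_comp_tau hV hy.2))).mul
      (contDiffAt_const.mul (contDiffAt_obs hH hy.2)))).smul hN)

/-- The divergence identity for the test field. -/
theorem divg_testX (hΛ : 0 < Λ) (hE : IsEinstein Λ O g) (hO : IsOpen O) (hy : y ∈ O ∩ intM)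
    (hβ : ContDiff ℝ ∞ β) (hH : ContDiff ℝ ∞ (Hc β)) (hV : ContDiff ℝ ∞ V) :
    divg (testX Λ p m β V q g) y = mu y * (
      Λ / 3 * √(3 / Λ) * obs p m β q y * ((1 - 2 * tau y ^ 2) * tau y ^ 4 * V (tau y))
      + testErr Λ p m β V q g y) := by
  have hk := hE.differentiableAt_sub hO hy
  have hsy := hE.symm_sub hO hy
  have hN := differentiableAt_Nf hy.2
  have hT := fun q => differentiableAt_Tf q hy.2
  have hm := differentiableAt_mu hy.2
  have hs := sT_pos hy.2
  have hτ := tau_pos hy.2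
  have hsq := sT_sq hy.2
  have hζ := hasFDerivAt_zetaF (p := p) hβ hV hy.2
  have hη := hasFDerivAt_etaF (p := p) (q := q) hβ hV hy.2
  have hχ := hasFDerivAt_chi (p := p) hβ hy.2
  obtain ⟨DT, hTh, hThN⟩ := hasFDerivAt_Th (p := p) (q := q) hβ hy.2
  obtain ⟨Do, hob, hobN⟩ := hasFDerivAt_obs (p := p) (m := m) (q := q) hH hy.2
  have har := hasFDerivAt_sT_mul_comp_tau hy.2 (hasDerivAt_ar (Λ := Λ) hV (tau y))
  have hzr := hasFDerivAt_sT_mul_comp_tau hy.2 (hasDerivAt_zr hV (tau y))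
  have hwz := hasFDerivAt_sT_mul_comp_tau hy.2 (hasDerivAt_wzr (Λ := Λ) hV (tau y))
  have hp5 := hasFDerivAt_sT_mul_comp_tau hy.2 (hasDerivAt_pow_mul hV (tau y))
  have hbr := hasFDerivAt_comp_tau hy.2 ((differentiable_br (Λ := Λ) hV (tau y)).hasDerivAt)
  have hcχ := (hasFDerivAt_cq q hy.2).fun_mul hχ
  -- the derivatives of the coefficients
  have hA := har.fun_mul hcχ
  have hB := hbr.fun_mul hχ
  have hE' := hzr.fun_mul hTh.fun_neg
  have hF := hp5.fun_mul (hob.const_mul (Λ / 3 * √(3 / Λ)))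
  have hf : ∀ i, HasFDerivAt (fF Λ p β V i) _ y := fun i =>
    hwz.fun_mul (hasFDerivAt_comp_cq (contDiff_deriv hβ) (p i) hy.2)
  have dA := (fderiv_radial_mul hy.2 har hcχ (by simp [dC_Nf _ hy.2])).1
  have dB := (fderiv_radial_mul hy.2 hbr hχ (by simp [dC_Nf _ hy.2])).2 q
  have dE := (fderiv_radial_mul hy.2 hzr hTh.fun_neg (by simp [hThN])).1
  have dF := (fderiv_radial_mul hy.2 hp5 (hob.const_mul (Λ / 3 * √(3 / Λ))) (by simp [hobN])).1
  have df := fun i => fderiv_radial_mul hy.2 hwz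
    (hasFDerivAt_comp_cq (contDiff_deriv hβ) (p i) hy.2) (by simp [dC_Nf _ hy.2])
  have hThe : dC (Pf p β y) y (Tf q y) = Th p β q y := by
    simp only [Pf, dC_sum, dC_smul, _root_.sum_apply, _root_.smul_apply, smul_eq_mul,
      dC_Tf' _ _ hy.2, Th]
  -- differentiability of the summands
  have hX1 : DifferentiableAt ℝ (fluxC Λ g q (zetaF p β V) (etaF p β V q)
      (fun z => sT z * ar Λ V (tau z) * (cq q z * chi p β z))
      (fun z => br Λ V (tau z) * chi p β z)
      (fun z => sT z * zr V (tau z) * -Th p β q z)) y :=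
    (contDiffAt_testX_flux hE hO hy hβ hV).differentiableAt (by simp)
  have hki : ∀ u v : E4 → E4, DifferentiableAt ℝ u y → DifferentiableAt ℝ v y →
      DifferentiableAt ℝ (fun z => (g z - deSitter Λ z) (u z) (v z)) y := fun u v hu hv =>
    (hk.clm_apply hu).clm_apply hv
  have hX2 : ∀ i, DifferentiableAt ℝ (fun y =>
      (mu y * (1 / 2 * fF Λ p β V i y * (g y - deSitter Λ y) (Tf q y) (Tf (p i) y))) • Nf y
        + (mu y * (1 / 2 * fF Λ p β V i y * (g y - deSitter Λ y) (Nf y) (Tf (p i) y))) • Tf q y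
        - (mu y * (1 / 2 * fF Λ p β V i y * (g y - deSitter Λ y) (Nf y) (Tf q y))) • Tf (p i) y) y :=
    fun i => (((hm.mul ((((hf i).differentiableAt.const_mul (1 / 2))).mul
        (hki _ _ (hT q) (hT (p i))))).smul hN).add
      ((hm.mul ((((hf i).differentiableAt.const_mul (1 / 2))).mul
        (hki _ _ hN (hT (p i))))).smul (hT q))).sub
      ((hm.mul ((((hf i).differentiableAt.const_mul (1 / 2))).mul
        (hki _ _ hN (hT q)))).smul (hT (p i)))
  have hX3 : DifferentiableAt ℝ (fun y => (mu y * (sT y * (tau y ^ 5 * V (tau y))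
      * (Λ / 3 * √(3 / Λ) * obs p m β q y))) • Nf y) y :=
    (hm.mul hF.differentiableAt).smul hN
  have hdiv := divg_add (hX1.fun_add (DifferentiableAt.fun_sum (u := Finset.univ)
    fun i _ => hX2 i)) hX3
  rw [divg_add hX1 (DifferentiableAt.fun_sum (u := Finset.univ) fun i _ => hX2 i),
    divg_sum _ fun i _ => hX2 i] at hdiv
  refine hdiv.trans ?_
  rw [divg_fluxC hΛ hE hO hy q hζ hη hA.differentiableAt hB.differentiableAt hE'.differentiableAt
    ?_ ?_ ?_ ?_, divg_mul_Nf hy.2 hF.differentiableAt, dA, dB, dE, dF]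
  · simp only [divg_Psi_Tf_Tf hk hsy hy.2 _ q (hf _).differentiableAt]
    have hPsi : Psi (fun z => g z - deSitter Λ z) y (Tf q y) (Tf (Pf p β y) y) = ∑ i,
        deriv β (cq (p i) y) * Psi (fun z => g z - deSitter Λ z) y (Tf q y) (Tf (p i) y) := by
      rw [Pf, Tf_sum, Psi_sum]
      simp only [Tf_smul, Psi_smul]
    have hφ : phi y * sT y = -((1 - tau y ^ 2) / tau y) := by
      rw [phi, ← hsq]; field_simp
    -- On an annulus k(T_q, T_{p_i}) has weight ½ `wzN` + 3φ `sT` `wzr`, and k(N, N) has weight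
    -- -`br` times θ. Both components have the same leading part up to θ, so the `br` parts cancel
    -- and φ `sT` `wzr` alone produces the obstruction.
    have hbr' : 1 / 2 * wzN Λ V y + 2 * (phi y * sT y) * wzr Λ V (tau y) = br Λ V (tau y) := by
      rw [hφ, wzN, hsq, wzr, br]; field_simp; ring
    have hlead : ∀ i, deriv β (cq (p i) y) * lead Λ p m i y
        = 2 * m i * √(3 / Λ) * tau y * Hc β (cq (p i) y) := fun i => by
      rw [lead, Hc]; ring
    have hφw : phi y * sT y * wzr Λ V (tau y) * tau y
        = -(Λ / 6 * sT y ^ 2 * tau y ^ 5 * deriv V (tau y)) := by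
      rw [hφ, wzr, hsq]; field_simp
    have hterm : ∀ i, mu y * (fF Λ p β V i y * Psi (fun z => g z - deSitter Λ z) y (Tf q y) (Tf (p i) y)
        + (g y - deSitter Λ y) (Tf q y) (Tf (p i) y)
          * (1 / 2 * fderiv ℝ (fF Λ p β V i) y (Nf y) + 3 * phi y * fF Λ p β V i y)
        + 1 / 2 * (g y - deSitter Λ y) (Nf y) (Tf (p i) y)
          * (fderiv ℝ (fF Λ p β V i) y (Tf q y) - 2 * cq q y * fF Λ p β V i y)
        - 1 / 2 * (g y - deSitter Λ y) (Nf y) (Tf q y)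
          * (fderiv ℝ (fF Λ p β V i) y (Tf (p i) y) - 2 * cq (p i) y * fF Λ p β V i y))
        = mu y * annErr Λ p m β V q g i y
          + mu y * (sT y * wzr Λ V (tau y)) * (deriv β (cq (p i) y)
            * Psi (fun z => g z - deSitter Λ z) y (Tf q y) (Tf (p i) y))
          + mu y * (br Λ V (tau y) * (g y - deSitter Λ y) (Nf y) (Nf y)
            + (1 / 2 * zN V y + 2 * phi y * (sT y * zr V (tau y)))
              * trV Λ y (fun u v => (g y - deSitter Λ y) u v))
            * (deriv β (cq (p i) y) * theta (p i) q y)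
          - mu y * (Λ / 3 * √(3 / Λ) * sT y ^ 2 * tau y ^ 5 * deriv V (tau y))
            * (m i * (Hc β (cq (p i) y) * theta (p i) q y)) := by
      intro i
      have d1 : fderiv ℝ (fF Λ p β V i) y (Nf y) = wzN Λ V y * deriv β (cq (p i) y) := (df i).1
      have d2 : ∀ q, fderiv ℝ (fF Λ p β V i) y (Tf q y)
          = sT y * wzr Λ V (tau y) * (deriv (deriv β) (cq (p i) y) * theta (p i) q y) := by
        intro q
        rw [← dC_Tf' _ _ hy.2]
        exact (df i).2 q
      rw [d1, d2, d2, fF, annErr]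
      have h1 := hlead i
      generalize (g y - deSitter Λ y) (Tf q y) (Tf (p i) y) = K1
      generalize (g y - deSitter Λ y) (Nf y) (Tf (p i) y) = K2
      generalize (g y - deSitter Λ y) (Nf y) (Tf q y) = K3
      generalize (g y - deSitter Λ y) (Nf y) (Nf y) = K4
      generalize Psi (fun z => g z - deSitter Λ z) y (Tf q y) (Tf (p i) y) = K5
      generalize (trV Λ y fun u v => (g y - deSitter Λ y) u v) = K6
      generalize deriv (deriv β) (cq (p i) y) = b2
      generalize hb1 : deriv β (cq (p i) y) = b1 at h1 ⊢
      generalize hH0 : Hc β (cq (p i) y) = H0 at h1 ⊢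
      generalize lead Λ p m i y = ld at h1 ⊢
      generalize theta (p i) q y = th
      linear_combination (mu y * b1 * ld * th) * hbr'
        + (mu y * th * (phi y * sT y * wzr Λ V (tau y))) * h1
        + (mu y * th * 2 * m i * √(3 / Λ) * H0) * hφw
    simp only [hterm]
    rw [Finset.sum_sub_distrib, Finset.sum_add_distrib, Finset.sum_add_distrib, ← Finset.mul_sum,
      ← Finset.mul_sum, ← Finset.mul_sum, ← Finset.mul_sum, ← hPsi, Tf_smul, Psi_smul, testErr]
    have e1 : ∑ i, deriv β (cq (p i) y) * theta (p i) q y = Th p β q y := rfl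
    have e2 : ∑ i, m i * (Hc β (cq (p i) y) * theta (p i) q y) = obs p m β q y := rfl
    rw [e1, e2, _root_.neg_apply, hThe]
    generalize quadErr Λ g y q _ _ _ _ _ _ = Q
    generalize ∑ i, annErr Λ p m β V q g i y = A
    generalize (g y - deSitter Λ y) (Nf y) (Tf q y) = K3
    generalize (g y - deSitter Λ y) (Nf y) (Nf y) = K4
    generalize Psi (fun z => g z - deSitter Λ z) y (Tf q y) (Tf (Pf p β y) y) = K5
    generalize (trV Λ y fun u v => (g y - deSitter Λ y) u v) = K6
    -- Away from the annuli the coefficient of k(N, N) cancels at leading order in V, V' and V''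
    -- separately; only Λ/2 τ² η is left.
    have hνc : Λ * etaF p β V q y + 3 * phi y * (sT y * ar Λ V (tau y) * (cq q y * chi p β y))
        + 1 / 2 * ((-tau y * ar Λ V (tau y) + sT y ^ 2 * (Λ / 3 * (12 * tau y ^ 3 * V (tau y)
          + 21 / 2 * tau y ^ 4 * deriv V (tau y) + 3 / 2 * tau y ^ 5 * deriv (deriv V) (tau y))))
          * (cq q y * chi p β y)) - 3 * cq q y * (br Λ V (tau y) * chi p β y)
        = Λ / 2 * tau y ^ 2 * etaF p β V q y := by
      have : 3 * phi y * (sT y * ar Λ V (tau y) * (cq q y * chi p β y))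
        = 3 * (phi y * sT y) * (ar Λ V (tau y) * (cq q y * chi p β y)) := by ring
      rw [this, hφ, hsq, etaF, ar, br, ur]
      field_simp
      ring
    have hw : wf Λ y * zr V (tau y) = wzr Λ V (tau y) := by
      rw [wf, zr, wzr]; ring
    have hz : -tau y * zr V (tau y) + sT y ^ 2 * ((3 * tau y ^ 2 * deriv V (tau y)
        + tau y ^ 3 * deriv (deriv V) (tau y)) / 2) = zN V y := rfl
    have hφ5 : phi y * sT y * tau y = -(1 - tau y ^ 2) := by rw [hφ]; field_simp
    rw [hz]
    -- The last summand of `testX` trades V' in the annulus term for V, so that a nonnegative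
    -- profile appears. Its coefficient is 5(1 - τ²) - τ² - 4(1 - τ²) = 1 - 2τ².
    linear_combination (mu y * K4) * hνc - (mu y * sT y * K5) * hw
      + mu y * Λ / 3 * √(3 / Λ) * obs p m β q y * tau y ^ 4 * V (tau y) * (4 * hφ5 + 5 * hsq)
  · simp only [etaN, zetaF, wf, ar, zr]
    ring
  · simp only [br, zetaF, wf, zr, zN, phi]
    field_simp
    rw [hsq]
    ring
  · rw [dC_smul, _root_.smul_apply, hThe, smul_eq_mul]; ring
  -- This requirement ties the profiles together: for η built from t³ V it forces the factor t³ V'/2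
  -- in ζ.
  · simp only [etaN, etaF, zetaF, ur, zr, phi]
    field_simp
    ring

end

end

end SdSGluing

namespace SdSGluing

noncomputable section

/-! # Bounds for the perturbation -/

section

variable {O : Set E4} {y : E4}

theorem norm_dTau (hy : y ∈ intM) : ‖dTau y‖ ≤ 1 := by
  refine ContinuousLinearMap.opNorm_le_bound _ zero_le_one fun v => ?_
  have h0 := hy.1
  rw [dTau_apply, norm_neg, norm_div, norm_norm, one_mul, div_le_iff₀ h0, mul_comm]
  exact norm_inner_le_norm y v

theorem norm_fderiv_comp_tau_smul {F : Type*} [NormedAddCommGroup F] [NormedSpace ℝ F]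
    (hy : y ∈ intM) {f : ℝ → ℝ} {f' : ℝ} {h : E4 → F} (hf : HasDerivAt f f' (tau y))
    (hh : DifferentiableAt ℝ h y) :
    DifferentiableAt ℝ (fun z => f (tau z) • h z) y ∧
    ∀ v, ‖fderiv ℝ (fun z => f (tau z) • h z) y v‖
      ≤ |f'| * ‖h y‖ * ‖v‖ + |f (tau y)| * ‖fderiv ℝ h y v‖ := by
  have h1 : HasFDerivAt (fun z => f (tau z)) (f' • dTau y) y :=
    hf.comp_hasFDerivAt y (hasFDerivAt_tau hy)
  have h2 := h1.fun_smul hh.hasFDerivAt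
  refine ⟨h2.differentiableAt, fun v => ?_⟩
  rw [h2.fderiv, add_comm]
  have hv : ‖dTau y v‖ ≤ ‖v‖ := by simpa using (dTau y).le_of_opNorm_le (norm_dTau hy) v
  refine (norm_add_le _ _).trans (add_le_add ?_ ?_)
  · change ‖(f' * dTau y v) • h y‖ ≤ _
    rw [norm_smul, norm_mul, Real.norm_eq_abs]
    have := mul_le_mul_of_nonneg_left hv (mul_nonneg (abs_nonneg f') (norm_nonneg (h y)))
    nlinarith
  · change ‖f (tau y) • fderiv ℝ h y v‖ ≤ _
    rw [norm_smul, Real.norm_eq_abs]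

/-- The closed ball is convex with nonempty interior, so derivatives within it are determined up to
the boundary sphere. -/
theorem uniqueDiffOn_inter_M (hO : IsOpen O) : UniqueDiffOn ℝ (O ∩ M) := by
  have h1 : O ∩ M = Metric.closedBall (0 : E4) 1 ∩ (O ∩ {0}ᶜ) := by
    ext z
    simp only [M, Set.mem_inter_iff, Set.mem_ofPred_eq, norm_pos_iff, Metric.mem_closedBall,
      dist_zero_right, Set.mem_compl_iff, Set.mem_singleton_iff]
    tauto
  rw [h1]
  refine UniqueDiffOn.inter (uniqueDiffOn_convex (convex_closedBall 0 1) ?_)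
    (hO.inter isOpen_compl_singleton)
  rw [interior_closedBall (0 : E4) one_ne_zero]
  exact ⟨0, by simp⟩

theorem bounds_of_contDiffOn {F : Type*} [NormedAddCommGroup F] [NormedSpace ℝ F] (hO : IsOpen O)
    {a : E4 → F} (ha : ContDiffOn ℝ ∞ a (O ∩ M)) {K : Set E4} (hK : IsCompact K)
    (hKO : K ⊆ O ∩ M) :
    ∃ C, 0 ≤ C ∧ ∀ y ∈ K ∩ intM, ‖a y‖ ≤ C ∧ DifferentiableAt ℝ a y ∧
      ∀ v, ‖fderiv ℝ a y v‖ ≤ C * ‖v‖ := by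
  obtain ⟨C1, h1⟩ := hK.exists_bound_of_continuousOn (ha.continuousOn.mono hKO)
  obtain ⟨C2, h2⟩ := hK.exists_bound_of_continuousOn
    ((ha.continuousOn_fderivWithin (uniqueDiffOn_inter_M hO) (by simp)).mono hKO)
  refine ⟨max (max C1 C2) 0, le_max_right _ _, fun y hy => ?_⟩
  have hn : O ∩ M ∈ 𝓝 y := Filter.mem_of_superset
    ((hO.inter isOpen_intM).mem_nhds ⟨(hKO hy.1).1, hy.2⟩)
    (Set.inter_subset_inter_right _ fun z hz => ⟨hz.1, hz.2.le⟩)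
  refine ⟨(h1 y hy.1).trans ((le_max_left _ _).trans (le_max_left _ _)),
    (ha.contDiffAt hn).differentiableAt (by simp), fun v => ?_⟩
  have := h2 y hy.1
  rw [fderivWithin_of_mem_nhds hn] at this
  exact (fderiv ℝ a y).le_of_opNorm_le
    (this.trans ((le_max_right _ _).trans (le_max_left _ _))) v

/-- A Cartesian derivative becomes a b-derivative after multiplication by a function vanishing at
the boundary. As τ ≤ 1 - ‖y‖², bounds along these fields give Cartesian derivatives of size 1/τ. -/
theorem isBVectorField_radial (i : Fin 4) : IsBVectorField fun y => (1 - ‖y‖ ^ 2) • ev i := by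
  refine ⟨(contDiff_const.sub (contDiff_norm_sq ℝ)).smul contDiff_const, fun y hy => ?_⟩
  have : ‖y‖ = 1 := by simpa [bdryM] using hy
  simp [this]

theorem norm_fderiv_le_of_radial {F : Type*} [NormedAddCommGroup F] [NormedSpace ℝ F]
    (hy : y ∈ intM) {h : E4 → F} {C : Fin 4 → ℝ}
    (hC : ∀ i, ‖fderiv ℝ h y ((1 - ‖y‖ ^ 2) • ev i)‖ ≤ C i) (v : E4) :
    ‖fderiv ℝ h y v‖ ≤ (∑ i, max (C i) 0) * (tau y)⁻¹ * ‖v‖ := by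
  have hτ := tau_pos hy
  have hb : ∀ i, ‖fderiv ℝ h y (ev i)‖ ≤ max (C i) 0 * (tau y)⁻¹ := by
    intro i
    have h1 := hC i
    have h2 : tau y ≤ 1 - ‖y‖ ^ 2 := by
      have := hy.1; have := hy.2
      rw [tau]; nlinarith
    rw [map_smul, norm_smul, Real.norm_of_nonneg (hτ.le.trans h2)] at h1
    rw [← div_eq_mul_inv, le_div_iff₀ hτ, mul_comm]
    exact (mul_le_mul_of_nonneg_right h2 (norm_nonneg _)).trans (h1.trans (le_max_left _ _))
  have hvi : ∀ i, |v i| ≤ ‖v‖ := fun i => PiLp.norm_apply_le v i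
  rw [map_eq_sum (fderiv ℝ h y) v]
  calc _ ≤ ∑ i, ‖v i • fderiv ℝ h y (ev i)‖ := norm_sum_le _ _
    _ ≤ ∑ i, ‖v‖ * (max (C i) 0 * (tau y)⁻¹) := by
        refine Finset.sum_le_sum fun i _ => ?_
        rw [norm_smul]
        exact mul_le_mul (hvi i) (hb i) (norm_nonneg _) (norm_nonneg _)
    _ = (∑ i, max (C i) 0) * (tau y)⁻¹ * ‖v‖ := by
        rw [← Finset.mul_sum, ← Finset.sum_mul]; ring

theorem bounds_of_conormal {α : ℝ} {c : E4 → Bil} (hO : IsOpen O) (hc : IsConormal0Section O α c)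
    {K : Set E4} (hK : IsCompact K) (hKO : K ⊆ O ∩ M) :
    ∃ C, 0 ≤ C ∧ ∀ y ∈ K ∩ intM,
      DifferentiableAt ℝ (fun z => (tau z ^ (-α) * tau z ^ 2) • c z) y ∧
      ‖(tau y ^ (-α) * tau y ^ 2) • c y‖ ≤ C ∧
      ∀ v, ‖fderiv ℝ (fun z => (tau z ^ (-α) * tau z ^ 2) • c z) y v‖ ≤ C * (tau y)⁻¹ * ‖v‖ := by
  obtain ⟨C0, h0⟩ := hc.2.2 [] (by simp) K hK hKO
  have hY : ∀ i : Fin 4, ∃ C : ℝ, ∀ y ∈ K ∩ intM,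
      ‖fderiv ℝ (fun z => (tau z ^ (-α) * tau z ^ 2) • c z) y ((1 - ‖y‖ ^ 2) • ev i)‖ ≤ C := by
    intro i
    exact hc.2.2 [fun y => (1 - ‖y‖ ^ 2) • ev i] (by simpa using isBVectorField_radial i) K hK hKO
  choose C hC using hY
  refine ⟨max C0 0 + ∑ i, max (C i) 0, by positivity, fun y hy => ?_⟩
  have hyO : y ∈ O ∩ intM := ⟨(hKO hy.1).1, hy.2⟩
  have hτ := tau_pos hy.2
  have hd : DifferentiableAt ℝ c y := (hc.2.1.contDiffAt
    ((hO.inter isOpen_intM).mem_nhds hyO)).differentiableAt (by simp)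
  have hf : HasDerivAt (fun t : ℝ => t ^ (-α) * t ^ 2) _ (tau y) :=
    (Real.hasDerivAt_rpow_const (Or.inl hτ.ne')).mul (hasDerivAt_pow 2 (tau y))
  refine ⟨(norm_fderiv_comp_tau_smul (F := Bil) hy.2 hf hd).1, ?_, ?_⟩
  · exact (h0 y hy).trans ((le_max_left _ _).trans (le_add_of_nonneg_right (by positivity)))
  · intro v
    refine (norm_fderiv_le_of_radial (F := Bil) hy.2 (fun i => hC i y hy) v).trans ?_
    gcongr
    exact le_add_of_nonneg_left (le_max_right _ _)

/-- Trading the logarithm for half a power of τ loses nothing essential: all later remainders beat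
the critical order τ⁴ by at least one half. -/
theorem abs_log_le {t : ℝ} (h0 : 0 < t) (h1 : t ≤ 1) : |Real.log t| ≤ 2 * t ^ (-(1 / 2) : ℝ) := by
  have h := Real.abs_log_mul_self_rpow_lt t (1 / 2) h0 h1 (by norm_num)
  rw [abs_mul, abs_of_pos (Real.rpow_pos_of_pos h0 _)] at h
  rw [Real.rpow_neg h0.le, ← div_eq_mul_inv, le_div_iff₀ (Real.rpow_pos_of_pos h0 _)]
  norm_num at h
  exact h.le

theorem norm_expansion_le {F : Type*} [NormedAddCommGroup F] [NormedSpace ℝ F] {ε A B C : ℝ}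
    (hε : 0 < ε) (hA0 : 0 ≤ A) (hB0 : 0 ≤ B) (hC0 : 0 ≤ C) (hy : y ∈ intM) {a b c : E4 → F}
    (a1 : ‖a y‖ ≤ A) (a2 : DifferentiableAt ℝ a y) (a3 : ∀ v, ‖fderiv ℝ a y v‖ ≤ A * ‖v‖)
    (b1 : ‖b y‖ ≤ B) (b2 : DifferentiableAt ℝ b y) (b3 : ∀ v, ‖fderiv ℝ b y v‖ ≤ B * ‖v‖)
    (c1 : DifferentiableAt ℝ c y) (c2 : ‖c y‖ ≤ C)
    (c3 : ∀ v, ‖fderiv ℝ c y v‖ ≤ C * (tau y)⁻¹ * ‖v‖) :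
    ‖(tau y * Real.log (tau y)) • a y + tau y • b y + tau y ^ (1 + ε) • c y‖
      ≤ 5 * (A + B + (1 + ε) * C) * tau y ^ (1 / 2 : ℝ) ∧
    ∀ v, ‖fderiv ℝ (fun z => (tau z * Real.log (tau z)) • a z + tau z • b z
      + tau z ^ (1 + ε) • c z) y v‖
      ≤ 5 * (A + B + (1 + ε) * C) * tau y ^ (-(1 / 2) : ℝ) * ‖v‖ := by
  have hτ := tau_pos hy
  have hτ1 := (tau_lt_one hy).le
  have hlog := abs_log_le hτ hτ1
  have r1 : tau y ≤ tau y ^ (1 / 2 : ℝ) := by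
    simpa using Real.rpow_le_rpow_of_exponent_ge hτ hτ1 (by norm_num : (1 / 2 : ℝ) ≤ 1)
  have r2 : tau y * tau y ^ (-(1 / 2) : ℝ) = tau y ^ (1 / 2 : ℝ) := by
    nth_rw 1 [← Real.rpow_one (tau y)]
    rw [← Real.rpow_add hτ]; norm_num
  have r3 : tau y ^ (1 + ε) ≤ tau y ^ (1 / 2 : ℝ) :=
    Real.rpow_le_rpow_of_exponent_ge hτ hτ1 (by linarith)
  have r4 : tau y ^ ε ≤ tau y ^ (-(1 / 2) : ℝ) :=
    Real.rpow_le_rpow_of_exponent_ge hτ hτ1 (by linarith)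
  have r5 : 1 ≤ tau y ^ (-(1 / 2) : ℝ) :=
    Real.one_le_rpow_of_pos_of_le_one_of_nonpos hτ hτ1 (by norm_num)
  have r6 : tau y ^ (1 / 2 : ℝ) ≤ tau y ^ (-(1 / 2) : ℝ) :=
    Real.rpow_le_rpow_of_exponent_ge hτ hτ1 (by norm_num)
  have r7 : tau y ^ (1 + ε) * (tau y)⁻¹ = tau y ^ ε := by
    rw [← Real.rpow_neg_one, ← Real.rpow_add hτ]; norm_num
  have hp : (0 : ℝ) < tau y ^ (1 / 2 : ℝ) := Real.rpow_pos_of_pos hτ _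
  have hm : (0 : ℝ) < tau y ^ (-(1 / 2) : ℝ) := Real.rpow_pos_of_pos hτ _
  have l1 : |tau y * Real.log (tau y)| ≤ 2 * tau y ^ (1 / 2 : ℝ) := by
    rw [abs_mul, abs_of_pos hτ, ← r2]
    nlinarith
  constructor
  · refine (norm_add₃_le (E := F)).trans ?_
    rw [norm_smul, norm_smul, norm_smul, Real.norm_eq_abs, Real.norm_eq_abs, Real.norm_eq_abs,
      abs_of_pos hτ, abs_of_pos (Real.rpow_pos_of_pos hτ _)]
    have h1 := mul_le_mul l1 a1 (norm_nonneg _) (by positivity)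
    have h2 := mul_le_mul r1 b1 (norm_nonneg _) hp.le
    have h3 := mul_le_mul r3 c2 (norm_nonneg _) hp.le
    have := mul_nonneg hA0 hp.le
    have := mul_nonneg hB0 hp.le
    have := mul_nonneg hC0 hp.le
    have := mul_nonneg hε.le this
    nlinarith
  · intro v
    have d1 := norm_fderiv_comp_tau_smul hy (Real.hasDerivAt_mul_log hτ.ne') a2
    have d2 := norm_fderiv_comp_tau_smul hy (hasDerivAt_id (tau y)) b2
    have d3 := norm_fderiv_comp_tau_smul hy
      (Real.hasDerivAt_rpow_const (p := 1 + ε) (Or.inl hτ.ne')) c1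
    have e := ((d1.1.hasFDerivAt.fun_add d2.1.hasFDerivAt).fun_add d3.1.hasFDerivAt).fderiv
    have e2 := congrArg (fun D => D v) e
    refine (congrArg norm e2).trans_le ?_
    refine (norm_add₃_le (E := F)).trans ?_
    refine (add_le_add (add_le_add (d1.2 v) (d2.2 v)) (d3.2 v)).trans ?_
    have l2 : |Real.log (tau y) + 1| ≤ 3 * tau y ^ (-(1 / 2) : ℝ) := by
      refine (abs_add_le _ _).trans ?_
      rw [abs_one]
      linarith
    have l3 : |(1 + ε) * tau y ^ (1 + ε - 1)| ≤ (1 + ε) * tau y ^ (-(1 / 2) : ℝ) := by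
      rw [add_sub_cancel_left, abs_of_nonneg (by positivity)]
      gcongr
    have l4 : |tau y ^ (1 + ε)| * (tau y)⁻¹ ≤ tau y ^ (-(1 / 2) : ℝ) := by
      rw [abs_of_pos (Real.rpow_pos_of_pos hτ _), r7]; exact r4
    have t1 : |Real.log (tau y) + 1| * ‖a y‖ * ‖v‖ ≤ 3 * tau y ^ (-(1 / 2) : ℝ) * A * ‖v‖ := by
      gcongr
    have t2 : |tau y * Real.log (tau y)| * ‖fderiv ℝ a y v‖
        ≤ 2 * tau y ^ (-(1 / 2) : ℝ) * (A * ‖v‖) :=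
      mul_le_mul (l1.trans (by linarith)) (a3 v) (norm_nonneg _) (by positivity)
    have t3 : |(1 : ℝ)| * ‖b y‖ * ‖v‖ ≤ tau y ^ (-(1 / 2) : ℝ) * B * ‖v‖ := by
      rw [abs_one]
      gcongr
    have t4 : |id (tau y)| * ‖fderiv ℝ b y v‖ ≤ tau y ^ (-(1 / 2) : ℝ) * (B * ‖v‖) := by
      rw [id, abs_of_pos hτ]
      exact mul_le_mul (by linarith) (b3 v) (norm_nonneg _) (by positivity)
    have t5 : |(1 + ε) * tau y ^ (1 + ε - 1)| * ‖c y‖ * ‖v‖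
        ≤ (1 + ε) * tau y ^ (-(1 / 2) : ℝ) * C * ‖v‖ := by
      gcongr
    have t6 : |tau y ^ (1 + ε)| * ‖fderiv ℝ c y v‖ ≤ tau y ^ (-(1 / 2) : ℝ) * (C * ‖v‖) := by
      refine (mul_le_mul_of_nonneg_left (c3 v) (abs_nonneg _)).trans ?_
      calc _ = (|tau y ^ (1 + ε)| * (tau y)⁻¹) * (C * ‖v‖) := by ring
        _ ≤ _ := by gcongr
    refine (add_le_add (add_le_add (add_le_add t1 t2) (add_le_add t3 t4))
      (add_le_add t5 t6)).trans ?_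
    have hX : 0 ≤ tau y ^ (-(1 / 2) : ℝ) * ‖v‖ := by positivity
    have := mul_nonneg hB0 hX
    have := mul_nonneg hC0 hX
    have := mul_nonneg hε.le this
    nlinarith

/-- Bounds for the perturbation and its first derivatives. -/
theorem bounds_of_asymptotics {Λ ε : ℝ} {g : E4 → Bil} (hε : 0 < ε) (hO : IsOpen O)
    (hasymp : ∃ a b c : E4 → Bil, IsSmooth0Section O a ∧ IsSmooth0Section O b ∧
      IsConormal0Section O (3 + ε) c ∧ ∀ y ∈ O ∩ intM,
        g y - deSitter Λ y = (tau y ^ 3 * Real.log (tau y)) • a y + tau y ^ 3 • b y + c y)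
    {K : Set E4} (hK : IsCompact K) (hKO : K ⊆ O ∩ M) :
    ∃ C, 0 ≤ C ∧ ∀ y ∈ K ∩ intM, ‖g y - deSitter Λ y‖ ≤ C * tau y ^ (1 / 2 : ℝ) ∧
      ∀ v, ‖fderiv ℝ (fun z => g z - deSitter Λ z) y v‖ ≤ C * tau y ^ (-(1 / 2) : ℝ) * ‖v‖ := by
  obtain ⟨a, b, c, ⟨-, a', ha', haa⟩, ⟨-, b', hb', hbb⟩, hc, hk⟩ := hasymp
  obtain ⟨A, hA0, hA⟩ := bounds_of_contDiffOn hO ha' hK hKO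
  obtain ⟨B, hB0, hB⟩ := bounds_of_contDiffOn hO hb' hK hKO
  obtain ⟨C, hC0, hC⟩ := bounds_of_conormal hO hc hK hKO
  set c' := fun z => (tau z ^ (-(3 + ε)) * tau z ^ 2) • c z
  refine ⟨5 * (A + B + (1 + ε) * C) , by positivity, fun y hy => ?_⟩
  have hyO : y ∈ O ∩ intM := ⟨(hKO hy.1).1, hy.2⟩
  -- A section of the 0-bundle is τ⁻² times a tensor regular in the Cartesian frame, so the orders
  -- τ³ log τ, τ³ and τ^{3+ε} drop by two.
  have hkk : ∀ z ∈ O ∩ intM, g z - deSitter Λ z = (tau z * Real.log (tau z)) • a' z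
      + tau z • b' z + tau z ^ (1 + ε) • c' z := by
    intro z hz
    have hτ := tau_pos hz.2
    have e : tau z ^ (1 + ε) * (tau z ^ (-(3 + ε)) * tau z ^ 2) = 1 := by
      rw [← Real.rpow_natCast, ← Real.rpow_add hτ, ← Real.rpow_add hτ]
      have : 1 + ε + (-(3 + ε) + ((2 : ℕ) : ℝ)) = 0 := by push_cast; ring
      rw [this, Real.rpow_zero]
    rw [hk z hz, ← haa z hz, ← hbb z hz]
    simp only [c', smul_smul, e, one_smul]
    congr 3 <;> ring
  have hev : (fun z => g z - deSitter Λ z) =ᶠ[𝓝 y] fun z => (tau z * Real.log (tau z)) • a' z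
      + tau z • b' z + tau z ^ (1 + ε) • c' z := by
    filter_upwards [(hO.inter isOpen_intM).mem_nhds hyO] with z hz using hkk z hz
  obtain ⟨a1, a2, a3⟩ := hA y hy
  obtain ⟨b1, b2, b3⟩ := hB y hy
  obtain ⟨c1, c2, c3⟩ := hC y hy
  have := norm_expansion_le (F := Bil) hε hA0 hB0 hC0 hy.2 a1 a2 a3 b1 b2 b3 c1 c2 c3
  rw [hkk y hyO, hev.fderiv_eq]
  exact this

end

end

end SdSGluing

namespace SdSGluing

noncomputable section

/-! # Orders of vanishing at the conformal boundary -/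

/-- The filter of pairs `(δ, y)` with `δ → 0`, `δ ≤ τ(y) ≤ 2δ` and `y ∈ K`. -/
def shellF (K : Set E4) : Filter (ℝ × E4) :=
  Filter.comap Prod.fst (𝓝[>] 0) ⊓
    Filter.principal {x | x.2 ∈ K ∩ intM ∧ x.1 ≤ tau x.2 ∧ tau x.2 ≤ 2 * x.1}

theorem eventually_shellF {K : Set E4} {P : ℝ × E4 → Prop} :
    (∀ᶠ x in shellF K, P x) ↔ ∀ᶠ δ in 𝓝[>] (0 : ℝ), ∀ y ∈ K ∩ intM,
      δ ≤ tau y → tau y ≤ 2 * δ → P (δ, y) := by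
  rw [shellF, Filter.eventually_inf_principal, Filter.eventually_comap]
  refine Filter.eventually_congr (Filter.Eventually.of_forall fun δ => ?_)
  constructor
  · intro h y hy h1 h2
    exact h (δ, y) rfl ⟨hy, h1, h2⟩
  · rintro h ⟨δ', y⟩ rfl ⟨hy, h1, h2⟩
    exact h y hy h1 h2

section

set_option linter.unusedSectionVars false

variable {K : Set E4} {F : Type*} [NormedAddCommGroup F] [NormedSpace ℝ F]

theorem shellF_basic (K : Set E4) {r : ℝ} (hr : 0 < r) : ∀ᶠ x in shellF K,
    x.2 ∈ K ∩ intM ∧ 0 < x.1 ∧ x.1 ≤ tau x.2 ∧ tau x.2 ≤ 2 * x.1 ∧ tau x.2 < r := by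
  rw [eventually_shellF]
  filter_upwards [self_mem_nhdsWithin, Ioo_mem_nhdsGT (half_pos hr)] with δ h0 hδ y hy h1 h2
  exact ⟨hy, h0, h1, h2, by linarith [hδ.2]⟩

/-- `f` is of order `τ ^ a`. -/
def Ord (K : Set E4) (a : ℝ) (f : ℝ × E4 → F) : Prop :=
  f =O[shellF K] fun x => tau x.2 ^ a

theorem Ord.of_le {a C : ℝ} {f : ℝ × E4 → F} {r : ℝ} (hr : 0 < r)
    (h : ∀ x : ℝ × E4, x.2 ∈ K ∩ intM → 0 < x.1 → x.1 ≤ tau x.2 → tau x.2 ≤ 2 * x.1 →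
      tau x.2 < r → ‖f x‖ ≤ C * tau x.2 ^ a) : Ord K a f := by
  refine Asymptotics.IsBigO.of_bound C ?_
  filter_upwards [shellF_basic K hr] with x hx
  rw [Real.norm_of_nonneg (Real.rpow_nonneg (tau_pos hx.1.2).le _)]
  exact h x hx.1 hx.2.1 hx.2.2.1 hx.2.2.2.1 hx.2.2.2.2

theorem rpow_add_eventually (K : Set E4) (a b : ℝ) :
    (fun x : ℝ × E4 => tau x.2 ^ a * tau x.2 ^ b) =ᶠ[shellF K] fun x => tau x.2 ^ (a + b) := by
  filter_upwards [shellF_basic K one_pos] with x hx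
  rw [Real.rpow_add (tau_pos hx.1.2)]

theorem Ord.mono {a b : ℝ} {f : ℝ × E4 → F} (h : Ord K a f) (hab : b ≤ a) : Ord K b f := by
  refine Asymptotics.IsBigO.trans h (Asymptotics.IsBigO.of_bound 1 ?_)
  filter_upwards [shellF_basic K one_pos] with x hx
  have h0 := tau_pos hx.1.2
  rw [Real.norm_of_nonneg (Real.rpow_nonneg h0.le _), Real.norm_of_nonneg (Real.rpow_nonneg h0.le _),
    one_mul]
  exact Real.rpow_le_rpow_of_exponent_ge h0 hx.2.2.2.2.le hab

theorem Ord.smul {a b c : ℝ} {f : ℝ × E4 → ℝ} {g : ℝ × E4 → F} (hf : Ord K a f) (hg : Ord K b g)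
    (hc : a + b = c) : Ord K c fun x => f x • g x :=
  hc ▸ (Asymptotics.IsBigO.smul hf hg).trans_eventuallyEq (rpow_add_eventually K a b)

theorem Ord.mul {a b c : ℝ} {f g : ℝ × E4 → ℝ} (hf : Ord K a f) (hg : Ord K b g)
    (hc : a + b = c) : Ord K c fun x => f x * g x := hf.smul hg hc

theorem Ord.add {a : ℝ} {f g : ℝ × E4 → F} (hf : Ord K a f) (hg : Ord K a g) :
    Ord K a fun x => f x + g x := Asymptotics.IsBigO.add hf hg

theorem Ord.sub {a : ℝ} {f g : ℝ × E4 → F} (hf : Ord K a f) (hg : Ord K a g) :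
    Ord K a fun x => f x - g x := Asymptotics.IsBigO.sub hf hg

theorem Ord.neg {a : ℝ} {f : ℝ × E4 → F} (hf : Ord K a f) : Ord K a fun x => -f x :=
  Asymptotics.IsBigO.neg_left hf

theorem Ord.const (c : F) : Ord K 0 fun _ => c :=
  Ord.of_le (C := ‖c‖) one_pos fun x _ _ _ _ _ => by simp

theorem Ord.cmul {a : ℝ} {f : ℝ × E4 → ℝ} (c : ℝ) (hf : Ord K a f) : Ord K a fun x => c * f x :=
  (Ord.const c).mul hf (zero_add a)

theorem Ord.sum {ι : Type*} {s : Finset ι} {a : ℝ} {f : ι → ℝ × E4 → F} (hf : ∀ i, Ord K a (f i)) :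
    Ord K a fun x => ∑ i ∈ s, f i x := Asymptotics.IsBigO.fun_sum fun i _ => hf i

theorem Ord.isLittleO {a b : ℝ} {f : ℝ × E4 → F} (h : Ord K a f) (hab : b < a) :
    f =o[shellF K] fun x => tau x.2 ^ b := by
  refine Asymptotics.IsBigO.trans_isLittleO h ?_
  have ht : Filter.Tendsto (fun x : ℝ × E4 => tau x.2 ^ (a - b)) (shellF K) (𝓝 0) := by
    have h1 : Filter.Tendsto (fun x : ℝ × E4 => tau x.2) (shellF K) (𝓝 0) := by
      rw [Metric.tendsto_nhds]
      intro r hr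
      filter_upwards [shellF_basic K hr] with x hx
      rw [Real.dist_eq, sub_zero, abs_of_pos (tau_pos hx.1.2)]
      exact hx.2.2.2.2
    have h2 := h1.rpow_const (p := a - b) (Or.inr (sub_pos.2 hab).le)
    rwa [Real.zero_rpow (sub_pos.2 hab).ne'] at h2
  have h3 := (Asymptotics.isLittleO_one_iff ℝ).2 ht
  have h4 := h3.mul_isBigO (Asymptotics.isBigO_refl (fun x : ℝ × E4 => tau x.2 ^ b) (shellF K))
  simp only [one_mul] at h4
  refine h4.congr' ?_ (Filter.EventuallyEq.refl _ _)
  exact (rpow_add_eventually K (a - b) b).trans (by simp)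

theorem isLittleO_mul_ord {a b c : ℝ} {f g : ℝ × E4 → ℝ}
    (hf : f =o[shellF K] fun x => tau x.2 ^ a) (hg : Ord K b g) (hc : a + b = c) :
    (fun x => f x * g x) =o[shellF K] fun x => tau x.2 ^ c :=
  hc ▸ (hf.mul_isBigO hg).trans_eventuallyEq (rpow_add_eventually K a b)

/-- A bilinear map is of order `τ ^ a`. -/
def OrdB (K : Set E4) (a : ℝ) (B : ℝ × E4 → E4 → E4 → F) : Prop :=
  ∃ C, ∀ᶠ x in shellF K, ∀ u v, ‖B x u v‖ ≤ C * tau x.2 ^ a * ‖u‖ * ‖v‖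

/-- A linear map is of order `τ ^ a`. -/
def OrdL (K : Set E4) (a : ℝ) (A : ℝ × E4 → E4 → F) : Prop :=
  ∃ C, ∀ᶠ x in shellF K, ∀ u, ‖A x u‖ ≤ C * tau x.2 ^ a * ‖u‖

theorem OrdL.apply {a b c : ℝ} {A : ℝ × E4 → E4 → F} (hA : OrdL K a A) {u : ℝ × E4 → E4}
    (hu : Ord K b u) (hc : a + b = c) : Ord K c fun x => A x (u x) := by
  obtain ⟨C, hC⟩ := hA
  subst hc
  refine Asymptotics.IsBigO.trans (Asymptotics.IsBigO.of_bound C (g := fun x : ℝ × E4 =>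
    tau x.2 ^ a * ‖u x‖) ?_) (((Asymptotics.isBigO_refl _ _).mul hu.norm_left).trans_eventuallyEq
      (rpow_add_eventually K a b))
  filter_upwards [hC, shellF_basic K one_pos] with x hx hx'
  rw [norm_mul, norm_norm, Real.norm_of_nonneg (Real.rpow_nonneg (tau_pos hx'.1.2).le _), ← mul_assoc]
  exact hx _

theorem OrdB.apply {a b c d : ℝ} {B : ℝ × E4 → E4 → E4 → F} (hB : OrdB K a B) {u v : ℝ × E4 → E4}
    (hu : Ord K b u) (hv : Ord K c v) (hd : a + b + c = d) : Ord K d fun x => B x (u x) (v x) := by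
  obtain ⟨C, hC⟩ := hB
  subst hd
  refine Asymptotics.IsBigO.trans (Asymptotics.IsBigO.of_bound C (g := fun x : ℝ × E4 =>
    tau x.2 ^ a * ‖u x‖ * ‖v x‖) ?_)
    ((((((Asymptotics.isBigO_refl _ _).mul hu.norm_left).trans_eventuallyEq
      (rpow_add_eventually K a b))).mul hv.norm_left).trans_eventuallyEq
      (rpow_add_eventually K (a + b) c))
  filter_upwards [hC, shellF_basic K one_pos] with x hx hx'
  rw [norm_mul, norm_mul, norm_norm, norm_norm,
    Real.norm_of_nonneg (Real.rpow_nonneg (tau_pos hx'.1.2).le _), ← mul_assoc, ← mul_assoc]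
  exact hx _ _

end

/-! ## Orders of the background quantities -/

section

variable {K : Set E4} {y : E4}

theorem half_lt_norm (h : tau y < 1 / 2) : 1 / 2 < ‖y‖ := by rw [tau] at h; linarith

theorem sT_le_one (y : E4) : sT y ≤ 1 :=
  Real.sqrt_le_one.2 (by nlinarith [sq_nonneg (tau y)])

theorem half_lt_sT (hy : y ∈ intM) (h : tau y < 1 / 2) : 1 / 2 < sT y := by
  have h1 := sT_sq hy
  have h2 := sT_pos hy
  have h3 := tau_pos hy
  nlinarith

theorem abs_cq_le (q : E4) (hy : y ∈ intM) : |cq q y| ≤ ‖q‖ := by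
  rw [cq_eq, abs_div, abs_norm, div_le_iff₀ hy.1]
  exact abs_real_inner_le_norm q y

theorem norm_Nf_le (hy : y ∈ intM) : ‖Nf y‖ ≤ 1 := by
  rw [Nf, norm_smul, norm_neg, norm_div, norm_norm, div_mul_cancel₀ _ hy.1.ne',
    Real.norm_of_nonneg (sT_pos hy).le]
  exact sT_le_one y

theorem norm_Tf_le (q : E4) (hy : y ∈ intM) : ‖Tf q y‖ ≤ 2 * ‖q‖ := by
  rw [Tf, ← cq_eq]
  refine (norm_sub_le _ _).trans ?_
  rw [norm_smul, norm_smul, norm_norm, Real.norm_eq_abs]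
  have h1 := abs_cq_le q hy
  have h2 := hy.2
  have h3 := norm_nonneg y
  have h4 := norm_nonneg q
  nlinarith [abs_nonneg (cq q y)]

theorem ord_tau_pow (n : ℕ) : Ord K n fun x => tau x.2 ^ n :=
  Ord.of_le (C := 1) one_pos fun x hx _ _ _ _ => by
    rw [Real.rpow_natCast, one_mul, Real.norm_of_nonneg (pow_nonneg (tau_pos hx.2).le _)]

theorem ord_tau : Ord K 1 fun x => tau x.2 := by simpa using ord_tau_pow (K := K) 1

theorem ord_sT : Ord K 0 fun x => sT x.2 :=
  Ord.of_le (C := 1) one_pos fun x hx _ _ _ _ => by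
    rw [Real.norm_of_nonneg (sT_pos hx.2).le]; simpa using sT_le_one x.2

theorem ord_phi : Ord K (-1) fun x => phi x.2 :=
  Ord.of_le (C := 1) one_pos fun x hx _ _ _ _ => by
    rw [phi, norm_div, norm_neg, Real.norm_of_nonneg (sT_pos hx.2).le,
      Real.norm_of_nonneg (tau_pos hx.2).le, Real.rpow_neg_one, div_eq_mul_inv]
    exact mul_le_mul_of_nonneg_right (sT_le_one _) (inv_nonneg.2 (tau_pos hx.2).le)

theorem ord_wf (Λ : ℝ) : Ord K 2 fun x => wf Λ x.2 :=
  Ord.cmul _ (by simpa using ord_tau_pow (K := K) 2)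

theorem ord_Nf : Ord K 0 fun x => Nf x.2 :=
  Ord.of_le (C := 1) one_pos fun x hx _ _ _ _ => by simpa using norm_Nf_le hx.2

theorem ord_Tf (q : E4) : Ord K 0 fun x => Tf q x.2 :=
  Ord.of_le (C := 2 * ‖q‖) one_pos fun x hx _ _ _ _ => by simpa using norm_Tf_le q hx.2

theorem ord_Tf_comp {a : ℝ} {q : ℝ × E4 → E4} (hq : Ord K a q) : Ord K a fun x => Tf (q x) x.2 := by
  have h : OrdL K 0 fun (x : ℝ × E4) u => Tf u x.2 := by
    refine ⟨2, ?_⟩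
    filter_upwards [shellF_basic K one_pos] with x hx u
    simpa using norm_Tf_le u hx.1.2
  exact h.apply hq (zero_add a)

theorem ord_comp_cq {f : ℝ → ℝ} (hf : Continuous f) (q : E4) : Ord K 0 fun x => f (cq q x.2) := by
  obtain ⟨C, hC⟩ := (isCompact_Icc (a := -‖q‖) (b := ‖q‖)).exists_bound_of_continuousOn
    hf.continuousOn
  exact Ord.of_le (C := C) one_pos fun x hx _ _ _ _ => by
    simpa using hC _ (abs_le.1 (abs_cq_le q hx.2))

theorem ord_cq (q : E4) : Ord K 0 fun x => cq q x.2 := ord_comp_cq continuous_id q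

theorem ord_theta (p q : E4) : Ord K 0 fun x => theta p q x.2 :=
  (Ord.const _).sub ((ord_cq p).mul (ord_cq q) (zero_add 0))

theorem norm_ev (i : Fin 4) : ‖ev i‖ = 1 := by simp [ev]

theorem abs_trE_le {A : E4 →L[ℝ] E4} {D : ℝ} (h : ∀ u, ‖A u‖ ≤ D * ‖u‖) : |trE A| ≤ 4 * D := by
  refine (Finset.abs_sum_le_sum_abs _ _).trans ?_
  refine (Finset.sum_le_card_nsmul _ _ D fun i _ => ?_).trans (by simp)
  have := (PiLp.norm_apply_le (A (ev i)) i).trans (h (ev i))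
  simpa [norm_ev] using this

theorem abs_trV_le {Λ D : ℝ} (hΛ : 0 < Λ) (hy : y ∈ intM) (hτ : tau y < 1 / 2) {f : E4 → E4 → ℝ}
    (h : ∀ u v, |f u v| ≤ D * ‖u‖ * ‖v‖) : |trV Λ y f| ≤ 4 * Λ * D * tau y ^ 2 := by
  have h0 := half_lt_norm hτ
  have h1 := hy.2
  have hD : 0 ≤ D := by simpa [norm_ev] using (abs_nonneg _).trans (h (ev 0) (ev 0))
  have e1 : |∑ i, f (ev i) (ev i)| ≤ 4 * D := by
    refine (Finset.abs_sum_le_sum_abs _ _).trans ?_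
    refine (Finset.sum_le_card_nsmul _ _ D fun i _ => ?_).trans (by simp)
    simpa [norm_ev] using h (ev i) (ev i)
  have e2 : |2 / ‖y‖ ^ 3 * f y y| ≤ 2 / ‖y‖ * D := by
    rw [abs_mul, abs_of_pos (by positivity)]
    calc 2 / ‖y‖ ^ 3 * |f y y| ≤ 2 / ‖y‖ ^ 3 * (D * ‖y‖ * ‖y‖) := by
          gcongr; exact h y y
      _ = _ := by field_simp
  have e3 : 2 / ‖y‖ ≤ 4 := by
    rw [div_le_iff₀ (by linarith)]; linarith
  rw [trV, abs_mul, abs_of_nonneg (by positivity)]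
  have e4 : |∑ i, f (ev i) (ev i) - 2 / ‖y‖ ^ 3 * f y y| ≤ 12 * D :=
    (abs_sub _ _).trans (by nlinarith)
  have e5 : ‖y‖ ^ 2 ≤ 1 := by nlinarith
  calc _ ≤ Λ / 3 * (tau y ^ 2 * 1) * (12 * D) := by gcongr
    _ = _ := by ring

theorem norm_fderiv_Nf_le (hy : y ∈ intM) (hτ : tau y < 1 / 2) (u : E4) :
    ‖fderiv ℝ Nf y u‖ ≤ 20 * ‖u‖ := by
  have h0 := half_lt_norm hτ
  have h1 := hy.2
  have hs := half_lt_sT hy hτ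
  have hs1 := sT_le_one y
  have ht := tau_pos hy
  rw [(hasFDerivAt_Nf hy).fderiv]
  change ‖-(sT y / ‖y‖) • u + -(tau y / (sT y * ‖y‖ ^ 2) - sT y / ‖y‖ ^ 3) • (⟪y, u⟫_ℝ • y)‖ ≤ _
  refine (norm_add_le _ _).trans ?_
  rw [norm_smul, norm_smul, norm_smul, norm_neg, norm_neg, Real.norm_of_nonneg (by positivity)]
  have e1 : sT y / ‖y‖ ≤ 2 := by rw [div_le_iff₀ (by linarith)]; linarith
  have e2 : tau y / (sT y * ‖y‖ ^ 2) ≤ 4 := by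
    rw [div_le_iff₀ (by positivity)]
    nlinarith [mul_lt_mul'' hs (mul_lt_mul'' h0 h0 (by norm_num) (by norm_num)) (by norm_num)
      (by norm_num)]
  have e3 : sT y / ‖y‖ ^ 3 ≤ 8 := by
    rw [div_le_iff₀ (by positivity)]
    nlinarith [pow_lt_pow_left₀ h0 (by norm_num) (three_ne_zero)]
  have e4 : ‖tau y / (sT y * ‖y‖ ^ 2) - sT y / ‖y‖ ^ 3‖ ≤ 12 := by
    rw [Real.norm_eq_abs, abs_le]
    have : 0 ≤ tau y / (sT y * ‖y‖ ^ 2) := by positivity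
    have : 0 ≤ sT y / ‖y‖ ^ 3 := by positivity
    constructor <;> linarith
  have e5 : ‖⟪y, u⟫_ℝ‖ * ‖y‖ ≤ ‖u‖ := by
    have := norm_inner_le_norm (𝕜 := ℝ) y u
    have h2 := norm_nonneg u
    have h3 : ‖y‖ * ‖u‖ ≤ ‖u‖ := by nlinarith
    nlinarith [norm_nonneg ⟪y, u⟫_ℝ]
  have := mul_le_mul e4 e5 (by positivity) (by norm_num)
  have := mul_le_mul_of_nonneg_right e1 (norm_nonneg u)
  nlinarith [norm_nonneg u]

theorem norm_GamB_le (hy : y ∈ intM) (hτ : tau y < 1 / 2) (u v : E4) :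
    ‖GamB y u v‖ ≤ 200 * (tau y)⁻¹ * ‖u‖ * ‖v‖ := by
  have h0 := half_lt_norm hτ
  have h1 := hy.2
  have ht := tau_pos hy
  have i0 : ‖y‖⁻¹ ≤ 2 := by rw [inv_le_comm₀ (by linarith) (by norm_num)]; linarith
  have i1 : 0 < ‖y‖⁻¹ := inv_pos.2 (by linarith)
  have j0 : 2 ≤ (tau y)⁻¹ := by rw [le_inv_comm₀ (by norm_num) ht]; linarith
  have k0 : (2 - ‖y‖)⁻¹ ≤ 1 := inv_le_one_of_one_le₀ (by linarith)
  have k1 : 0 < (2 - ‖y‖)⁻¹ := inv_pos.2 (by linarith)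
  have p2 : (‖y‖ ^ 2)⁻¹ ≤ 4 := by
    rw [← inv_pow]; exact (pow_le_pow_left₀ i1.le i0 2).trans (by norm_num)
  have p3 : (‖y‖ ^ 3)⁻¹ ≤ 8 := by
    rw [← inv_pow]; exact (pow_le_pow_left₀ i1.le i0 3).trans (by norm_num)
  have p4 : (‖y‖ ^ 4)⁻¹ ≤ 16 := by
    rw [← inv_pow]; exact (pow_le_pow_left₀ i1.le i0 4).trans (by norm_num)
  have q2 : 0 < (‖y‖ ^ 2)⁻¹ := by positivity
  have q3 : 0 < (‖y‖ ^ 3)⁻¹ := by positivity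
  have q4 : 0 < (‖y‖ ^ 4)⁻¹ := by positivity
  have a1 : 0 ≤ (tau y)⁻¹ - ‖y‖⁻¹ := by linarith
  have b1 : 0 ≤ g1 y := mul_nonneg a1 i1.le
  have b1' : g1 y ≤ 2 * (tau y)⁻¹ := by
    rw [g1, mul_comm]
    exact mul_le_mul i0 (by linarith) a1 (by norm_num)
  have b2 : 0 ≤ g2 y := by
    have : 0 ≤ 2 - ‖y‖ := by linarith
    unfold g2; positivity
  have b2' : g2 y ≤ 16 * (tau y)⁻¹ := by
    have e1 : (2 - ‖y‖) * g1 y * ‖y‖⁻¹ ≤ 3 / 2 * (2 * (tau y)⁻¹) * 2 := by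
      gcongr
      linarith
    unfold g2; linarith
  have b3 : |g3 y| ≤ 166 * (tau y)⁻¹ := by
    have e1 : (2 * ‖y‖)⁻¹ ≤ 1 := inv_le_one_of_one_le₀ (by linarith)
    have e1' : 0 < (2 * ‖y‖)⁻¹ := by positivity
    have e2 : 4 * (‖y‖ ^ 3)⁻¹ * (tau y)⁻¹ ≤ 4 * 8 * (tau y)⁻¹ := by gcongr
    have e2' : 0 ≤ 4 * (‖y‖ ^ 3)⁻¹ * (tau y)⁻¹ := by positivity
    have e3 : (‖y‖ ^ 2 * (2 - ‖y‖))⁻¹ ≤ 4 * 1 := by rw [mul_inv]; gcongr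
    have e3' : 0 ≤ (‖y‖ ^ 2 * (2 - ‖y‖))⁻¹ := by rw [mul_inv]; positivity
    have e4 : 4 * g1 y * (‖y‖ ^ 3)⁻¹ ≤ 4 * (2 * (tau y)⁻¹) * 8 := by gcongr
    have e4' : 0 ≤ 4 * g1 y * (‖y‖ ^ 3)⁻¹ := by positivity
    have e5 : |4 * (‖y‖ ^ 3)⁻¹ * (tau y)⁻¹ + (‖y‖ ^ 3)⁻¹ - 8 * (‖y‖ ^ 4)⁻¹
        + (‖y‖ ^ 2 * (2 - ‖y‖))⁻¹| ≤ 32 * (tau y)⁻¹ + 64 * (tau y)⁻¹ := by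
      rw [abs_le]; constructor <;> linarith
    unfold g3
    refine (abs_sub _ _).trans ?_
    rw [abs_mul, abs_of_pos e1', abs_of_nonneg e4']
    have := mul_le_mul e5 e1 e1'.le (by positivity)
    linarith
  have y1 : |⟪y, u⟫_ℝ| ≤ ‖u‖ := (abs_real_inner_le_norm y u).trans
    (mul_le_of_le_one_left (norm_nonneg u) h1.le)
  have y2 : |⟪y, v⟫_ℝ| ≤ ‖v‖ := (abs_real_inner_le_norm y v).trans
    (mul_le_of_le_one_left (norm_nonneg v) h1.le)
  have y3 := abs_real_inner_le_norm u v
  rw [GamB_apply]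
  refine (norm_add_le _ _).trans ?_
  rw [norm_smul, norm_smul, Real.norm_eq_abs, Real.norm_eq_abs, abs_of_nonneg b1]
  have z1 : ‖⟪y, u⟫_ℝ • v + ⟪y, v⟫_ℝ • u‖ ≤ 2 * (‖u‖ * ‖v‖) := by
    refine (norm_add_le _ _).trans ?_
    rw [norm_smul, norm_smul, Real.norm_eq_abs, Real.norm_eq_abs]
    have := mul_le_mul_of_nonneg_right y1 (norm_nonneg v)
    have := mul_le_mul_of_nonneg_right y2 (norm_nonneg u)
    linarith
  have z2 : |g2 y * ⟪u, v⟫_ℝ + g3 y * (⟪y, u⟫_ℝ * ⟪y, v⟫_ℝ)| * ‖y‖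
      ≤ 182 * (tau y)⁻¹ * (‖u‖ * ‖v‖) := by
    refine (mul_le_of_le_one_right (abs_nonneg _) h1.le).trans ((abs_add_le _ _).trans ?_)
    rw [abs_mul, abs_mul, abs_mul, abs_of_nonneg b2]
    have := mul_le_mul b2' y3 (abs_nonneg _) (by positivity)
    have := mul_le_mul b3 (mul_le_mul y1 y2 (abs_nonneg _) (norm_nonneg _)) (by positivity)
      (by positivity)
    linarith
  have z3 := mul_le_mul b1' z1 (norm_nonneg _) (by positivity)
  have : 0 ≤ (tau y)⁻¹ * (‖u‖ * ‖v‖) := by positivity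
  linarith

/-- The de Sitter metric is nondegenerate, uniformly after rescaling. -/
theorem exists_deSitter_ge {Λ : ℝ} (hΛ : 0 < Λ) (hy : y ∈ intM) (x : E4) :
    ∃ w : E4, ‖w‖ ≤ ‖x‖ ∧ 3 / Λ * (tau y ^ 2)⁻¹ * ‖x‖ ^ 2 ≤ deSitter Λ y x w := by
  have h0 := hy.1
  have h1 := hy.2
  have ht := tau_pos hy
  have h2 := two_sub_norm_pos hy
  obtain ⟨n, hn, hyn⟩ : ∃ n : E4, ‖n‖ = 1 ∧ ∀ v, ⟪y, v⟫_ℝ = ‖y‖ * ⟪n, v⟫_ℝ := by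
    refine ⟨‖y‖⁻¹ • y, ?_, fun v => ?_⟩
    · simp only [norm_smul, norm_inv, norm_norm]; field_simp
    · simp only [inner_smul_left]; simp; field_simp
  set α := ⟪n, x⟫_ℝ
  have hw : ‖x - (2 * α) • n‖ ^ 2 = ‖x‖ ^ 2 := by
    rw [norm_sub_sq_real, norm_smul, hn, inner_smul_right, real_inner_comm n x, mul_one,
      Real.norm_eq_abs, sq_abs]
    change _ - 2 * (2 * α * α) + _ = _
    ring
  -- Reflecting the timelike radial component turns the Lorentzian pairing with x into a positive
  -- definite expression.
  refine ⟨x - (2 * α) • n, le_of_eq ((sq_eq_sq₀ (norm_nonneg _) (norm_nonneg _)).1 hw), ?_⟩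
  rw [deSitter_apply Λ hy, hyn, hyn, inner_sub_right, inner_sub_right, inner_smul_right,
    inner_smul_right, real_inner_self_eq_norm_sq, real_inner_self_eq_norm_sq, hn,
    real_inner_comm n x]
  change _ ≤ bA Λ y * (‖x‖ ^ 2 - 2 * α * α) + bB Λ y * (‖y‖ * α * (‖y‖ * (α - 2 * α * 1 ^ 2)))
  have hα : α ^ 2 ≤ ‖x‖ ^ 2 := by
    have := abs_real_inner_le_norm n x
    rw [hn, one_mul] at this
    exact sq_le_sq' (by linarith [abs_le.1 this]) (abs_le.1 this).2
  have e : bA Λ y * (‖x‖ ^ 2 - 2 * α * α) + bB Λ y * (‖y‖ * α * (‖y‖ * (α - 2 * α * 1 ^ 2)))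
      = 3 / Λ * (tau y ^ 2)⁻¹ * ((‖x‖ ^ 2 - α ^ 2) * (‖y‖ ^ 2)⁻¹ + α ^ 2 * (‖y‖ * (2 - ‖y‖))⁻¹) := by
    simp only [bA, bB]
    field_simp
    ring
  rw [e]
  have e1 : 1 ≤ (‖y‖ ^ 2)⁻¹ := (one_le_inv₀ (by positivity)).2 (by nlinarith)
  have e2 : 1 ≤ (‖y‖ * (2 - ‖y‖))⁻¹ := (one_le_inv₀ (by positivity)).2 (by nlinarith)
  gcongr
  nlinarith [sq_nonneg α]

end

end

end SdSGluing

namespace SdSGluing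

noncomputable section

/-! # Estimates for the remainder terms -/

section

variable {Λ : ℝ} {O : Set E4} {g : E4 → Bil} {y : E4} {K : Set E4}

/-- The coercivity constant of the de Sitter metric is (3/Λ) τ⁻²; the smallness hypothesis lets half
of it absorb k. Raising an index therefore gains the factor τ². -/
theorem norm_le_of_metric (hΛ : 0 < Λ) (hy : y ∈ intM) {C D : ℝ} {X : E4} (hD : 0 ≤ D)
    (hk : ∀ w, |(g y - deSitter Λ y) X w| ≤ C * ‖X‖ * ‖w‖) (hC : 0 ≤ C)
    (hCτ : C * tau y ^ 2 ≤ 3 / (2 * Λ)) (h : ∀ w, |g y X w| ≤ D * ‖w‖) :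
    ‖X‖ ≤ 2 * Λ / 3 * tau y ^ 2 * D := by
  have ht := tau_pos hy
  obtain ⟨w, hw, hX⟩ := exists_deSitter_ge hΛ hy X
  have e : deSitter Λ y X w = g y X w - (g y - deSitter Λ y) X w := by
    simp
  have h1 : deSitter Λ y X w ≤ D * ‖X‖ + C * ‖X‖ * ‖X‖ := by
    rw [e]
    have := le_abs_self (g y X w)
    have := neg_abs_le ((g y - deSitter Λ y) X w)
    have := h w
    have := hk w
    have := mul_le_mul_of_nonneg_left hw hD
    have := mul_le_mul_of_nonneg_left hw (mul_nonneg hC (norm_nonneg X))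
    linarith
  rcases (norm_nonneg X).eq_or_lt with h0 | h0
  · rw [← h0]; positivity
  have h2 : 3 / Λ * (tau y ^ 2)⁻¹ * ‖X‖ ≤ D + C * ‖X‖ := by
    refine le_of_mul_le_mul_right ?_ h0
    nlinarith
  have h3 : 3 / Λ * ‖X‖ ≤ D * tau y ^ 2 + C * tau y ^ 2 * ‖X‖ := by
    have := mul_le_mul_of_nonneg_right h2 (sq_nonneg (tau y))
    calc 3 / Λ * ‖X‖ = 3 / Λ * (tau y ^ 2)⁻¹ * ‖X‖ * tau y ^ 2 := by field_simp
      _ ≤ _ := this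
      _ = _ := by ring
  have h4 := mul_le_mul_of_nonneg_right hCτ h0.le
  have h5 : 3 / (2 * Λ) * ‖X‖ ≤ D * tau y ^ 2 := by
    have : 3 / Λ * ‖X‖ = 3 / (2 * Λ) * ‖X‖ + 3 / (2 * Λ) * ‖X‖ := by field_simp; ring
    linarith
  have h6 : ‖X‖ = 2 * Λ / 3 * (3 / (2 * Λ) * ‖X‖) := by field_simp
  rw [h6]
  calc _ ≤ 2 * Λ / 3 * (D * tau y ^ 2) := by gcongr
    _ = _ := by ring

/-- The pointwise bounds for `k = g - g_{dS}` which enter the estimates. -/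
def KBound (Λ : ℝ) (g : E4 → Bil) (K : Set E4) (C : ℝ) : Prop :=
  0 ≤ C ∧ ∀ y ∈ K ∩ intM, ‖g y - deSitter Λ y‖ ≤ C * tau y ^ (1 / 2 : ℝ) ∧
    ∀ v, ‖fderiv ℝ (fun z => g z - deSitter Λ z) y v‖ ≤ C * tau y ^ (-(1 / 2) : ℝ) * ‖v‖

variable {C : ℝ}

theorem KBound.apply (h : KBound Λ g K C) (hy : y ∈ K ∩ intM) (u v : E4) :
    |(g y - deSitter Λ y) u v| ≤ C * tau y ^ (1 / 2 : ℝ) * ‖u‖ * ‖v‖ := by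
  refine ((g y - deSitter Λ y).le_opNorm₂ u v).trans ?_
  have := (h.2 y hy).1
  gcongr

theorem KBound.koszul (h : KBound Λ g K C) (hy : y ∈ K ∩ intM) (u v w : E4) :
    |koszul (fderiv ℝ (fun z => g z - deSitter Λ z) y) u v w|
      ≤ 3 / 2 * C * tau y ^ (-(1 / 2) : ℝ) * ‖u‖ * ‖v‖ * ‖w‖ := by
  have hD : ∀ u v w, |fderiv ℝ (fun z => g z - deSitter Λ z) y u v w|
      ≤ C * tau y ^ (-(1 / 2) : ℝ) * ‖u‖ * ‖v‖ * ‖w‖ := by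
    intro u v w
    refine ((fderiv ℝ (fun z => g z - deSitter Λ z) y u).le_opNorm₂ v w).trans ?_
    have := (h.2 y hy).2 u
    gcongr
  have h1 := abs_le.1 (hD u v w)
  have h2 := abs_le.1 (hD v u w)
  have h3 := abs_le.1 (hD w u v)
  rw [SdSGluing.koszul, abs_le]
  constructor <;> nlinarith

theorem KBound.psi (h : KBound Λ g K C) (hy : y ∈ K ∩ intM) (hτ : tau y < 1 / 2) (u w : E4) :
    |Psi (fun z => g z - deSitter Λ z) y u w|
      ≤ 30 * C * tau y ^ (-(1 / 2) : ℝ) * ‖u‖ * ‖w‖ := by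
  have ht := tau_pos hy.2
  have h1 := h.koszul hy u (Nf y) w
  have h2 := h.apply hy (fderiv ℝ Nf y u - phi y • u) w
  have h3 := norm_fderiv_Nf_le hy.2 hτ u
  have h4 := norm_Nf_le hy.2
  have h5 : |phi y| ≤ (tau y)⁻¹ := by
    rw [phi, abs_div, abs_neg, abs_of_pos (sT_pos hy.2), abs_of_pos ht, div_eq_mul_inv]
    exact mul_le_of_le_one_left (inv_nonneg.2 ht.le) (sT_le_one y)
  have h6 : ‖fderiv ℝ Nf y u - phi y • u‖ ≤ 11 * (tau y)⁻¹ * ‖u‖ := by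
    refine (norm_sub_le _ _).trans ?_
    rw [norm_smul, Real.norm_eq_abs]
    have e1 := mul_le_mul_of_nonneg_right h5 (norm_nonneg u)
    have e2 : 2 ≤ (tau y)⁻¹ := by rw [le_inv_comm₀ (by norm_num) ht]; linarith
    have e3 := mul_le_mul_of_nonneg_right e2 (norm_nonneg u)
    linarith
  have hr : tau y ^ (1 / 2 : ℝ) * (tau y)⁻¹ = tau y ^ (-(1 / 2) : ℝ) := by
    rw [← Real.rpow_neg_one, ← Real.rpow_add ht]; norm_num
  have hC := h.1
  have hp : 0 ≤ tau y ^ (-(1 / 2) : ℝ) := Real.rpow_nonneg ht.le _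
  have h7 : C * tau y ^ (1 / 2 : ℝ) * ‖fderiv ℝ Nf y u - phi y • u‖ * ‖w‖
      ≤ 11 * C * tau y ^ (-(1 / 2) : ℝ) * ‖u‖ * ‖w‖ := by
    have : C * tau y ^ (1 / 2 : ℝ) * (11 * (tau y)⁻¹ * ‖u‖) * ‖w‖
        = 11 * C * tau y ^ (-(1 / 2) : ℝ) * ‖u‖ * ‖w‖ := by rw [← hr]; ring
    rw [← this]
    gcongr
  have h8 : 3 / 2 * C * tau y ^ (-(1 / 2) : ℝ) * ‖u‖ * ‖Nf y‖ * ‖w‖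
      ≤ 3 / 2 * C * tau y ^ (-(1 / 2) : ℝ) * ‖u‖ * 1 * ‖w‖ := by gcongr
  rw [Psi]
  refine (abs_add_le _ _).trans ?_
  have : 0 ≤ C * tau y ^ (-(1 / 2) : ℝ) * ‖u‖ * ‖w‖ := by positivity
  linarith

theorem eventually_small (K : Set E4) (hΛ : 0 < Λ) (hC : 0 ≤ C) : ∀ᶠ x in shellF K,
    x.2 ∈ K ∩ intM ∧ tau x.2 < 1 / 2 ∧ C * tau x.2 ^ (1 / 2 : ℝ) * tau x.2 ^ 2 ≤ 3 / (2 * Λ) := by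
  have hr : 0 < min (1 / 2) (3 / (2 * Λ) / (C + 1)) := by positivity
  filter_upwards [shellF_basic K hr] with x hx
  have ht := tau_pos hx.1.2
  have h1 := hx.2.2.2.2.trans_le (min_le_left _ _)
  refine ⟨hx.1, h1, ?_⟩
  have h2 := hx.2.2.2.2.trans_le (min_le_right _ _)
  rw [lt_div_iff₀ (by positivity)] at h2
  have h3 : tau x.2 ^ (1 / 2 : ℝ) ≤ 1 := Real.rpow_le_one ht.le (by linarith) (by norm_num)
  calc C * tau x.2 ^ (1 / 2 : ℝ) * tau x.2 ^ 2 ≤ C * 1 * tau x.2 := by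
        gcongr; nlinarith
    _ ≤ _ := by nlinarith

theorem rpow_three_halves {t : ℝ} (ht : 0 < t) : t ^ 2 * t ^ (-(1 / 2) : ℝ) = t ^ (3 / 2 : ℝ) := by
  rw [← Real.rpow_natCast, ← Real.rpow_add ht]; norm_num

theorem KBound.ordB (h : KBound Λ g K C) :
    OrdB K (1 / 2) fun x u v => (g x.2 - deSitter Λ x.2) u v := by
  refine ⟨C, ?_⟩
  filter_upwards [shellF_basic K one_pos] with x hx u v using h.apply hx.1 u v

theorem KBound.ordB_psi (h : KBound Λ g K C) :
    OrdB K (-(1 / 2)) fun x u v => Psi (fun z => g z - deSitter Λ z) x.2 u v := by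
  refine ⟨30 * C, ?_⟩
  filter_upwards [shellF_basic K one_half_pos] with x hx u v using h.psi hx.1 hx.2.2.2.2 u v

/-- Ψ is of order τ^{-1/2}, and raising the index by `norm_le_of_metric` gains τ². The same count
gives `KBound.ordB_dGam`, where the factor 1/τ in `GamB` compensates for the missing derivative of
k. -/
theorem KBound.ordL_Sp (h : KBound Λ g K C) (hΛ : 0 < Λ) (hE : IsEinstein Λ O g) (hO : IsOpen O)
    (hKO : K ⊆ O ∩ M) : OrdL K (3 / 2) fun x u => Sp g x.2 u := by
  refine ⟨2 * Λ / 3 * (30 * C), ?_⟩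
  filter_upwards [eventually_small K hΛ h.1] with x hx u
  have ht := tau_pos hx.1.2
  have hp : 0 ≤ tau x.2 ^ (-(1 / 2) : ℝ) := Real.rpow_nonneg ht.le _
  have hC := h.1
  have := norm_le_of_metric (g := g) hΛ hx.1.2 (X := Sp g x.2 u)
    (D := 30 * C * tau x.2 ^ (-(1 / 2) : ℝ) * ‖u‖) (by positivity)
    (fun w => h.apply hx.1 _ w) (by positivity) hx.2.2 (fun w => by
      rw [metric_Sp hE hO ⟨(hKO hx.1.1).1, hx.1.2⟩]
      exact h.psi hx.1 hx.2.1 u w)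
  refine this.trans (le_of_eq ?_)
  rw [← rpow_three_halves ht]
  ring

theorem KBound.ordB_dGam (h : KBound Λ g K C) (hΛ : 0 < Λ) (hE : IsEinstein Λ O g) (hO : IsOpen O)
    (hKO : K ⊆ O ∩ M) : OrdB K (3 / 2) fun x u v => dGam g x.2 u v := by
  refine ⟨2 * Λ / 3 * (202 * C), ?_⟩
  filter_upwards [eventually_small K hΛ h.1] with x hx u v
  have ht := tau_pos hx.1.2
  have hp : 0 ≤ tau x.2 ^ (-(1 / 2) : ℝ) := Real.rpow_nonneg ht.le _
  have hC := h.1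
  have := norm_le_of_metric (g := g) hΛ hx.1.2 (X := dGam g x.2 u v)
    (D := 202 * C * tau x.2 ^ (-(1 / 2) : ℝ) * ‖u‖ * ‖v‖) (by positivity)
    (fun w => h.apply hx.1 _ w) (by positivity) hx.2.2 (fun w => by
      rw [metric_dGam hE hO ⟨(hKO hx.1.1).1, hx.1.2⟩]
      have h1 := h.koszul hx.1 u v w
      have h2 := h.apply hx.1 (GamB x.2 u v) w
      have h3 := norm_GamB_le hx.1.2 hx.2.1 u v
      have hr : tau x.2 ^ (1 / 2 : ℝ) * (tau x.2)⁻¹ = tau x.2 ^ (-(1 / 2) : ℝ) := by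
        rw [← Real.rpow_neg_one, ← Real.rpow_add ht]; norm_num
      have h4 : C * tau x.2 ^ (1 / 2 : ℝ) * ‖GamB x.2 u v‖ * ‖w‖
          ≤ 200 * C * tau x.2 ^ (-(1 / 2) : ℝ) * ‖u‖ * ‖v‖ * ‖w‖ := by
        have : C * tau x.2 ^ (1 / 2 : ℝ) * (200 * (tau x.2)⁻¹ * ‖u‖ * ‖v‖) * ‖w‖
            = 200 * C * tau x.2 ^ (-(1 / 2) : ℝ) * ‖u‖ * ‖v‖ * ‖w‖ := by rw [← hr]; ring
        rw [← this]
        gcongr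
      refine (abs_sub _ _).trans ?_
      have : 0 ≤ C * tau x.2 ^ (-(1 / 2) : ℝ) * ‖u‖ * ‖v‖ * ‖w‖ := by positivity
      linarith)
  refine this.trans (le_of_eq ?_)
  rw [← rpow_three_halves ht]
  ring

theorem OrdB.trV {a : ℝ} (hΛ : 0 < Λ) {B : ℝ × E4 → E4 → E4 → ℝ} (hB : OrdB K a B) :
    Ord K (2 + a) fun x => SdSGluing.trV Λ x.2 (B x) := by
  obtain ⟨C, hC⟩ := hB
  refine Asymptotics.IsBigO.of_bound (4 * Λ * C) ?_
  filter_upwards [hC, shellF_basic K one_half_pos] with x hx hx'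
  have ht := tau_pos hx'.1.2
  rw [Real.norm_of_nonneg (Real.rpow_nonneg ht.le _), Real.rpow_add ht, Real.rpow_two]
  refine (abs_trV_le hΛ hx'.1.2 hx'.2.2.2.2 hx).trans (le_of_eq ?_)
  ring

theorem OrdL.bil {a b c : ℝ} {B : ℝ × E4 → E4 → E4 → ℝ} (hB : OrdB K a B) {A : ℝ × E4 → E4 → E4}
    (hA : OrdL K b A) (hc : a + b = c) : OrdB K c fun x u v => B x (A x u) v := by
  obtain ⟨C, hC⟩ := hB
  obtain ⟨D, hD⟩ := hA
  refine ⟨|C| * D, ?_⟩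
  filter_upwards [hC, hD, shellF_basic K one_pos] with x h1 h2 hx u v
  have ht := tau_pos hx.1.2
  have hp : 0 ≤ tau x.2 ^ a := Real.rpow_nonneg ht.le _
  rw [← hc, Real.rpow_add ht]
  calc ‖B x (A x u) v‖ ≤ C * tau x.2 ^ a * ‖A x u‖ * ‖v‖ := h1 _ _
    _ ≤ |C| * tau x.2 ^ a * ‖A x u‖ * ‖v‖ := by gcongr; exact le_abs_self C
    _ ≤ |C| * tau x.2 ^ a * (D * tau x.2 ^ b * ‖u‖) * ‖v‖ := by gcongr; exact h2 u
    _ = _ := by ring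

theorem ord_trG {a b c d : ℝ} {G : ℝ × E4 → E4 →L[ℝ] E4 →L[ℝ] E4} (hG : OrdB K a fun x u v => G x u v)
    {A : ℝ × E4 → E4 →L[ℝ] E4} (hA : OrdL K b fun x u => A x u) {u : ℝ × E4 → E4} (hu : Ord K c u)
    (hd : a + b + c = d) :
    Ord K d (fun x => trG (G x) (A x (u x))) ∧ Ord K d fun x => trE ((G x (u x)).comp (A x)) := by
  subst hd
  obtain ⟨C, hC⟩ := hG
  obtain ⟨D, hD⟩ := hA
  have key : Ord K (a + b + c) fun x => (tau x.2 ^ a * tau x.2 ^ b) * ‖u x‖ :=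
    (((Asymptotics.isBigO_refl _ _).trans_eventuallyEq (rpow_add_eventually K a b)).mul
      hu.norm_left).trans_eventuallyEq (rpow_add_eventually K (a + b) c)
  constructor
  · refine Asymptotics.IsBigO.trans (Asymptotics.IsBigO.of_bound (4 * (|C| * D)) ?_) key
    filter_upwards [hC, hD, shellF_basic K one_pos] with x h1 h2 hx
    have ht := tau_pos hx.1.2
    have hp : 0 ≤ tau x.2 ^ a := Real.rpow_nonneg ht.le _
    have hq : 0 ≤ tau x.2 ^ b := Real.rpow_nonneg ht.le _
    rw [norm_mul, norm_norm, Real.norm_of_nonneg (mul_nonneg hp hq)]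
    refine (abs_trE_le (D := |C| * tau x.2 ^ a * (D * tau x.2 ^ b * ‖u x‖)) fun v => ?_).trans
      (le_of_eq (by ring))
    change ‖G x v (A x (u x))‖ ≤ _
    calc _ ≤ C * tau x.2 ^ a * ‖v‖ * ‖A x (u x)‖ := h1 _ _
      _ ≤ |C| * tau x.2 ^ a * ‖v‖ * ‖A x (u x)‖ := by gcongr; exact le_abs_self C
      _ ≤ |C| * tau x.2 ^ a * ‖v‖ * (D * tau x.2 ^ b * ‖u x‖) := by gcongr; exact h2 _
      _ = _ := by ring
  · refine Asymptotics.IsBigO.trans (Asymptotics.IsBigO.of_bound (4 * (|C| * D)) ?_) key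
    filter_upwards [hC, hD, shellF_basic K one_pos] with x h1 h2 hx
    have ht := tau_pos hx.1.2
    have hp : 0 ≤ tau x.2 ^ a := Real.rpow_nonneg ht.le _
    have hq : 0 ≤ tau x.2 ^ b := Real.rpow_nonneg ht.le _
    rw [norm_mul, norm_norm, Real.norm_of_nonneg (mul_nonneg hp hq)]
    refine (abs_trE_le (D := |C| * tau x.2 ^ a * D * tau x.2 ^ b * ‖u x‖) fun v => ?_).trans
      (le_of_eq (by ring))
    change ‖G x (u x) (A x v)‖ ≤ _
    calc _ ≤ C * tau x.2 ^ a * ‖u x‖ * ‖A x v‖ := h1 _ _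
      _ ≤ |C| * tau x.2 ^ a * ‖u x‖ * ‖A x v‖ := by gcongr; exact le_abs_self C
      _ ≤ |C| * tau x.2 ^ a * ‖u x‖ * (D * tau x.2 ^ b * ‖v‖) := by gcongr; exact h2 _
      _ = _ := by ring

theorem ord_dC {a : ℝ} {P : ℝ × E4 → E4} (hP : Ord K a P)
    (q : E4) : Ord K a fun x => dC (P x) x.2 (Tf q x.2) := by
  have : OrdL K 0 fun (x : ℝ × E4) u => dC u x.2 (Tf q x.2) := by
    refine ⟨‖q‖ + ‖q‖, ?_⟩
    filter_upwards [shellF_basic K one_pos] with x hx u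
    rw [dC_Tf _ _ hx.1.2, Real.rpow_zero, mul_one]
    refine (norm_sub_le _ _).trans ?_
    rw [norm_mul, Real.norm_eq_abs, Real.norm_eq_abs, Real.norm_eq_abs]
    have h1 := abs_real_inner_le_norm u q
    have h2 := mul_le_mul (abs_cq_le u hx.1.2) (abs_cq_le q hx.1.2) (abs_nonneg _) (norm_nonneg u)
    linarith
  exact this.apply hP (zero_add a)

end

end

end SdSGluing

/-! ### Order of the quadratic error -/

namespace SdSGluing

noncomputable section

section

variable {Λ : ℝ} {O : Set E4} {g : E4 → Bil} {K : Set E4} {C : ℝ}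

/-- S and `dGam` are of order τ^{3/2} and Y is of order τ², which gives 3/2 + 3/2 + 2 = 5 for the
connection terms. The leading metric terms are τ² from `wf`, times a weight of order τ, times k(S·,
·) = O(τ²). -/
theorem KBound.ord_quadErr (h : KBound Λ g K C) (hΛ : 0 < Λ) (hE : IsEinstein Λ O g) (hO : IsOpen O)
    (hKO : K ⊆ O ∩ M) (q : E4) {P Q : ℝ × E4 → E4} {ζ η a b : ℝ × E4 → ℝ}
    (hP : Ord K 2 P) (hQ : Ord K 2 Q) (hζ : Ord K 2 ζ) (hη : Ord K 2 η) (ha : Ord K 1 a)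
    (hb : Ord K 2 b) :
    Ord K 5 fun x => quadErr Λ g x.2 q (P x) (Q x) (ζ x) (η x) (a x) (b x) := by
  have hS := h.ordL_Sp hΛ hE hO hKO
  have hkS := OrdL.bil h.ordB hS (show (1 / 2 : ℝ) + 3 / 2 = 2 by norm_num)
  have hG := h.ordB_dGam hΛ hE hO hKO
  have hY := (hζ.smul (ord_Tf q) (add_zero 2)).add (hη.smul ord_Nf (add_zero 2))
  have hGS := ord_trG hG hS hY (show (3 / 2 : ℝ) + 3 / 2 + 2 = 5 by norm_num)
  have e1 := hkS.apply (ord_Tf q) ord_Nf (show (2 : ℝ) + 0 + 0 = 2 by norm_num)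
  have e2 := hkS.apply (ord_Tf q) (ord_Tf_comp hP) (show (2 : ℝ) + 0 + 2 = 4 by norm_num)
  have e3 := hkS.apply ord_Nf ord_Nf (show (2 : ℝ) + 0 + 0 = 2 by norm_num)
  have e4 := hkS.apply ord_Nf (ord_Tf_comp hQ) (show (2 : ℝ) + 0 + 2 = 4 by norm_num)
  have e5 := hkS.apply ord_Nf (ord_Tf q) (show (2 : ℝ) + 0 + 0 = 2 by norm_num)
  have e6 := OrdB.trV hΛ hkS
  have f1 := ha.add (ord_phi.mul hζ (show (-1 : ℝ) + 2 = 1 by norm_num))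
  have f2 := hb.add (hζ.mul (ord_cq q) (add_zero 2))
  have f3 := hζ.mul ord_phi (show (2 : ℝ) + -1 = 1 by norm_num)
  have s1 := f1.neg.mul e1 (show (1 : ℝ) + 2 = 3 by norm_num)
  have s3 := (f2.mul e3 (show (2 : ℝ) + 2 = 4 by norm_num)).mono (show (3 : ℝ) ≤ 4 by norm_num)
  have s5 := f3.mul e5 (show (1 : ℝ) + 2 = 3 by norm_num)
  have t := (ord_wf (K := K) Λ).mul ((((s1.add (e2.mono (by norm_num))).sub s3).add
    (e4.mono (by norm_num))).add s5) (show (2 : ℝ) + 3 = 5 by norm_num)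
  have t2 := ((ord_dC hP q).mul e6 (show (2 : ℝ) + (2 + 2) = 6 by norm_num)).mono
    (show (5 : ℝ) ≤ 6 by norm_num)
  exact ((t.neg.add t2).sub hGS.1).add hGS.2

end

/-! ### Orders of the rescaled test field and of the remainder -/

section

variable {N : ℕ} {Λ : ℝ} {p : Fin N → E4} {m : Fin N → ℝ} {β v : ℝ → ℝ} {q : E4} {O : Set E4}
  {g : E4 → Bil} {K : Set E4} {C : ℝ}

/-- The function `t ↦ v (t / δ)`. -/
def resc (v : ℝ → ℝ) (δ : ℝ) (t : ℝ) : ℝ := v (t / δ)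

theorem deriv_resc (v : ℝ → ℝ) (δ : ℝ) : deriv (resc v δ) = fun t => δ⁻¹ * deriv v (t / δ) := by
  funext t
  have h := deriv_comp_mul_left δ⁻¹ v t
  simp only [smul_eq_mul] at h
  have e : resc v δ = fun t => v (δ⁻¹ * t) := by
    funext s; rw [resc, div_eq_inv_mul]
  rw [e, h, div_eq_inv_mul]

theorem deriv_deriv_resc (v : ℝ → ℝ) (δ : ℝ) :
    deriv (deriv (resc v δ)) = fun t => δ⁻¹ * (δ⁻¹ * deriv (deriv v) (t / δ)) := by
  rw [deriv_resc]
  have : (fun t => δ⁻¹ * deriv v (t / δ)) = fun t => δ⁻¹ * resc (deriv v) δ t := rfl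
  funext t
  rw [this, deriv_const_mul_field, deriv_resc]

theorem contDiff_resc (hv : ContDiff ℝ ∞ v) (δ : ℝ) : ContDiff ℝ ∞ (resc v δ) :=
  hv.comp (contDiff_id.div_const δ)

/-- On the shell τ/δ stays in [1, 2], so the rescaled profile is bounded uniformly in δ, and every
derivative of it costs 1/δ, comparable to 1/τ. -/
theorem ord_comp_div {f : ℝ → ℝ} (hf : Continuous f) : Ord K 0 fun x => f (tau x.2 / x.1) := by
  obtain ⟨C, hC⟩ := (isCompact_Icc (a := (1 : ℝ)) (b := 2)).exists_bound_of_continuousOn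
    hf.continuousOn
  exact Ord.of_le (C := C) one_pos fun x hx h0 h1 h2 _ => by
    rw [Real.rpow_zero, mul_one]
    exact hC _ ⟨(one_le_div h0).2 h1, (div_le_iff₀ h0).2 h2⟩

theorem ord_inv_fst : Ord K (-1) fun x => x.1⁻¹ :=
  Ord.of_le (C := 2) one_pos fun x hx h0 h1 h2 _ => by
    have ht := tau_pos hx.2
    rw [Real.rpow_neg_one, Real.norm_of_nonneg (inv_nonneg.2 h0.le), ← div_eq_mul_inv,
      le_div_iff₀ ht, inv_mul_le_iff₀ h0]
    linarith

theorem ord_resc (hv : ContDiff ℝ ∞ v) : Ord K 0 fun x => resc v x.1 (tau x.2) :=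
  ord_comp_div hv.continuous

theorem ord_deriv_resc (hv : ContDiff ℝ ∞ v) : Ord K (-1) fun x => deriv (resc v x.1) (tau x.2) := by
  simp only [deriv_resc]
  exact ord_inv_fst.mul (ord_comp_div (contDiff_deriv hv).continuous) (add_zero _)

theorem ord_deriv_deriv_resc (hv : ContDiff ℝ ∞ v) :
    Ord K (-2) fun x => deriv (deriv (resc v x.1)) (tau x.2) := by
  simp only [deriv_deriv_resc]
  exact ord_inv_fst.mul (ord_inv_fst.mul
    (ord_comp_div (contDiff_deriv (contDiff_deriv hv)).continuous) (add_zero _))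
    (show (-1 : ℝ) + -1 = -2 by norm_num)

theorem ord_zr (hv : ContDiff ℝ ∞ v) : Ord K 2 fun x => zr (resc v x.1) (tau x.2) := by
  have := Ord.cmul (1 / 2) ((ord_tau_pow (K := K) 3).mul (ord_deriv_resc hv)
    (show ((3 : ℕ) : ℝ) + -1 = 2 by norm_num))
  exact this.congr_left fun x => by rw [zr]; ring

theorem ord_ur (hv : ContDiff ℝ ∞ v) : Ord K 3 fun x => ur (resc v x.1) (tau x.2) :=
  (ord_tau_pow 3).mul (ord_resc hv) (by norm_num)

theorem ord_wzr (hv : ContDiff ℝ ∞ v) : Ord K 4 fun x => wzr Λ (resc v x.1) (tau x.2) :=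
  Ord.cmul _ ((ord_tau_pow 5).mul (ord_deriv_resc hv) (by norm_num))

theorem ord_br (hv : ContDiff ℝ ∞ v) : Ord K 3 fun x => br Λ (resc v x.1) (tau x.2) := by
  have h1 := (((ord_tau_pow (K := K) 6).mul (ord_deriv_resc hv) rfl).mono
    (show (3 : ℝ) ≤ _ by norm_num)).neg
  have h2 := (ord_tau_pow (K := K) 4).mul (ord_deriv_resc hv)
    (show ((4 : ℕ) : ℝ) + -1 = 3 by norm_num)
  have h3 := (ord_tau_pow (K := K) 5).mul (ord_deriv_deriv_resc hv)
    (show ((5 : ℕ) : ℝ) + -2 = 3 by norm_num)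
  have h4 : Ord K 0 fun x => 1 - tau x.2 ^ 2 :=
    (Ord.const 1).sub ((ord_tau_pow 2).mono (by norm_num))
  exact Ord.cmul _ (h1.add (h4.mul (h2.add h3) (zero_add 3)))

theorem ord_sT_sq : Ord K 0 fun x => sT x.2 ^ 2 := by
  simpa only [pow_two] using ord_sT.mul ord_sT (add_zero 0)

theorem ord_zN (hv : ContDiff ℝ ∞ v) : Ord K 1 fun x => zN (resc v x.1) x.2 := by
  have h1 := (ord_tau.neg.mul (ord_zr (K := K) hv) rfl).mono (show (1 : ℝ) ≤ _ by norm_num)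
  have h2 := (Ord.cmul 3 (ord_tau_pow (K := K) 2)).mul (ord_deriv_resc hv)
    (show ((2 : ℕ) : ℝ) + -1 = 1 by norm_num)
  have h3 := (ord_tau_pow (K := K) 3).mul (ord_deriv_deriv_resc hv)
    (show ((3 : ℕ) : ℝ) + -2 = 1 by norm_num)
  have h4 := (Ord.cmul (1 / 2) (h2.add h3)).congr_left
    (f₂ := fun x => (3 * tau x.2 ^ 2 * deriv (resc v x.1) (tau x.2)
    + tau x.2 ^ 3 * deriv (deriv (resc v x.1)) (tau x.2)) / 2) fun x => by ring
  exact h1.add (ord_sT_sq.mul h4 (zero_add 1))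

theorem ord_wzN (hv : ContDiff ℝ ∞ v) : Ord K 3 fun x => wzN Λ (resc v x.1) x.2 := by
  have h1 := (ord_tau.neg.mul (ord_wzr (K := K) (Λ := Λ) hv) rfl).mono
    (show (3 : ℝ) ≤ _ by norm_num)
  have h2 := (Ord.cmul 5 (ord_tau_pow (K := K) 4)).mul (ord_deriv_resc hv)
    (show ((4 : ℕ) : ℝ) + -1 = 3 by norm_num)
  have h3 := (ord_tau_pow (K := K) 5).mul (ord_deriv_deriv_resc hv)
    (show ((5 : ℕ) : ℝ) + -2 = 3 by norm_num)
  exact h1.add (ord_sT_sq.mul (Ord.cmul (Λ / 6) (h2.add h3)) (zero_add 3))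

theorem ord_chi (hβ : ContDiff ℝ ∞ β) : Ord K 0 fun x => chi p β x.2 :=
  (Ord.const 1).sub (Ord.sum fun i => ord_comp_cq hβ.continuous (p i))

theorem ord_Pf (hβ : ContDiff ℝ ∞ β) : Ord K 0 fun x => Pf p β x.2 :=
  Ord.sum fun i => (ord_comp_cq (contDiff_deriv hβ).continuous (p i)).smul (Ord.const (p i))
    (add_zero 0)

theorem ord_zetaF (hβ : ContDiff ℝ ∞ β) (hv : ContDiff ℝ ∞ v) :
    Ord K 2 fun x => zetaF p β (resc v x.1) x.2 :=
  (ord_sT.mul (ord_zr hv) (zero_add 2)).mul (ord_chi hβ) (add_zero 2)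

theorem ord_etaF (hβ : ContDiff ℝ ∞ β) (hv : ContDiff ℝ ∞ v) :
    Ord K 3 fun x => etaF p β (resc v x.1) q x.2 :=
  (ord_ur hv).mul ((ord_cq q).mul (ord_chi hβ) (add_zero 0)) (add_zero 3)

theorem ord_etaN (hβ : ContDiff ℝ ∞ β) (hv : ContDiff ℝ ∞ v) :
    Ord K 2 fun x => etaN p β (resc v x.1) q x.2 := by
  have h1 := (Ord.cmul 3 (ord_tau_pow (K := K) 2)).mul (ord_resc hv)
    (show ((2 : ℕ) : ℝ) + 0 = 2 by norm_num)
  have h2 := (ord_tau_pow (K := K) 3).mul (ord_deriv_resc hv)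
    (show ((3 : ℕ) : ℝ) + -1 = 2 by norm_num)
  exact ((h1.add h2).mul ord_sT (add_zero 2)).mul ((ord_cq q).mul (ord_chi hβ) (add_zero 0))
    (add_zero 2)

theorem ord_Qf (hβ : ContDiff ℝ ∞ β) (hv : ContDiff ℝ ∞ v) :
    Ord K 3 fun x => Qf p β (resc v x.1) q x.2 :=
  (ord_ur hv).smul (((ord_chi hβ).smul (Ord.const q) (add_zero 0)).sub
    ((ord_cq q).smul (ord_Pf hβ) (add_zero 0))) (add_zero 3)

/-- The asymptotics of the frame components of `k` in the annulus around `p_i`. -/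
def AnnAsymp (Λ : ℝ) (p : Fin N → E4) (m : Fin N → ℝ) (β : ℝ → ℝ) (q : E4) (g : E4 → Bil)
    (K : Set E4) (i : Fin N) : Prop :=
  ((fun x : ℝ × E4 => deriv β (cq (p i) x.2) * ((g x.2 - deSitter Λ x.2) (Nf x.2) (Nf x.2)
      - lead Λ p m i x.2)) =o[shellF K] fun x => tau x.2 ^ (1 : ℝ)) ∧
  ((fun x : ℝ × E4 => deriv β (cq (p i) x.2) * ((g x.2 - deSitter Λ x.2) (Tf q x.2) (Tf (p i) x.2)
      - lead Λ p m i x.2 * theta (p i) q x.2)) =o[shellF K] fun x => tau x.2 ^ (1 : ℝ)) ∧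
  ((fun x : ℝ × E4 => deriv β (cq (p i) x.2) * trV Λ x.2 fun u v => (g x.2 - deSitter Λ x.2) u v)
      =o[shellF K] fun x => tau x.2 ^ (3 : ℝ))

/-- The components minus their leading parts are o(τ) against weights O(τ³), and the trace is o(τ³)
against O(τ). The mixed components need no asymptotics, since k = O(τ^{1/2}) meets a weight O(τ⁴).
-/
theorem KBound.annErr_isLittleO (h : KBound Λ g K C)
    (hβ : ContDiff ℝ ∞ β) (hv : ContDiff ℝ ∞ v) {i : Fin N} (hA : AnnAsymp Λ p m β q g K i) :
    (fun x : ℝ × E4 => annErr Λ p m β (resc v x.1) q g i x.2)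
      =o[shellF K] fun x => tau x.2 ^ (4 : ℝ) := by
  obtain ⟨h1, h2, h3⟩ := hA
  have w := ord_sT.mul (ord_wzr (K := K) (Λ := Λ) hv) (zero_add 4)
  have c1 : Ord K 3 fun x => 1 / 2 * wzN Λ (resc v x.1) x.2
      + 3 * phi x.2 * (sT x.2 * wzr Λ (resc v x.1) (tau x.2)) :=
    (Ord.cmul _ (ord_wzN hv)).add ((Ord.cmul 3 ord_phi).mul w (by norm_num))
  have c2 := (ord_br (K := K) (Λ := Λ) hv).mul (ord_theta (p i) q) (add_zero 3)
  have c3 : Ord K 1 fun x => theta (p i) q x.2 * (1 / 2 * zN (resc v x.1) x.2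
      + 2 * phi x.2 * (sT x.2 * zr (resc v x.1) (tau x.2))) :=
    (ord_theta (p i) q).mul ((Ord.cmul _ (ord_zN hv)).add ((Ord.cmul 2 ord_phi).mul
      (ord_sT.mul (ord_zr hv) (zero_add 2)) (by norm_num))) (zero_add 1)
  have b1 := ord_comp_cq (K := K) (contDiff_deriv hβ).continuous (p i)
  have b2 := ord_comp_cq (K := K) (contDiff_deriv (contDiff_deriv hβ)).continuous (p i)
  have k1 := fun q => h.ordB.apply ord_Nf (ord_Tf q) (show (1 / 2 : ℝ) + 0 + 0 = 1 / 2 by norm_num)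
  have r1 := ((((Ord.cmul (1 / 2) (k1 (p i))).mul w rfl).mul
    ((b2.mul (ord_theta (p i) q) (add_zero 0)).sub ((Ord.cmul 2 (ord_cq q)).mul b1 (add_zero 0)))
    rfl).isLittleO (show (4 : ℝ) < _ by norm_num))
  have r2 := ((((Ord.cmul (1 / 2) (k1 q)).mul w rfl).mul
    ((b2.mul (ord_theta (p i) (p i)) (add_zero 0)).sub
      ((Ord.cmul 2 (ord_cq (p i))).mul b1 (add_zero 0))) rfl).isLittleO
      (show (4 : ℝ) < _ by norm_num))
  have s1 := isLittleO_mul_ord h2 c1 (show (1 : ℝ) + 3 = 4 by norm_num)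
  have s2 := isLittleO_mul_ord h1 c2 (show (1 : ℝ) + 3 = 4 by norm_num)
  have s3 := isLittleO_mul_ord h3 c3 (show (3 : ℝ) + 1 = 4 by norm_num)
  refine ((((s1.sub s2).sub s3).add r1).sub r2).congr_left fun x => ?_
  rw [annErr]
  ring

/-- Each nonannular term has order at least 9/2. In particular Ψ(N, T_Q) is harmless because Q is
O(τ³), one power better than P. -/
theorem KBound.testErr_isLittleO (h : KBound Λ g K C) (hΛ : 0 < Λ) (hE : IsEinstein Λ O g)
    (hO : IsOpen O) (hKO : K ⊆ O ∩ M) (hβ : ContDiff ℝ ∞ β) (hv : ContDiff ℝ ∞ v)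
    (hA : ∀ i, AnnAsymp Λ p m β q g K i) :
    (fun x : ℝ × E4 => testErr Λ p m β (resc v x.1) q g x.2)
      =o[shellF K] fun x => tau x.2 ^ (4 : ℝ) := by
  have k1 := h.ordB.apply ord_Nf (ord_Tf q) (show (1 / 2 : ℝ) + 0 + 0 = 1 / 2 by norm_num)
  have k2 := h.ordB.apply ord_Nf ord_Nf (show (1 / 2 : ℝ) + 0 + 0 = 1 / 2 by norm_num)
  have hζ := ord_zetaF (K := K) (p := p) hβ hv
  have hη := ord_etaF (K := K) (p := p) (q := q) hβ hv
  have t2 := ord_tau_pow (K := K) 2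
  have r1 := (((Ord.cmul (2 * Λ / 3) t2).mul hζ rfl).mul k1 rfl).isLittleO
    (show (4 : ℝ) < _ by norm_num)
  have r2 := (((Ord.cmul (Λ / 2) t2).mul hη rfl).mul k2 rfl).isLittleO
    (show (4 : ℝ) < _ by norm_num)
  have r3 := ((ord_wf (K := K) Λ).mul (h.ordB_psi.apply ord_Nf
    (ord_Tf_comp (ord_Qf (K := K) (p := p) (q := q) hβ hv)) rfl) rfl).isLittleO
    (show (4 : ℝ) < _ by norm_num)
  have hP : Ord K 2 fun x => (-(sT x.2 * zr (resc v x.1) (tau x.2))) • Pf p β x.2 :=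
    (ord_sT.mul (ord_zr hv) (zero_add 2)).neg.smul (ord_Pf hβ) (add_zero 2)
  have r4 := (h.ord_quadErr hΛ hE hO hKO q hP ((ord_Qf (p := p) (q := q) hβ hv).mono (by norm_num))
    hζ (hη.mono (by norm_num)) ((ord_zN hv).mul (ord_chi (p := p) hβ) (add_zero 1))
    (ord_etaN (p := p) (q := q) hβ hv)).isLittleO (show (4 : ℝ) < _ by norm_num)
  have r5 := Asymptotics.IsLittleO.fun_sum (s := Finset.univ) fun i _ =>
    h.annErr_isLittleO hβ hv (hA i)
  exact (((r1.add r2).add r3).add r4).add r5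

end

end

end SdSGluing

namespace SdSGluing

noncomputable section

/-! # The Schwarzschild-de Sitter metrics near the conformal boundary -/

section

variable {Λ : ℝ} {p y : E4}

/-- The sine of the angle to `p`. -/
def sinB (p y : E4) : ℝ := √(1 - cq p y ^ 2)

/-- The region on which the static coordinates of `p` are used. -/
def staticRegion (p : E4) : Set E4 := {y | y ∈ intM ∧ 0 < sT y + cq p y ∧ 0 < sT y ^ 2 - cq p y ^ 2}

theorem continuousAt_cq (p : E4) (hy : y ∈ intM) : ContinuousAt (cq p) y :=
  (hasFDerivAt_cq p hy).continuousAt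

theorem continuousAt_sT (hy : y ∈ intM) : ContinuousAt sT y :=
  (hasFDerivAt_sT hy).continuousAt

theorem staticRegion_mem_nhds (hy : y ∈ staticRegion p) : staticRegion p ∈ 𝓝 y := by
  obtain ⟨h0, h1, h2⟩ := hy
  have hc := continuousAt_cq p h0
  have hs := continuousAt_sT h0
  filter_upwards [isOpen_intM.mem_nhds h0, (hs.add hc).eventually (lt_mem_nhds h1),
    ((hs.pow 2).sub (hc.pow 2)).eventually (lt_mem_nhds h2)] with z z0 z1 z2
  exact ⟨z0, z1, z2⟩

theorem one_sub_cq_sq (hy : y ∈ intM) :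
    1 - cq p y ^ 2 = tau y ^ 2 + (sT y ^ 2 - cq p y ^ 2) := by rw [sT_sq hy]; ring

theorem sinB_pos (hy : y ∈ staticRegion p) : 0 < sinB p y :=
  Real.sqrt_pos.2 (by
    rw [one_sub_cq_sq hy.1]
    have := pow_pos (tau_pos hy.1) 2
    linarith [hy.2.2])

theorem sinB_sq (hy : y ∈ staticRegion p) : sinB p y ^ 2 = 1 - cq p y ^ 2 :=
  Real.sq_sqrt (Real.sqrt_pos.1 (sinB_pos hy)).le

theorem norm_psi (hy : y ∈ intM) : ‖psi y‖ = 1 := by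
  have := hy.1
  simp only [psi, norm_smul, norm_inv, norm_norm]; field_simp

theorem norm_psi_sub (hp : ‖p‖ = 1) (hy : y ∈ intM) : ‖psi y - cq p y • p‖ = sinB p y := by
  have : ‖psi y - cq p y • p‖ ^ 2 = 1 - cq p y ^ 2 := by
    rw [norm_sub_sq_real, norm_smul, hp, norm_psi hy, inner_smul_right, real_inner_comm, mul_one,
      Real.norm_eq_abs, sq_abs]
    change 1 ^ 2 - 2 * (cq p y * cq p y) + cq p y ^ 2 = _
    ring
  rw [sinB, ← this, Real.sqrt_sq (norm_nonneg _)]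

theorem norm_halfX (hp : ‖p‖ = 1) (hy : y ∈ staticRegion p) :
    ‖halfX p y‖ = sinB p y / (sT y + cq p y) := by
  change ‖(sT y + cq p y)⁻¹ • (psi y - cq p y • p)‖ = _
  rw [norm_smul, norm_psi_sub hp hy.1, norm_inv, Real.norm_of_nonneg hy.2.1.le, div_eq_inv_mul]

theorem halfTau_eq (p y : E4) : halfTau p y = tau y / (sT y + cq p y) := rfl

theorem rCoord_eq (hp : ‖p‖ = 1) (hy : y ∈ staticRegion p) :
    rCoord Λ p y = √(3 / Λ) * (sinB p y * (tau y)⁻¹) := by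
  have := hy.2.1
  have := tau_pos hy.1
  rw [rCoord, norm_halfX hp hy, halfTau_eq]
  field_simp

theorem tCoord_eq (hp : ‖p‖ = 1) (hy : y ∈ staticRegion p) :
    tCoord Λ p y = -(1 / 2) * √(3 / Λ) *
      (Real.log (sT y - cq p y) - Real.log (sT y + cq p y)) := by
  have h1 := hy.2.1
  have h3 : 0 < sT y - cq p y := by
    have : 0 < (sT y + cq p y) * (sT y - cq p y) := by nlinarith [hy.2.2]
    exact (mul_pos_iff_of_pos_left h1).1 this
  rw [tCoord, norm_halfX hp hy, halfTau_eq, ← Real.log_div h3.ne' h1.ne']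
  congr 2
  rw [div_pow, div_pow, sinB_sq hy, one_sub_cq_sq hy.1]
  field_simp
  ring

theorem omegaCoord_eq (hp : ‖p‖ = 1) (hy : y ∈ staticRegion p) :
    omegaCoord p y = (sinB p y)⁻¹ • (psi y - cq p y • p) := by
  have h1 := hy.2.1
  have h2 := sinB_pos hy
  rw [omegaCoord, norm_halfX hp hy]
  change _ • (sT y + cq p y)⁻¹ • _ = _
  rw [smul_smul]
  congr 1
  field_simp

theorem hasFDerivAt_sinB (hy : y ∈ staticRegion p) :
    HasFDerivAt (sinB p) (-(cq p y / sinB p y) • dC p y) y := by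
  have h := (((hasFDerivAt_cq p hy.1).pow 2).const_sub 1).sqrt (Real.sqrt_pos.1 (sinB_pos hy)).ne'
  refine h.congr_fderiv ?_
  ext v
  simp [sinB]
  ring

theorem fderiv_rCoord (hp : ‖p‖ = 1) (hy : y ∈ staticRegion p) (v : E4) :
    fderiv ℝ (rCoord Λ p) y v = -√(3 / Λ) * (cq p y / (sinB p y * tau y) * dC p y v
      + sinB p y / tau y ^ 2 * dTau y v) := by
  have ht := tau_pos hy.1
  have hB := sinB_pos hy
  have he : rCoord Λ p =ᶠ[𝓝 y] fun z => √(3 / Λ) * (sinB p z * (tau z)⁻¹) := by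
    filter_upwards [staticRegion_mem_nhds hy] with z hz using rCoord_eq hp hz
  have h := ((hasFDerivAt_sinB hy).fun_mul
    (hasFDerivAt_inv_comp (hasFDerivAt_tau hy.1) ht.ne')).const_mul (√(3 / Λ))
  rw [he.fderiv_eq, h.fderiv]
  simp
  field_simp
  ring

theorem fderiv_tCoord (hp : ‖p‖ = 1) (hy : y ∈ staticRegion p) (v : E4) :
    fderiv ℝ (tCoord Λ p) y v = √(3 / Λ) * ((sT y * dC p y v + cq p y * tau y / sT y * dTau y v)
      / (sT y ^ 2 - cq p y ^ 2)) := by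
  have ht := tau_pos hy.1
  have hs := sT_pos hy.1
  have h1 := hy.2.1
  have h2 := hy.2.2
  have h3 : 0 < sT y - cq p y := by
    have : 0 < (sT y + cq p y) * (sT y - cq p y) := by nlinarith
    exact (mul_pos_iff_of_pos_left h1).1 this
  have he : tCoord Λ p =ᶠ[𝓝 y] fun z => -(1 / 2) * √(3 / Λ) *
      (Real.log (sT z - cq p z) - Real.log (sT z + cq p z)) := by
    filter_upwards [staticRegion_mem_nhds hy] with z hz using tCoord_eq hp hz
  have hS := hasFDerivAt_sT hy.1
  have hC := hasFDerivAt_cq p hy.1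
  have h := (((hS.fun_sub hC).log h3.ne').fun_sub ((hS.fun_add hC).log h1.ne')).const_mul
    (-(1 / 2) * √(3 / Λ))
  rw [he.fderiv_eq, h.fderiv]
  have hW : sT y ^ 2 - cq p y ^ 2 = (sT y - cq p y) * (sT y + cq p y) := by ring
  rw [hW]
  simp
  field_simp
  ring

theorem inner_fderiv_psi (p : E4) (hy : y ∈ intM) (v : E4) : ⟪p, fderiv ℝ psi y v⟫_ℝ = dC p y v := by
  rw [fderiv_psi hy, dC_apply, inner_sub_right, inner_smul_right, inner_smul_right]
  ring

theorem psi_inner_fderiv_psi (hy : y ∈ intM) (v : E4) : ⟪psi y, fderiv ℝ psi y v⟫_ℝ = 0 := by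
  have := hy.1
  rw [inner_fderiv_psi _ hy, dC_apply, psi, inner_smul_left, inner_smul_left,
    real_inner_self_eq_norm_sq]
  simp
  field_simp
  ring

theorem differentiableAt_psi (hy : y ∈ intM) : DifferentiableAt ℝ psi y :=
  (hasFDerivAt_inv_comp (hasFDerivAt_norm' (ne_zero_of_intM hy)) hy.1.ne').differentiableAt.smul
    differentiableAt_id

theorem fderiv_omegaCoord (hp : ‖p‖ = 1) (hy : y ∈ staticRegion p) (v : E4) :
    fderiv ℝ (omegaCoord p) y v = (sinB p y)⁻¹ • (fderiv ℝ psi y v - dC p y v • p)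
      + (cq p y / sinB p y ^ 3 * dC p y v) • (psi y - cq p y • p) := by
  have hB := sinB_pos hy
  have he : omegaCoord p =ᶠ[𝓝 y] fun z => (sinB p z)⁻¹ • (psi z - cq p z • p) := by
    filter_upwards [staticRegion_mem_nhds hy] with z hz using omegaCoord_eq hp hz
  have h := (hasFDerivAt_inv_comp (hasFDerivAt_sinB hy) hB.ne').fun_smul
    ((differentiableAt_psi hy.1).hasFDerivAt.fun_sub ((hasFDerivAt_cq p hy.1).smul_const p))
  rw [he.fderiv_eq, h.fderiv]
  simp only [_root_.add_apply, _root_.smul_apply, _root_.sub_apply,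
    ContinuousLinearMap.smulRight_apply, smul_eq_mul]
  congr 2
  field_simp

theorem inner_fderiv_omegaCoord (hp : ‖p‖ = 1) (hy : y ∈ staticRegion p) (v w : E4) :
    ⟪fderiv ℝ (omegaCoord p) y v, fderiv ℝ (omegaCoord p) y w⟫_ℝ = (sinB p y ^ 2)⁻¹ *
      (⟪fderiv ℝ psi y v, fderiv ℝ psi y w⟫_ℝ - dC p y v * dC p y w / sinB p y ^ 2) := by
  have hB := sinB_pos hy
  have hBs := sinB_sq hy
  have e1 := inner_fderiv_psi p hy.1 v
  have e2 := inner_fderiv_psi p hy.1 w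
  have e3 := psi_inner_fderiv_psi hy.1 v
  have e4 := psi_inner_fderiv_psi hy.1 w
  have e5 : ⟪p, psi y⟫_ℝ = cq p y := rfl
  have e6 : ⟪psi y, p⟫_ℝ = cq p y := real_inner_comm _ _
  have e7 : ⟪psi y, psi y⟫_ℝ = 1 := by rw [real_inner_self_eq_norm_sq, norm_psi hy.1, one_pow]
  have e8 : ⟪p, p⟫_ℝ = 1 := by rw [real_inner_self_eq_norm_sq, hp, one_pow]
  have e9 : ⟪fderiv ℝ psi y v, p⟫_ℝ = dC p y v := by rw [real_inner_comm, e1]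
  have e10 : ⟪fderiv ℝ psi y v, psi y⟫_ℝ = 0 := by rw [real_inner_comm, e3]
  rw [fderiv_omegaCoord hp hy, fderiv_omegaCoord hp hy]
  simp only [inner_add_left, inner_add_right, inner_sub_left, inner_sub_right, inner_smul_left,
    inner_smul_right, e2, e4, e5, e6, e7, e8, e9, e10, conj_trivial]
  field_simp
  linear_combination (-(cq p y ^ 2 + sinB p y ^ 2) * dC p y v * dC p y w) * hBs

/-- The mass-free function F is Λr²/3 - 1 = (sT² - c²)/τ² with c = ⟨p, ψ⟩, so this is g_{p,0} = g_dS
in static coordinates. It isolates the mass term in `sds_sub_deSitter`. -/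
theorem deSitter_eq_static (hΛ : 0 < Λ) (hp : ‖p‖ = 1) (hy : y ∈ staticRegion p) (v w : E4) :
    deSitter Λ y v w =
      -((sT y ^ 2 - cq p y ^ 2) / tau y ^ 2)⁻¹ *
        (fderiv ℝ (rCoord Λ p) y v * fderiv ℝ (rCoord Λ p) y w)
      + (sT y ^ 2 - cq p y ^ 2) / tau y ^ 2 *
        (fderiv ℝ (tCoord Λ p) y v * fderiv ℝ (tCoord Λ p) y w)
      + rCoord Λ p y ^ 2 *
        ⟪fderiv ℝ (omegaCoord p) y v, fderiv ℝ (omegaCoord p) y w⟫_ℝ := by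
  have hB := sinB_pos hy
  have hBs := sinB_sq hy
  have ht := tau_pos hy.1
  have hs := sT_pos hy.1
  have hss := sT_sq hy.1
  have hW := hy.2.2
  have hL : √(3 / Λ) ^ 2 = 3 / Λ := Real.sq_sqrt (by positivity)
  rw [inner_fderiv_omegaCoord hp hy, rCoord_eq hp hy, fderiv_rCoord hp hy, fderiv_rCoord hp hy,
    fderiv_tCoord hp hy, fderiv_tCoord hp hy]
  simp only [deSitter, sq, pullInner, _root_.smul_apply, _root_.add_apply,
    ContinuousLinearMap.smulRight_apply, ContinuousLinearMap.bilinearComp_apply,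
    innerSL_apply_apply, (hasFDerivAt_tau hy.1).fderiv, smul_eq_mul, ← hss]
  generalize ⟪fderiv ℝ psi y v, fderiv ℝ psi y w⟫_ℝ = I
  generalize dC p y v = a
  generalize dC p y w = a'
  generalize dTau y v = b
  generalize dTau y w = b'
  generalize √(3 / Λ) = ℓ at *
  rw [← hL]
  generalize sinB p y = B at *
  generalize sT y = s at *
  generalize cq p y = c at *
  generalize tau y = t at *
  have hc : c ^ 2 = 1 - B ^ 2 := by linarith
  have hW' : s ^ 2 - c ^ 2 = B ^ 2 - t ^ 2 := by rw [hss, hBs]; ring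
  rw [hW'] at hW ⊢
  -- `k1` compares the coefficients of the squared differential of c, and `k2` those of dτ². The
  -- mixed terms from dr² and dt² cancel.
  have k1 : c ^ 2 / ((B ^ 2 - t ^ 2) * B ^ 2) + 1 / (t ^ 2 * B ^ 2)
      = s ^ 2 / ((B ^ 2 - t ^ 2) * t ^ 2) := by
    field_simp
    rw [hc, hss]; ring
  have k2 : B ^ 2 / ((B ^ 2 - t ^ 2) * t ^ 2) = c ^ 2 / ((B ^ 2 - t ^ 2) * s ^ 2)
      + 1 / (t ^ 2 * s ^ 2) := by
    field_simp
    rw [hc, hss]; ring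
  trans ℓ ^ 2 * (I / t ^ 2 - b * b' * (1 / (t ^ 2 * s ^ 2)))
  · field_simp
    ring
  trans ℓ ^ 2 * (I / t ^ 2 + a * a' * (s ^ 2 / ((B ^ 2 - t ^ 2) * t ^ 2)
      - (c ^ 2 / ((B ^ 2 - t ^ 2) * B ^ 2) + 1 / (t ^ 2 * B ^ 2)))
      + b * b' * (c ^ 2 / ((B ^ 2 - t ^ 2) * s ^ 2) - B ^ 2 / ((B ^ 2 - t ^ 2) * t ^ 2)))
  · rw [k1, k2]; ring
  · field_simp
    ring

/-- The correction `2 𝔪 / r` as a function of `τ` and of the sine of the angle. -/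
def massTerm (Λ m t B : ℝ) : ℝ := 2 * m * t / (√(3 / Λ) * B)

theorem sdsF_rCoord (hΛ : 0 < Λ) (hp : ‖p‖ = 1) (hy : y ∈ staticRegion p) (m : ℝ) :
    sdsF Λ m (rCoord Λ p y) =
      (sT y ^ 2 - cq p y ^ 2) / tau y ^ 2 + massTerm Λ m (tau y) (sinB p y) := by
  have hB := sinB_pos hy
  have hBs := sinB_sq hy
  have ht := tau_pos hy.1
  have hss := sT_sq hy.1
  have hL : √(3 / Λ) ^ 2 = 3 / Λ := Real.sq_sqrt (by positivity)
  have hL0 : 0 < √(3 / Λ) := Real.sqrt_pos.2 (by positivity)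
  rw [sdsF, rCoord_eq hp hy, massTerm, mul_pow, hL, mul_pow, hBs, hss]
  congr 1
  · field_simp
    ring
  · field_simp

theorem sds_sub_deSitter (hΛ : 0 < Λ) (hp : ‖p‖ = 1) (hy : y ∈ staticRegion p) (m : ℝ) (v w : E4) :
    (sds Λ p m y - deSitter Λ y) v w =
      (((sT y ^ 2 - cq p y ^ 2) / tau y ^ 2)⁻¹ - ((sT y ^ 2 - cq p y ^ 2) / tau y ^ 2
        + massTerm Λ m (tau y) (sinB p y))⁻¹) *
        (fderiv ℝ (rCoord Λ p) y v * fderiv ℝ (rCoord Λ p) y w)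
      + massTerm Λ m (tau y) (sinB p y) *
        (fderiv ℝ (tCoord Λ p) y v * fderiv ℝ (tCoord Λ p) y w) := by
  rw [_root_.sub_apply, _root_.sub_apply, deSitter_eq_static hΛ hp hy]
  simp only [sds, sq, pullInner, _root_.smul_apply, _root_.add_apply,
    ContinuousLinearMap.smulRight_apply, ContinuousLinearMap.bilinearComp_apply,
    innerSL_apply_apply, smul_eq_mul, sdsF_rCoord hΛ hp hy]
  ring

theorem fderiv_rCoord_Nf (hp : ‖p‖ = 1) (hy : y ∈ staticRegion p) :
    fderiv ℝ (rCoord Λ p) y (Nf y) = -√(3 / Λ) * (sinB p y * sT y / tau y ^ 2) := by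
  rw [fderiv_rCoord hp hy, dC_Nf p hy.1, dTau_Nf hy.1]; ring

theorem fderiv_tCoord_Nf (hp : ‖p‖ = 1) (hy : y ∈ staticRegion p) :
    fderiv ℝ (tCoord Λ p) y (Nf y) =
      √(3 / Λ) * (cq p y * tau y / (sT y ^ 2 - cq p y ^ 2)) := by
  have := sT_pos hy.1
  rw [fderiv_tCoord hp hy, dC_Nf p hy.1, dTau_Nf hy.1]
  field_simp
  ring

theorem fderiv_rCoord_Tf (hp : ‖p‖ = 1) (hy : y ∈ staticRegion p) (q : E4) :
    fderiv ℝ (rCoord Λ p) y (Tf q y) =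
      -√(3 / Λ) * (cq p y * theta p q y / (sinB p y * tau y)) := by
  rw [fderiv_rCoord hp hy, dC_Tf p q hy.1, dTau_Tf q hy.1, theta]; ring

theorem fderiv_tCoord_Tf (hp : ‖p‖ = 1) (hy : y ∈ staticRegion p) (q : E4) :
    fderiv ℝ (tCoord Λ p) y (Tf q y) =
      √(3 / Λ) * (sT y * theta p q y / (sT y ^ 2 - cq p y ^ 2)) := by
  rw [fderiv_tCoord hp hy, dC_Tf p q hy.1, dTau_Tf q hy.1, theta]; ring

theorem theta_self (hp : ‖p‖ = 1) (hy : y ∈ staticRegion p) : theta p p y = sinB p y ^ 2 := by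
  rw [theta, real_inner_self_eq_norm_sq, hp, sinB_sq hy]; ring

/-- The de Sitter trace of α ⊗ α is the squared length of α; dτ and d⟨p, ψ⟩ are orthogonal, of
opposite causal type. -/
theorem trV_covector_sq (a b : ℝ) (hp : ‖p‖ = 1) (hy : y ∈ intM) :
    trV Λ y (fun u v => (a * dC p y u + b * dTau y u) * (a * dC p y v + b * dTau y v)) =
      Λ / 3 * tau y ^ 2 * (a ^ 2 * (1 - cq p y ^ 2) - b ^ 2 * sT y ^ 2) := by
  have h0 := hy.1
  have hd : dC p y y = 0 := by
    rw [dC_apply, real_inner_self_eq_norm_sq]; field_simp; ring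
  have ht : dTau y y = -‖y‖ := by
    rw [dTau_apply, real_inner_self_eq_norm_sq]; field_simp
  have e1 : ∀ i, p i * p i = p i ^ 2 := fun i => (pow_two _).symm
  have s1 : ∑ i, p i ^ 2 = 1 := by
    have := EuclideanSpace.real_norm_sq_eq p
    rw [hp] at this; linarith
  have s2 : ∑ i, y i ^ 2 = ‖y‖ ^ 2 := (EuclideanSpace.real_norm_sq_eq y).symm
  have s3 : ∑ i, p i * y i = ⟪p, y⟫_ℝ := by simp [PiLp.inner_apply, mul_comm]
  have hc : ⟪p, y⟫_ℝ = cq p y * ‖y‖ := by rw [cq_eq]; field_simp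
  have hev : ∀ i, ⟪p, ev i⟫_ℝ = p i := fun i => by simp [ev, EuclideanSpace.inner_single_right]
  have hev' : ∀ i, ⟪y, ev i⟫_ℝ = y i := fun i => by simp [ev, EuclideanSpace.inner_single_right]
  rw [trV]
  simp only [hd, ht]
  have e : ∀ i, (a * dC p y (ev i) + b * dTau y (ev i)) * (a * dC p y (ev i) + b * dTau y (ev i))
      = (a / ‖y‖) ^ 2 * p i ^ 2 - 2 * (a / ‖y‖) * (a * cq p y / ‖y‖ ^ 2 + b / ‖y‖) * (p i * y i)
        + (a * cq p y / ‖y‖ ^ 2 + b / ‖y‖) ^ 2 * y i ^ 2 := fun i => by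
    rw [dC_apply, dTau_apply, hev, hev', hc]
    field_simp
    ring
  simp only [e, Finset.sum_add_distrib, Finset.sum_sub_distrib, ← Finset.mul_sum, s1, s2, s3]
  rw [hc, sT_sq' hy]
  field_simp
  ring

end

end

end SdSGluing

/-! ### Frame components of the Schwarzschild-de Sitter perturbation -/

namespace SdSGluing

noncomputable section

section

variable {Λ : ℝ} {p y : E4}

theorem trV_lin (Λ : ℝ) (y : E4) (P Q : ℝ) (f h : E4 → E4 → ℝ) :
    trV Λ y (fun u v => P * f u v + Q * h u v) = P * trV Λ y f + Q * trV Λ y h := by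
  simp only [trV, Finset.sum_add_distrib, ← Finset.mul_sum]
  ring

/-- The mass term is a small perturbation of `F`, uniformly away from `± p`. -/
theorem massTerm_bounds (hΛ : 0 < Λ) (m : ℝ) {b : ℝ} (hb : 0 < b) :
    ∃ H r : ℝ, 0 ≤ H ∧ 0 < r ∧ r ≤ 1 ∧ ∀ t B : ℝ, 0 < t → t < r → b ≤ B →
      |massTerm Λ m t B| ≤ H * t ∧ b ^ 2 / 2 ≤ B ^ 2 - t ^ 2 ∧
        b ^ 2 / 2 ≤ B ^ 2 - t ^ 2 + massTerm Λ m t B * t ^ 2 := by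
  have hL0 : 0 < √(3 / Λ) := Real.sqrt_pos.2 (by positivity)
  set H := 2 * |m| / (√(3 / Λ) * b) with hH
  have hH0 : 0 ≤ H := by positivity
  -- This radius makes t(1 + H) at most b²/4, which dominates t² plus the mass correction because t
  -- < 1.
  refine ⟨H, min 1 (b ^ 2 / (4 * (H + 1))), hH0, by positivity, min_le_left _ _, ?_⟩
  intro t B ht htr hbB
  have ht1 : t < 1 := htr.trans_le (min_le_left _ _)
  have ht2 : t * (4 * (H + 1)) < b ^ 2 :=
    (lt_div_iff₀ (by positivity)).1 (htr.trans_le (min_le_right _ _))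
  have hB : 0 < B := hb.trans_le hbB
  have h1 : |massTerm Λ m t B| ≤ H * t := by
    rw [massTerm, hH, abs_div, abs_mul, abs_mul, abs_of_pos ht, abs_of_pos (mul_pos hL0 hB),
      abs_of_pos (two_pos : (0 : ℝ) < 2), div_mul_eq_mul_div]
    gcongr
  have hB2 : b ^ 2 ≤ B ^ 2 := by gcongr
  have t2 : t ^ 2 ≤ t := by nlinarith
  have h3 : |massTerm Λ m t B * t ^ 2| ≤ H * t := by
    rw [abs_mul, abs_of_pos (pow_pos ht 2)]
    calc _ ≤ H * t * 1 := by gcongr; nlinarith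
      _ = _ := mul_one _
  have h4 := (abs_le.1 h3).1
  have : 0 ≤ t * H := by positivity
  refine ⟨h1, by nlinarith, by nlinarith⟩

/-- Here h = 2m/r, W = t²F₀ and G = t²F. To first order 1/F₀ - 1/F is h/F₀², close to h t⁴/B⁴; with
dr(N)² close to (3/Λ) B²/t⁴ this is the subtracted term. The dt² part is smaller by t². -/
theorem sds_sub_deSitter_Nf_Nf (hΛ : 0 < Λ) (hp : ‖p‖ = 1) (hy : y ∈ staticRegion p) (m : ℝ)
    {t B h W G : ℝ} (et : tau y = t) (eB : sinB p y = B) (eh : massTerm Λ m t B = h)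
    (eW : B ^ 2 - t ^ 2 = W) (eG : W + h * t ^ 2 = G) (hG : 0 < G) :
    (sds Λ p m y - deSitter Λ y) (Nf y) (Nf y) - 2 * m * √(3 / Λ) * t * (B ^ 3)⁻¹
      = h * (3 / Λ) * t ^ 2 * ((2 * B ^ 2 - B ^ 4 - t ^ 2 - h * W) / (W * G * B ^ 2)
        + cq p y ^ 2 / W ^ 2) := by
  have hB := sinB_pos hy
  have hBs := sinB_sq hy
  have ht := tau_pos hy.1
  have hss := sT_sq hy.1
  have hW := hy.2.2
  have hL : √(3 / Λ) ^ 2 = 3 / Λ := Real.sq_sqrt (by positivity)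
  have hL0 : 0 < √(3 / Λ) := Real.sqrt_pos.2 (by positivity)
  rw [sds_sub_deSitter hΛ hp hy, fderiv_rCoord_Nf hp hy, fderiv_tCoord_Nf hp hy]
  have e1 : sT y ^ 2 - cq p y ^ 2 = W := by rw [← eW, ← eB, ← et, hss, hBs]; ring
  rw [e1] at hW ⊢
  rw [et] at *
  rw [eB] at *
  rw [eh]
  have e2 : 2 * m * √(3 / Λ) * t * (B ^ 3)⁻¹ = √(3 / Λ) ^ 2 * h / B ^ 2 := by
    rw [← eh, massTerm]; field_simp
  have e3 : (W / t ^ 2 + h)⁻¹ = t ^ 2 / G := by rw [← eG]; field_simp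
  rw [e2, e3]
  generalize √(3 / Λ) = ℓ at *
  rw [← hL]
  have e4 : B ^ 4 * sT y ^ 2 - W * G
      = t ^ 2 * (2 * B ^ 2 - B ^ 4 - t ^ 2 - h * W) := by
    rw [hss, ← eG, ← eW]; ring
  have e5 : (W / t ^ 2)⁻¹ - t ^ 2 / G = h * t ^ 4 / (W * G) := by
    field_simp; rw [← eG]; ring
  rw [e5]
  have e6 : t ^ 2 * ((2 * B ^ 2 - B ^ 4 - t ^ 2 - h * W) / (W * G * B ^ 2)) =
    (B ^ 4 * sT y ^ 2 - W * G) / (W * G * B ^ 2) := by rw [e4]; ring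
  trans h * ℓ ^ 2 * (t ^ 2 * ((2 * B ^ 2 - B ^ 4 - t ^ 2 - h * W) / (W * G * B ^ 2))
    + t ^ 2 * (cq p y ^ 2 / W ^ 2))
  · rw [e6]
    field_simp
    ring
  · ring

/-- The roles of the two covectors are exchanged: the subtracted term comes from h dt², and the dr²
part is smaller by t². -/
theorem sds_sub_deSitter_Tf_Tf (hΛ : 0 < Λ) (hp : ‖p‖ = 1) (hy : y ∈ staticRegion p) (m : ℝ) (q : E4)
    {t B h W G : ℝ} (et : tau y = t) (eB : sinB p y = B) (eh : massTerm Λ m t B = h)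
    (eW : B ^ 2 - t ^ 2 = W) (eG : W + h * t ^ 2 = G) (hG : 0 < G) :
    (sds Λ p m y - deSitter Λ y) (Tf q y) (Tf p y)
        - 2 * m * √(3 / Λ) * t * (B ^ 3)⁻¹ * theta p q y
      = h * (3 / Λ) * t ^ 2 * (theta p q y * (cq p y ^ 2 / (W * G)
        + (2 * B ^ 2 - B ^ 4 - t ^ 2) / (W ^ 2 * B ^ 2))) := by
  have hB := sinB_pos hy
  have hBs := sinB_sq hy
  have ht := tau_pos hy.1
  have hss := sT_sq hy.1
  have hW := hy.2.2
  have hL : √(3 / Λ) ^ 2 = 3 / Λ := Real.sq_sqrt (by positivity)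
  have hL0 : 0 < √(3 / Λ) := Real.sqrt_pos.2 (by positivity)
  rw [sds_sub_deSitter hΛ hp hy, fderiv_rCoord_Tf hp hy, fderiv_tCoord_Tf hp hy,
    fderiv_rCoord_Tf hp hy, fderiv_tCoord_Tf hp hy, theta_self hp hy]
  have e1 : sT y ^ 2 - cq p y ^ 2 = W := by rw [← eW, ← eB, ← et, hss, hBs]; ring
  rw [e1] at hW ⊢
  rw [et] at *
  rw [eB] at *
  rw [eh]
  have e2 : 2 * m * √(3 / Λ) * t * (B ^ 3)⁻¹ = √(3 / Λ) ^ 2 * h / B ^ 2 := by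
    rw [← eh, massTerm]; field_simp
  have e3 : (W / t ^ 2 + h)⁻¹ = t ^ 2 / G := by rw [← eG]; field_simp
  rw [e2, e3]
  generalize √(3 / Λ) = ℓ at *
  rw [← hL]
  have e4 : B ^ 4 * sT y ^ 2 - W ^ 2 = t ^ 2 * (2 * B ^ 2 - B ^ 4 - t ^ 2) := by
    rw [hss, ← eW]; ring
  have e5 : (W / t ^ 2)⁻¹ - t ^ 2 / G = h * t ^ 4 / (W * G) := by
    field_simp; rw [← eG]; ring
  rw [e5]
  have e6 : t ^ 2 * ((2 * B ^ 2 - B ^ 4 - t ^ 2) / (W ^ 2 * B ^ 2)) =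
    (B ^ 4 * sT y ^ 2 - W ^ 2) / (W ^ 2 * B ^ 2) := by rw [e4]; ring
  trans h * ℓ ^ 2 * theta p q y * (t ^ 2 * (cq p y ^ 2 / (W * G))
    + t ^ 2 * ((2 * B ^ 2 - B ^ 4 - t ^ 2) / (W ^ 2 * B ^ 2)))
  · rw [e6]
    field_simp
    ring
  · ring

/-- The squared lengths of dr and dt are -F₀ and 1/F₀. The trace is therefore -F₀(1/F₀ - 1/F) + h/F₀
= h²/(F₀F): the linear terms in the mass cancel. -/
theorem trV_sds_sub_deSitter (hΛ : 0 < Λ) (hp : ‖p‖ = 1) (hy : y ∈ staticRegion p) (m : ℝ)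
    {t B h W G : ℝ} (et : tau y = t) (eB : sinB p y = B) (eh : massTerm Λ m t B = h)
    (eW : B ^ 2 - t ^ 2 = W) (eG : W + h * t ^ 2 = G) (hG : 0 < G) :
    trV Λ y (fun u v => (sds Λ p m y - deSitter Λ y) u v) = h ^ 2 * t ^ 4 / (W * G) := by
  have hB := sinB_pos hy
  have hBs := sinB_sq hy
  have ht := tau_pos hy.1
  have hs := sT_pos hy.1
  have hss := sT_sq hy.1
  have hW := hy.2.2
  have hL : √(3 / Λ) ^ 2 = 3 / Λ := Real.sq_sqrt (by positivity)
  have hL' : Λ / 3 * √(3 / Λ) ^ 2 = 1 := by rw [hL]; field_simp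
  have r1 : ∀ v, fderiv ℝ (rCoord Λ p) y v = -√(3 / Λ) * (cq p y / (sinB p y * tau y)) * dC p y v
      + -√(3 / Λ) * (sinB p y / tau y ^ 2) * dTau y v := fun v => by
    rw [fderiv_rCoord hp hy]; ring
  have r2 : ∀ v, fderiv ℝ (tCoord Λ p) y v = √(3 / Λ) * (sT y / (sT y ^ 2 - cq p y ^ 2)) * dC p y v
      + √(3 / Λ) * (cq p y * tau y / (sT y * (sT y ^ 2 - cq p y ^ 2))) * dTau y v := fun v => by
    rw [fderiv_tCoord hp hy]; field_simp
  simp only [sds_sub_deSitter hΛ hp hy, r1, r2]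
  rw [trV_lin, trV_covector_sq _ _ hp hy.1, trV_covector_sq _ _ hp hy.1, ← hBs]
  have e1 : sT y ^ 2 - cq p y ^ 2 = W := by rw [← eW, ← eB, ← et, hss, hBs]; ring
  rw [e1] at hW ⊢
  rw [et] at *
  rw [eB] at *
  rw [eh]
  have e3 : (W / t ^ 2 + h)⁻¹ = t ^ 2 / G := by rw [← eG]; field_simp
  rw [e3]
  have e5 : (W / t ^ 2)⁻¹ - t ^ 2 / G = h * t ^ 4 / (W * G) := by
    field_simp; rw [← eG]; ring
  rw [e5]
  generalize √(3 / Λ) = ℓ at *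
  generalize sT y = s at *
  generalize cq p y = c at *
  have hc : c ^ 2 = 1 - B ^ 2 := by linarith
  have f1 : Λ / 3 * t ^ 2 * ((-ℓ * (c / (B * t))) ^ 2 * B ^ 2 - (-ℓ * (B / t ^ 2)) ^ 2 * s ^ 2)
      = -(W / t ^ 2) := by
    trans (Λ / 3 * ℓ ^ 2) * ((c ^ 2 * t ^ 2 - B ^ 2 * s ^ 2) / t ^ 2)
    · field_simp
    · rw [hL', hc, hss, ← eW, one_mul, ← neg_div]; congr 1; ring
  have f2 : Λ / 3 * t ^ 2 * ((ℓ * (s / W)) ^ 2 * B ^ 2 - (ℓ * (c * t / (s * W))) ^ 2 * s ^ 2)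
      = t ^ 2 / W := by
    trans (Λ / 3 * ℓ ^ 2) * (t ^ 2 * (s ^ 2 * B ^ 2 - c ^ 2 * t ^ 2) / W ^ 2)
    · field_simp
    · have : s ^ 2 * B ^ 2 - c ^ 2 * t ^ 2 = W := by rw [hc, hss, ← eW]; ring
      rw [hL', this, one_mul]; field_simp
  rw [f1, f2]
  field_simp
  rw [← eG]
  ring

theorem abs_div_le_of_le {a b A D : ℝ} (hD : 0 < D) (ha : |a| ≤ A) (hb : D ≤ b) : |a / b| ≤ A / D := by
  rw [abs_div, abs_of_pos (hD.trans_le hb)]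
  exact div_le_div₀ ((abs_nonneg a).trans ha) ha hD hb

theorem abs_mul_mul_sq_le {h t H L X E : ℝ} (ht : 0 < t) (hL : 0 ≤ L) (h1 : |h| ≤ H * t)
    (hX : |X| ≤ E) : |h * L * t ^ 2 * X| ≤ H * L * E * t ^ 3 := by
  have : |h * L * t ^ 2 * X| = |h| * L * t ^ 2 * |X| := by
    rw [abs_mul, abs_mul, abs_mul, abs_of_nonneg hL, abs_of_pos (pow_pos ht 2)]
  rw [this]
  calc _ ≤ H * t * L * t ^ 2 * E := by
        gcongr
        exact mul_nonneg (mul_nonneg ((abs_nonneg h).trans h1) hL) (sq_nonneg t)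
    _ = _ := by ring

section

variable {b d H h t B W G c : ℝ}

theorem abs_nn_coeff_le (hb : 0 < b) (hd : 0 < d) (hBb : b ^ 2 ≤ B ^ 2) (hB1 : B ^ 2 ≤ 1)
    (hc : c ^ 2 ≤ 1) (ht : t ^ 2 ≤ 1) (hh : |h| ≤ H) (hdW : d ≤ W) (hW1 : W ≤ 1) (hdG : d ≤ G) :
    |(2 * B ^ 2 - B ^ 4 - t ^ 2 - h * W) / (W * G * B ^ 2) + c ^ 2 / W ^ 2|
      ≤ (4 + H) / (d * d * b ^ 2) + 1 / d ^ 2 := by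
  have hW := hd.trans_le hdW
  have hG := hd.trans_le hdG
  have hhW : |h * W| ≤ H := by
    rw [abs_mul, abs_of_pos hW]; nlinarith [abs_nonneg h]
  have hhW' := abs_le.1 hhW
  have hB4 : B ^ 4 ≤ 1 := by
    have : B ^ 4 = (B ^ 2) ^ 2 := by ring
    rw [this]; exact pow_le_one₀ (sq_nonneg B) hB1
  have hB0 : 0 ≤ B ^ 4 := by positivity
  have n1 : |2 * B ^ 2 - B ^ 4 - t ^ 2 - h * W| ≤ 4 + H :=
    abs_le.2 ⟨by linarith [sq_nonneg B], by linarith [sq_nonneg t]⟩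
  have n2 : |c ^ 2| ≤ 1 := by rwa [abs_of_nonneg (sq_nonneg c)]
  have m1 : d * d * b ^ 2 ≤ W * G * B ^ 2 :=
    mul_le_mul (mul_le_mul hdW hdG hd.le hW.le) hBb (sq_nonneg b) (mul_pos hW hG).le
  have m2 : d ^ 2 ≤ W ^ 2 := pow_le_pow_left₀ hd.le hdW 2
  exact (abs_add_le _ _).trans (add_le_add (abs_div_le_of_le (by positivity) n1 m1)
    (abs_div_le_of_le (by positivity) n2 m2))

theorem abs_tt_coeff_le (hb : 0 < b) (hd : 0 < d) (hBb : b ^ 2 ≤ B ^ 2) (hB1 : B ^ 2 ≤ 1)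
    (hc : c ^ 2 ≤ 1) (ht : t ^ 2 ≤ 1) (hdW : d ≤ W) (hdG : d ≤ G) :
    |c ^ 2 / (W * G) + (2 * B ^ 2 - B ^ 4 - t ^ 2) / (W ^ 2 * B ^ 2)|
      ≤ 1 / (d * d) + 4 / (d ^ 2 * b ^ 2) := by
  have hW := hd.trans_le hdW
  have hG := hd.trans_le hdG
  have hB4 : B ^ 4 ≤ 1 := by
    have : B ^ 4 = (B ^ 2) ^ 2 := by ring
    rw [this]; exact pow_le_one₀ (sq_nonneg B) hB1
  have hB0 : 0 ≤ B ^ 4 := by positivity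
  have n1 : |2 * B ^ 2 - B ^ 4 - t ^ 2| ≤ 4 :=
    abs_le.2 ⟨by linarith [sq_nonneg B], by linarith [sq_nonneg t]⟩
  have n2 : |c ^ 2| ≤ 1 := by rwa [abs_of_nonneg (sq_nonneg c)]
  have m1 : d * d ≤ W * G := mul_le_mul hdW hdG hd.le hW.le
  have m2 : d ^ 2 * b ^ 2 ≤ W ^ 2 * B ^ 2 :=
    mul_le_mul (pow_le_pow_left₀ hd.le hdW 2) hBb (sq_nonneg b) (sq_nonneg W)
  exact (abs_add_le _ _).trans (add_le_add (abs_div_le_of_le (by positivity) n2 m1)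
    (abs_div_le_of_le (by positivity) n1 m2))

end

theorem abs_theta_le (hp : ‖p‖ = 1) (q : E4) (hy : y ∈ intM) : |theta p q y| ≤ 2 * ‖q‖ := by
  rw [theta]
  refine (abs_sub _ _).trans ?_
  have a1 := abs_real_inner_le_norm p q
  have a2 := abs_cq_le q hy
  have a3 := abs_cq_le p hy
  rw [hp] at a1 a3
  rw [abs_mul]
  nlinarith [abs_nonneg (cq p y), abs_nonneg (cq q y)]

/-- The asymptotics of a Schwarzschild-de Sitter metric, uniformly away from `± p`. -/
theorem exists_sds_bounds (hΛ : 0 < Λ) (hp : ‖p‖ = 1) (m : ℝ) (q : E4) {b : ℝ} (hb : 0 < b) :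
    ∃ C₁ C₂ C₃ r : ℝ, 0 < r ∧ ∀ y ∈ staticRegion p, b ≤ sinB p y → tau y < r →
      |(sds Λ p m y - deSitter Λ y) (Nf y) (Nf y)
        - 2 * m * √(3 / Λ) * tau y * (sinB p y ^ 3)⁻¹| ≤ C₁ * tau y ^ 3 ∧
      |(sds Λ p m y - deSitter Λ y) (Tf q y) (Tf p y)
        - 2 * m * √(3 / Λ) * tau y * (sinB p y ^ 3)⁻¹ * theta p q y| ≤ C₂ * tau y ^ 3 ∧
      |trV Λ y (fun u v => (sds Λ p m y - deSitter Λ y) u v)| ≤ C₃ * tau y ^ 4 := by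
  obtain ⟨H, r, hH, hr, hr1, hbd⟩ := massTerm_bounds hΛ m hb
  have hd0 : 0 < b ^ 2 / 2 := by positivity
  generalize b ^ 2 / 2 = d at hbd hd0
  have hL : 0 ≤ 3 / Λ := by positivity
  refine ⟨H * (3 / Λ) * ((4 + H) / (d * d * b ^ 2) + 1 / d ^ 2),
    H * (3 / Λ) * (2 * ‖q‖ * (1 / (d * d) + 4 / (d ^ 2 * b ^ 2))), H ^ 2 / (d * d), r, hr,
    fun y hy hbB htr => ?_⟩
  have ht := tau_pos hy.1
  have ht1 := tau_lt_one hy.1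
  obtain ⟨h1, h2, h3⟩ := hbd _ _ ht htr hbB
  have hBs := sinB_sq hy
  have hB1 : sinB p y ^ 2 ≤ 1 := by linarith [sq_nonneg (cq p y)]
  have hc2 : cq p y ^ 2 ≤ 1 := by linarith [sq_nonneg (sinB p y)]
  have hBb : b ^ 2 ≤ sinB p y ^ 2 := pow_le_pow_left₀ hb.le hbB 2
  have hG := hd0.trans_le h3
  have hW := hd0.trans_le h2
  have hW1 : sinB p y ^ 2 - tau y ^ 2 ≤ 1 := by linarith [sq_nonneg (tau y)]
  have hh : |massTerm Λ m (tau y) (sinB p y)| ≤ H := h1.trans (by nlinarith)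
  have t2 : tau y ^ 2 ≤ 1 := pow_le_one₀ ht.le ht1.le
  rw [sds_sub_deSitter_Nf_Nf hΛ hp hy m rfl rfl rfl rfl rfl hG,
    sds_sub_deSitter_Tf_Tf hΛ hp hy m q rfl rfl rfl rfl rfl hG,
    trV_sds_sub_deSitter hΛ hp hy m rfl rfl rfl rfl rfl hG]
  refine ⟨abs_mul_mul_sq_le ht hL h1 (abs_nn_coeff_le hb hd0 hBb hB1 hc2 t2 hh h2 hW1 h3),
    abs_mul_mul_sq_le ht hL h1 ?_, ?_⟩
  · rw [abs_mul]
    exact mul_le_mul (abs_theta_le hp q hy.1) (abs_tt_coeff_le hb hd0 hBb hB1 hc2 t2 h2 h3)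
      (abs_nonneg _) (by positivity)
  · rw [mul_div_right_comm, abs_mul, abs_of_pos (pow_pos ht 4)]
    refine mul_le_mul_of_nonneg_right (abs_div_le_of_le (mul_pos hd0 hd0) ?_
      (mul_le_mul h2 h3 hd0.le hW.le)) (pow_pos ht 4).le
    rw [abs_pow]
    exact pow_le_pow_left₀ (abs_nonneg _) hh 2

end

/-! ### Asymptotics of k on the annuli -/

section

variable {N : ℕ} {Λ : ℝ} {p : Fin N → E4} {m : Fin N → ℝ} {β : ℝ → ℝ} {q : E4} {g : E4 → Bil}
  {K : Set E4}

/-- Where the derivative of the cutoff vanishes the product is zero, so a bound on its support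
suffices. -/
theorem ord_deriv_mul (hβ : ContDiff ℝ ∞ β) {P : E4} {D : ℝ × E4 → ℝ} {C r : ℝ} (hr : 0 < r) (n : ℕ)
    (h : ∀ y ∈ K ∩ intM, tau y < r → deriv β (cq P y) ≠ 0 → ∀ δ, |D (δ, y)| ≤ C * tau y ^ n) :
    Ord K n fun x => deriv β (cq P x.2) * D x := by
  have h1 := (ord_comp_cq (K := K) (contDiff_deriv hβ).continuous P).mul (ord_tau_pow n) (zero_add _)
  refine Asymptotics.IsBigO.trans (Asymptotics.IsBigO.of_bound C ?_) h1
  filter_upwards [shellF_basic K hr] with x hx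
  rw [norm_mul, norm_mul, Real.norm_of_nonneg (pow_nonneg (tau_pos hx.1.2).le n)]
  by_cases h0 : deriv β (cq P x.2) = 0
  · simp [h0]
  · have := h x.2 hx.1 hx.2.2.2.2 h0 x.1
    calc _ ≤ ‖deriv β (cq P x.2)‖ * (C * tau x.2 ^ n) := by gcongr; exact this
      _ = _ := by ring

/-- For c₀ ≤ ⟨p_i, ψ⟩ ≤ c₁ the sine of the angle is at least √(1 - c₁²), and positivity of c₀ puts
the points into `staticRegion`. Then `exists_sds_bounds` applies with errors τ³ and τ⁴, one order or
more better than needed. -/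
theorem annAsymp_of_eq_sds (hΛ : 0 < Λ) (hβ : ContDiff ℝ ∞ β) {i : Fin N} (hp : ‖p i‖ = 1)
    {c₀ c₁ r : ℝ} (hc₀ : 0 < c₀) (hc₁ : c₁ < 1) (hr : 0 < r)
    (hsupp : ∀ c, deriv β c ≠ 0 → c₀ ≤ c ∧ c ≤ c₁)
    (hg : ∀ y ∈ K ∩ intM, tau y < r → c₀ ≤ cq (p i) y → cq (p i) y ≤ c₁ →
      g y = sds Λ (p i) (m i) y) :
    AnnAsymp Λ p m β q g K i := by
  by_cases hcc : c₀ ≤ c₁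
  swap
  · have h0 : ∀ c, deriv β c = 0 := fun c => by
      by_contra h
      exact hcc ((hsupp c h).1.trans (hsupp c h).2)
    refine ⟨?_, ?_, ?_⟩ <;> simp only [h0, zero_mul] <;> exact Asymptotics.isLittleO_zero _ _
  have hc1 : c₁ ^ 2 < 1 := by nlinarith
  set b := √(1 - c₁ ^ 2)
  have hb : 0 < b := Real.sqrt_pos.2 (by linarith)
  have hbs : b ^ 2 = 1 - c₁ ^ 2 := Real.sq_sqrt (by linarith)
  obtain ⟨C₁, C₂, C₃, r', hr', hbd⟩ := exists_sds_bounds hΛ hp (m i) q hb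
  have key : ∀ y ∈ K ∩ intM, tau y < min r (min r' b) → deriv β (cq (p i) y) ≠ 0 →
      g y = sds Λ (p i) (m i) y ∧ y ∈ staticRegion (p i) ∧ b ≤ sinB (p i) y ∧ tau y < r' := by
    intro y hy ht h0
    obtain ⟨s1, s2⟩ := hsupp _ h0
    have tb : tau y < b := ht.trans_le ((min_le_right _ _).trans (min_le_right _ _))
    have ht0 := tau_pos hy.2
    have hcc : cq (p i) y ^ 2 ≤ c₁ ^ 2 := by nlinarith
    refine ⟨hg y hy (ht.trans_le (min_le_left _ _)) s1 s2, ⟨hy.2, by linarith [sT_pos hy.2], ?_⟩,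
      Real.sqrt_le_sqrt (by linarith), ht.trans_le ((min_le_right _ _).trans (min_le_left _ _))⟩
    rw [sT_sq hy.2]
    nlinarith
  have hR : 0 < min r (min r' b) := by positivity
  refine ⟨Ord.isLittleO (ord_deriv_mul (C := C₁) hβ hR 3 ?_) (by norm_num),
    Ord.isLittleO (ord_deriv_mul (C := C₂) hβ hR 3 ?_) (by norm_num),
    Ord.isLittleO (ord_deriv_mul (C := C₃) hβ hR 4 ?_) (by norm_num)⟩
  · intro y hy ht h0 δ
    obtain ⟨k1, k2, k3, k4⟩ := key y hy ht h0
    have := (hbd y k2 k3 k4).1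
    rw [k1, lead]
    exact this
  · intro y hy ht h0 δ
    obtain ⟨k1, k2, k3, k4⟩ := key y hy ht h0
    have := (hbd y k2 k3 k4).2.1
    rw [k1, lead]
    exact this
  · intro y hy ht h0 δ
    obtain ⟨k1, k2, k3, k4⟩ := key y hy ht h0
    have := (hbd y k2 k3 k4).2.2
    rw [k1]
    exact this

end

end

end SdSGluing

namespace SdSGluing

noncomputable section

/-! # Cutoff functions and neighborhoods of the conformal boundary -/

/-- A smooth cutoff function, which is `0` below `1 - 2e` and `1` above `1 - e`. -/
def capCutoff (e : ℝ) (c : ℝ) : ℝ := Real.smoothTransition ((c - (1 - 2 * e)) / e)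

section

variable {e : ℝ}

theorem contDiff_capCutoff (e : ℝ) : ContDiff ℝ ∞ (capCutoff e) :=
  Real.smoothTransition.contDiff.comp ((contDiff_id.sub contDiff_const).div_const e)

theorem capCutoff_eq_zero (he : 0 < e) {c : ℝ} (hc : c ≤ 1 - 2 * e) : capCutoff e c = 0 :=
  Real.smoothTransition.zero_of_nonpos (div_nonpos_of_nonpos_of_nonneg (by linarith) he.le)

theorem capCutoff_eq_one (he : 0 < e) {c : ℝ} (hc : 1 - e ≤ c) : capCutoff e c = 1 :=
  Real.smoothTransition.one_of_one_le ((one_le_div he).2 (by linarith))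

theorem deriv_capCutoff_nonneg (he : 0 < e) (c : ℝ) : 0 ≤ deriv (capCutoff e) c :=
  Monotone.deriv_nonneg fun a b hab => Real.smoothTransition.monotone (by gcongr)

theorem deriv_capCutoff_supp (he : 0 < e) (c : ℝ) (h : deriv (capCutoff e) c ≠ 0) :
    1 - 2 * e ≤ c ∧ c ≤ 1 - e := by
  refine ⟨not_lt.1 fun hc => h ?_, not_lt.1 fun hc => h ?_⟩
  · have : capCutoff e =ᶠ[𝓝 c] fun _ => 0 := by
      filter_upwards [gt_mem_nhds hc] with x hx using capCutoff_eq_zero he hx.le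
    rw [this.deriv_eq, deriv_const]
  · have : capCutoff e =ᶠ[𝓝 c] fun _ => 1 := by
      filter_upwards [lt_mem_nhds hc] with x hx using capCutoff_eq_one he hx.le
    rw [this.deriv_eq, deriv_const]

theorem exists_deriv_capCutoff_pos (he : 0 < e) :
    ∃ c, 1 - 2 * e ≤ c ∧ c ≤ 1 - e ∧ 0 < deriv (capCutoff e) c := by
  have hd : Differentiable ℝ (capCutoff e) := (contDiff_capCutoff e).differentiable (by simp)
  obtain ⟨c, hc, h⟩ := exists_deriv_eq_slope (capCutoff e) (show 1 - 2 * e < 1 - e by linarith)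
    hd.continuous.continuousOn hd.differentiableOn
  refine ⟨c, hc.1.le, hc.2.le, ?_⟩
  rw [h, capCutoff_eq_one he le_rfl, capCutoff_eq_zero he le_rfl]
  have : 1 - e - (1 - 2 * e) = e := by ring
  rw [this]
  positivity

/-- The weight (1 - c²)^{-3/2} is singular only at c = ±1, and the derivative of the cutoff vanishes
outside [1 - 2e, 1 - e]. -/
theorem contDiff_Hc (he : 0 < e) (he' : e < 1 / 2) : ContDiff ℝ ∞ (Hc (capCutoff e)) := by
  rw [contDiff_iff_contDiffAt]
  intro c
  by_cases hc : 0 < 1 - c ^ 2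
  · have h1 : ContDiffAt ℝ ∞ (fun c : ℝ => √(1 - c ^ 2) ^ 3) c :=
      ((contDiffAt_const.sub (contDiffAt_id.pow 2)).sqrt hc.ne').pow 3
    exact (contDiff_deriv (contDiff_capCutoff e)).contDiffAt.mul
      (h1.inv (pow_pos (Real.sqrt_pos.2 hc) 3).ne')
  · have h0 : c ∉ Set.Icc (1 - 2 * e) (1 - e) := fun h => hc (by nlinarith [h.1, h.2])
    have : Hc (capCutoff e) =ᶠ[𝓝 c] fun _ => 0 := by
      filter_upwards [isClosed_Icc.isOpen_compl.mem_nhds h0] with x hx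
      have : deriv (capCutoff e) x = 0 := by
        by_contra h
        exact hx (deriv_capCutoff_supp he x h)
      rw [Hc, this, zero_mul]
    exact contDiffAt_const.congr_of_eventuallyEq this

theorem Hc_nonneg (he : 0 < e) (c : ℝ) : 0 ≤ Hc (capCutoff e) c :=
  mul_nonneg (deriv_capCutoff_nonneg he c) (inv_nonneg.2 (pow_nonneg (Real.sqrt_nonneg _) 3))

end

/-- A smooth bump function on `(1, 2)`. -/
theorem exists_bump : ∃ v : ℝ → ℝ, ContDiff ℝ ∞ v ∧ (∀ t, 0 ≤ v t) ∧ Function.support v = Set.Ioo 1 2 := by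
  obtain ⟨f, hf, hf', hr⟩ := (isOpen_Ioo (a := (1 : ℝ)) (b := 2)).exists_contDiff_support_eq (n := ⊤)
  exact ⟨f, hf', fun t => (hr ⟨t, rfl⟩).1, hf⟩

section

variable {N : ℕ} {p : Fin N → E4} {V : Fin N → Set E4}

/-- Small caps around the given points are disjoint and contained in the given balls. -/
theorem exists_cap (hp : ∀ i, p i ∈ bdryM) (hpinj : Function.Injective p)
    (hV : ∀ i, ∃ ρ > 0, V i = puncturedBall (p i) ρ) :
    ∃ e : ℝ, 0 < e ∧ e < 1 / 4 ∧
      (∀ i, ∀ ψ ∈ bdryM, 1 - 2 * e ≤ ⟪p i, ψ⟫_ℝ → ⟪p i, ψ⟫_ℝ ≤ 1 - e → ψ ∈ V i) ∧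
      ∀ i j, i ≠ j → ∀ ψ ∈ bdryM, 1 - 2 * e ≤ ⟪p i, ψ⟫_ℝ → ⟪p j, ψ⟫_ℝ < 1 - 2 * e := by
  choose ρ hρ hVρ using hV
  have hsmall : ∀ a : ℝ, 0 < a → ∀ᶠ e in 𝓝[>] (0 : ℝ), e < a := fun a ha =>
    mem_nhdsWithin_of_mem_nhds (gt_mem_nhds ha)
  have h0 : ∀ᶠ e in 𝓝[>] (0 : ℝ), 0 < e := self_mem_nhdsWithin
  -- On the unit sphere ‖ψ - p_i‖² = 2 - 2⟨p_i, ψ⟩, which is at most 4e on the cap.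
  have h1 : ∀ᶠ e in 𝓝[>] (0 : ℝ), ∀ i, e < ρ i ^ 2 / 4 :=
    Filter.eventually_all.2 fun i => hsmall _ (by have := hρ i; positivity)
  have h2 : ∀ᶠ e in 𝓝[>] (0 : ℝ), ∀ i j, i ≠ j → e < ‖p i - p j‖ ^ 2 / 16 :=
    Filter.eventually_all.2 fun i => Filter.eventually_all.2 fun j => by
      by_cases hij : i = j
      · exact Filter.Eventually.of_forall fun e h => (h hij).elim
      · have : 0 < ‖p i - p j‖ := norm_pos_iff.2 (sub_ne_zero.2 fun h => hij (hpinj h))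
        filter_upwards [hsmall (‖p i - p j‖ ^ 2 / 16) (by positivity)] with e he _ using he
  obtain ⟨e, he0, he1, he2, he3⟩ := (h0.and
    ((hsmall (1 / 4) (by norm_num)).and (h1.and h2))).exists
  have hn : ∀ i, ‖p i‖ = 1 := fun i => by simpa [bdryM] using hp i
  have hd : ∀ i, ∀ ψ ∈ bdryM, 1 - 2 * e ≤ ⟪p i, ψ⟫_ℝ → ‖ψ - p i‖ ^ 2 ≤ 4 * e := by
    intro i ψ hψ h
    have : ‖ψ‖ = 1 := by simpa [bdryM] using hψ
    rw [norm_sub_sq_real, this, hn i, real_inner_comm]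
    linarith
  refine ⟨e, he0, he1, fun i ψ hψ h h' => ?_, fun i j hij ψ hψ h => ?_⟩
  · rw [hVρ i]
    refine ⟨⟨hψ, ?_⟩, fun h0 => ?_⟩
    · rw [mem_ball_iff_norm]
      have := hd i ψ hψ h
      have := he2 i
      exact lt_of_pow_lt_pow_left₀ 2 (hρ i).le (by linarith)
    · rw [Set.mem_singleton_iff] at h0
      rw [h0, real_inner_self_eq_norm_sq, hn i] at h'
      linarith
  · by_contra! h'
    have a1 := hd i ψ hψ h
    have a2 := hd j ψ hψ h'
    have a3 := he3 i j hij
    have a4 : ‖p i - p j‖ ≤ ‖ψ - p i‖ + ‖ψ - p j‖ := by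
      have e : p i - p j = -(ψ - p i) + (ψ - p j) := by abel
      rw [e]
      exact (norm_add_le _ _).trans (by rw [norm_neg])
    have a5 := norm_nonneg (p i - p j)
    -- A common point of two caps would give ‖p_i - p_j‖² ≤ 2(4e + 4e) = 16e.
    nlinarith [sq_nonneg (‖ψ - p i‖ - ‖ψ - p j‖), norm_nonneg (ψ - p i), norm_nonneg (ψ - p j)]

theorem psi_mem_bdryM {y : E4} (hy : y ≠ 0) : psi y ∈ bdryM := by
  have := norm_pos_iff.2 hy
  simp only [bdryM, mem_sphere_zero_iff_norm, psi, norm_smul, norm_inv, norm_norm]; field_simp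

theorem dist_psi {y : E4} (hy : y ≠ 0) (hy1 : ‖y‖ ≤ 1) : dist y (psi y) = tau y := by
  have h0 := norm_pos_iff.2 hy
  have h1 : y - psi y = (1 - ‖y‖⁻¹) • y := by rw [psi]; module
  have h2 : 1 ≤ ‖y‖⁻¹ := (one_le_inv₀ h0).2 hy1
  rw [dist_eq_norm, h1, norm_smul, Real.norm_eq_abs, abs_of_nonpos (by linarith), tau]
  field_simp
  ring

/-- An open set that contains a compact part of the conformal boundary contains all points near it. -/
theorem exists_tau_of_isOpen {S W : Set E4} (hS : IsCompact S) (hW : IsOpen W) (h : S ⊆ W) :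
    ∃ r : ℝ, 0 < r ∧ ∀ y : E4, y ≠ 0 → ‖y‖ ≤ 1 → tau y < r → psi y ∈ S → y ∈ W := by
  obtain ⟨r, hr, hrW⟩ := hS.exists_thickening_subset_open hW h
  refine ⟨r, hr, fun y h0 h1 h2 h3 => hrW (Metric.mem_thickening_iff.2 ⟨_, h3, ?_⟩)⟩
  rwa [dist_psi h0 h1]

/-- The points near the conformal boundary outside of the caps. -/
def capCompl (p : Fin N → E4) (e r : ℝ) : Set E4 :=
  {y | 1 - r ≤ ‖y‖ ∧ ‖y‖ ≤ 1 ∧ ∀ i, ⟪p i, y⟫_ℝ ≤ (1 - e) * ‖y‖}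

theorem isCompact_capCompl (p : Fin N → E4) (e r : ℝ) : IsCompact (capCompl p e r) := by
  refine (isCompact_closedBall (0 : E4) 1).of_isClosed_subset ?_ fun y hy => by
    simpa using hy.2.1
  have h1 : IsClosed {y : E4 | 1 - r ≤ ‖y‖} := isClosed_le continuous_const continuous_norm
  have h2 : IsClosed {y : E4 | ‖y‖ ≤ 1} := isClosed_le continuous_norm continuous_const
  have h3 : IsClosed {y : E4 | ∀ i, ⟪p i, y⟫_ℝ ≤ (1 - e) * ‖y‖} := by
    simp only [Set.ofPred_forall]
    exact isClosed_iInter fun i => isClosed_le (continuous_const.inner continuous_id)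
      (continuous_const.mul continuous_norm)
  exact h1.inter (h2.inter h3)

theorem cq_le_of_mem_capCompl {e r : ℝ} {y : E4} (hy : y ∈ capCompl p e r) (h0 : y ≠ 0) (i : Fin N) :
    cq (p i) y ≤ 1 - e := by
  rw [cq_eq, div_le_iff₀ (norm_pos_iff.2 h0)]
  exact hy.2.2 i

/-- At r = 0 the set is a compact part of the sphere avoiding all p_i, hence inside O; compactness
extends this to a uniform layer. -/
theorem exists_capCompl_subset (hp : ∀ i, p i ∈ bdryM) {O : Set E4} (hO : IsOpen O)
    (hOp : bdryM \ Set.range p ⊆ O) {e : ℝ} (he : 0 < e) :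
    ∃ r : ℝ, 0 < r ∧ r < 1 / 2 ∧ capCompl p e r ⊆ O ∩ M := by
  have hS := isCompact_capCompl p e 0
  have hsub : capCompl p e 0 ⊆ O := fun y hy => hOp ⟨by
    simp only [bdryM, mem_sphere_zero_iff_norm]; linarith [hy.1, hy.2.1], by
    rintro ⟨i, rfl⟩
    have hn : ‖p i‖ = 1 := by simpa [bdryM] using hp i
    have := hy.2.2 i
    rw [real_inner_self_eq_norm_sq, hn] at this
    linarith⟩
  obtain ⟨r, hr, h⟩ := exists_tau_of_isOpen hS hO hsub
  refine ⟨min (r / 2) (1 / 4), by positivity, (min_le_right _ _).trans_lt (by norm_num), ?_⟩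
  intro y hy
  have hr1 := min_le_left (r / 2) (1 / 4)
  have hr2 := min_le_right (r / 2) (1 / 4)
  have h1 := hy.1
  have h0 : 0 < ‖y‖ := by linarith
  have hy0 := norm_pos_iff.1 h0
  refine ⟨h y hy0 hy.2.1 (by rw [tau]; linarith) ?_, h0, hy.2.1⟩
  have hψ : ‖psi y‖ = 1 := by simpa [bdryM] using psi_mem_bdryM hy0
  refine ⟨by rw [hψ]; norm_num, hψ.le, fun i => ?_⟩
  rw [hψ, mul_one]
  exact cq_le_of_mem_capCompl hy hy0 i

/-- The closed annulus is compact inside W, so a neighborhood of W contains a uniform layer above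
it. -/
theorem exists_eq_sds {Λ : ℝ} {O : Set E4} {g : E4 → Bil} {P : E4} {m : ℝ} {W : Set E4} {a b : ℝ}
    (hW : ∀ ψ ∈ bdryM, a ≤ ⟪P, ψ⟫_ℝ → ⟪P, ψ⟫_ℝ ≤ b → ψ ∈ W)
    (hSdS : ∀ᶠ y in 𝓝ˢ W, y ∈ O ∩ intM → g y = sds Λ P m y) :
    ∃ r : ℝ, 0 < r ∧ ∀ y ∈ O ∩ intM, tau y < r → a ≤ cq P y → cq P y ≤ b → g y = sds Λ P m y := by
  obtain ⟨T, hT, hWT, h⟩ := mem_nhdsSet_iff_exists.1 hSdS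
  have hc : Continuous fun ψ : E4 => ⟪P, ψ⟫_ℝ := continuous_const.inner continuous_id
  have hS : IsCompact (bdryM ∩ {ψ : E4 | a ≤ ⟪P, ψ⟫_ℝ ∧ ⟪P, ψ⟫_ℝ ≤ b}) :=
    (isCompact_sphere (0 : E4) 1).inter_right
      ((isClosed_le continuous_const hc).inter (isClosed_le hc continuous_const))
  obtain ⟨r, hr, h'⟩ := exists_tau_of_isOpen hS hT fun ψ hψ => hWT (hW ψ hψ.1 hψ.2.1 hψ.2.2)
  refine ⟨r, hr, fun y hy ht h1 h2 => ?_⟩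
  have hy0 := ne_zero_of_intM hy.2
  exact h (h' y hy0 hy.2.2.le ht ⟨psi_mem_bdryM hy0, h1, h2⟩) hy

end

end

end SdSGluing

namespace SdSGluing

noncomputable section

/-! # Integration of the test field -/

section

variable {N : ℕ} {Λ : ℝ} {p : Fin N → E4} {m : Fin N → ℝ} {β V v : ℝ → ℝ} {q : E4} {O : Set E4}
  {g : E4 → Bil} {y : E4} {e δ : ℝ}

theorem testX_eq_zero_of_radial (h0 : V (tau y) = 0) (h1 : deriv V (tau y) = 0)
    (h2 : deriv (deriv V) (tau y) = 0) : testX Λ p m β V q g y = 0 := by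
  simp [testX, fluxC, flux, zetaF, etaF, zr, ur, ar, br, fF, wzr, h0, h1, h2]

theorem testX_eq_zero_of_angular (h0 : chi p β y = 0) (h1 : ∀ i, deriv β (cq (p i) y) = 0) :
    testX Λ p m β V q g y = 0 := by
  simp [testX, fluxC, flux, zetaF, etaF, fF, Th, obs, Hc, h0, h1]

theorem obs_eq_zero (h1 : ∀ i, deriv β (cq (p i) y) = 0) : obs p m β q y = 0 := by
  simp [obs, Hc, h1]

/-- The region `δ ≤ τ ≤ 2 δ`. -/
def shell (δ : ℝ) : Set E4 := {y | δ ≤ tau y ∧ tau y ≤ 2 * δ}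

theorem isCompact_shell (δ : ℝ) : IsCompact (shell δ) := by
  have hc : Continuous tau := continuous_const.sub continuous_norm
  refine (isCompact_closedBall (0 : E4) (1 - δ)).of_isClosed_subset
    ((isClosed_le continuous_const hc).inter (isClosed_le hc continuous_const)) fun y hy => ?_
  have := hy.1
  rw [tau] at this
  simp; linarith

theorem mem_intM_of_mem_shell (h0 : 0 < δ) (h1 : δ < 1 / 4) (hy : y ∈ shell δ) : y ∈ intM := by
  have h2 := hy.1
  have h3 := hy.2
  rw [tau] at h2 h3
  exact ⟨by linarith, by linarith⟩

theorem resc_eq_zero (hv : Function.support v = Set.Ioo 1 2) (hδ : 0 < δ) (hy : y ∉ shell δ) :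
    resc v δ (tau y) = 0 ∧ deriv (resc v δ) (tau y) = 0 ∧
      deriv (deriv (resc v δ)) (tau y) = 0 := by
  have hz : ∀ t, t ∉ Set.Icc 1 2 → v t = 0 := fun t ht => by
    by_contra h
    have : t ∈ Function.support v := h
    rw [hv] at this
    exact ht ⟨this.1.le, this.2.le⟩
  have ht : tau y / δ ∉ Set.Icc 1 2 := fun h => hy
    ⟨by have := (le_div_iff₀ hδ).1 h.1; linarith, (div_le_iff₀ hδ).1 h.2⟩
  have e0 : v =ᶠ[𝓝 (tau y / δ)] fun _ => 0 := by
    filter_upwards [isClosed_Icc.isOpen_compl.mem_nhds ht] with t ht using hz t ht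
  have e1 : deriv v =ᶠ[𝓝 (tau y / δ)] fun _ => 0 := by
    have := e0.deriv
    simpa using this
  have e2 := e1.deriv_eq
  rw [deriv_const] at e2
  rw [deriv_deriv_resc, deriv_resc]
  simp only [e1.eq_of_nhds, e2, mul_zero, and_self, and_true]
  exact hz _ ht

/-- Inside the cap of p_i its own cutoff equals 1 and, by disjointness, every other one is 0. Hence
the test field vanishes near all the points. -/
theorem angular_eq_zero (he : 0 < e)
    (hdisj : ∀ i j, i ≠ j → ∀ ψ ∈ bdryM, 1 - 2 * e ≤ ⟪p i, ψ⟫_ℝ → ⟪p j, ψ⟫_ℝ < 1 - 2 * e)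
    (hy : y ≠ 0) {i : Fin N} (hi : 1 - e < cq (p i) y) :
    chi p (capCutoff e) y = 0 ∧ ∀ j, deriv (capCutoff e) (cq (p j) y) = 0 := by
  have hj : ∀ j, j ≠ i → cq (p j) y < 1 - 2 * e := fun j hj =>
    hdisj i j hj.symm _ (psi_mem_bdryM hy) (show 1 - 2 * e ≤ cq (p i) y by linarith)
  constructor
  · rw [chi, Finset.sum_eq_single i (fun j _ h => capCutoff_eq_zero he (hj j h).le)
      (fun h => absurd (Finset.mem_univ _) h), capCutoff_eq_one he hi.le, sub_self]
  · intro j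
    by_contra h
    obtain ⟨h1, h2⟩ := deriv_capCutoff_supp he _ h
    by_cases hij : j = i
    · subst hij; linarith
    · linarith [hj j hij]

theorem mem_capCompl_of_ne (he : 0 < e) {r : ℝ} (hδ : 0 < δ) (hδ' : δ < 1 / 4) (hδr : 2 * δ ≤ r)
    (hdisj : ∀ i j, i ≠ j → ∀ ψ ∈ bdryM, 1 - 2 * e ≤ ⟪p i, ψ⟫_ℝ → ⟪p j, ψ⟫_ℝ < 1 - 2 * e)
    (hy : y ∈ shell δ)
    (h : ¬ (chi p (capCutoff e) y = 0 ∧ ∀ j, deriv (capCutoff e) (cq (p j) y) = 0)) :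
    y ∈ capCompl p e r := by
  have hM := mem_intM_of_mem_shell hδ hδ' hy
  have h1 := hy.2
  rw [tau] at h1
  refine ⟨by linarith, hM.2.le, fun i => ?_⟩
  by_contra! hi
  refine h (angular_eq_zero he hdisj (ne_zero_of_intM hM) (i := i) ?_)
  rwa [cq_eq, lt_div_iff₀ hM.1]

/-- The test field vanishes outside of a compact set. -/
theorem testX_eq_zero (hv : Function.support v = Set.Ioo 1 2) (he : 0 < e) {r : ℝ} (hδ : 0 < δ)
    (hδ' : δ < 1 / 4) (hδr : 2 * δ ≤ r)
    (hdisj : ∀ i j, i ≠ j → ∀ ψ ∈ bdryM, 1 - 2 * e ≤ ⟪p i, ψ⟫_ℝ → ⟪p j, ψ⟫_ℝ < 1 - 2 * e)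
    (hy : y ∉ shell δ ∩ capCompl p e r) :
    testX Λ p m (capCutoff e) (resc v δ) q g y = 0 := by
  by_cases h : y ∈ shell δ
  · by_cases h' : chi p (capCutoff e) y = 0 ∧ ∀ j, deriv (capCutoff e) (cq (p j) y) = 0
    · exact testX_eq_zero_of_angular h'.1 h'.2
    · exact absurd ⟨h, mem_capCompl_of_ne he hδ hδ' hδr hdisj h h'⟩ hy
  · obtain ⟨h0, h1, h2⟩ := resc_eq_zero hv hδ h
    exact testX_eq_zero_of_radial h0 h1 h2

/-- The radial factor of the obstruction integrand. -/
def radialWt (v : ℝ → ℝ) (δ : ℝ) (y : E4) : ℝ :=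
  (‖y‖ ^ 3 * sT y)⁻¹ * (1 - 2 * tau y ^ 2) * v (tau y / δ)

/-- The density of the obstruction integral. -/
def obsDensity (p : Fin N → E4) (m : Fin N → ℝ) (β v : ℝ → ℝ) (q : E4) (δ : ℝ) (y : E4) : ℝ :=
  radialWt v δ y * obs p m β q y

theorem mu_mul (hy : y ∈ intM) (Λ : ℝ) (m : Fin N → ℝ) (β v : ℝ → ℝ) (q : E4) (δ : ℝ) :
    mu y * (Λ / 3 * √(3 / Λ) * obs p m β q y * ((1 - 2 * tau y ^ 2) * tau y ^ 4 * resc v δ (tau y)))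
      = Λ / 3 * √(3 / Λ) * obsDensity p m β v q δ y := by
  have := tau_pos hy
  have := sT_pos hy
  have := hy.1
  rw [mu, obsDensity, radialWt, resc]
  field_simp

theorem mu_tau_le (hy : y ∈ intM) (h : tau y < 1 / 2) : mu y * tau y ^ 4 ≤ 16 := by
  have h0 := half_lt_norm h
  have h1 := half_lt_sT hy h
  have ht := tau_pos hy
  have e1 : mu y * tau y ^ 4 = (‖y‖ ^ 3 * sT y)⁻¹ := by
    have := hy.1
    have := sT_pos hy
    rw [mu]; field_simp
  have e2 : (1 / 2 : ℝ) ^ 3 * (1 / 2) ≤ ‖y‖ ^ 3 * sT y := by gcongr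
  rw [e1, inv_le_comm₀ (by positivity) (by norm_num)]
  linarith

theorem continuousOn_cq (P : E4) : ContinuousOn (cq P) intM := fun _ hy =>
  (continuousAt_cq P hy).continuousWithinAt

theorem continuous_tau : Continuous tau := continuous_const.sub continuous_norm

theorem continuousOn_radialWt (hv : ContDiff ℝ ∞ v) (δ : ℝ) : ContinuousOn (radialWt v δ) intM := by
  have hs : ContinuousOn sT intM := fun y hy => (continuousAt_sT hy).continuousWithinAt
  have hi : ContinuousOn (fun y : E4 => (‖y‖ ^ 3 * sT y)⁻¹) intM :=
    ((continuous_norm.pow 3).continuousOn.mul hs).inv₀ fun y hy =>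
      (mul_pos (pow_pos hy.1 3) (sT_pos hy)).ne'
  exact (hi.mul (continuous_const.sub (continuous_const.mul (continuous_tau.pow 2))).continuousOn).mul
    (hv.continuous.comp (continuous_tau.div_const δ)).continuousOn

theorem continuousOn_Hc_mul_theta (hH : ContDiff ℝ ∞ (Hc β)) (P q : E4) :
    ContinuousOn (fun y => Hc β (cq P y) * theta P q y) intM :=
  (hH.continuous.comp_continuousOn (continuousOn_cq P)).mul
    (continuousOn_const.sub ((continuousOn_cq P).mul (continuousOn_cq q)))

theorem continuousOn_obsDensity (hH : ContDiff ℝ ∞ (Hc β)) (hv : ContDiff ℝ ∞ v) :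
    ContinuousOn (obsDensity p m β v q δ) intM :=
  (continuousOn_radialWt hv δ).mul (continuousOn_finsetSum _ fun i _ => continuousOn_const.mul
    (continuousOn_Hc_mul_theta hH (p i) q))

open MeasureTheory in
/-- The obstruction integral is small compared to the volume of the shell. -/
theorem abs_integral_obsDensity_le (hΛ : 0 < Λ) (hE : IsEinstein Λ O g) (hO : IsOpen O)
    (he : 0 < e) (he' : e < 1 / 2) (hv : ContDiff ℝ ∞ v) (hvs : Function.support v = Set.Ioo 1 2)
    (hdisj : ∀ i j, i ≠ j → ∀ ψ ∈ bdryM, 1 - 2 * e ≤ ⟪p i, ψ⟫_ℝ → ⟪p j, ψ⟫_ℝ < 1 - 2 * e)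
    {r : ℝ} (hr : 0 < r) (hKO : capCompl p e r ⊆ O ∩ M)
    (herr : (fun x : ℝ × E4 => testErr Λ p m (capCutoff e) (resc v x.1) q g x.2)
      =o[shellF (capCompl p e r)] fun x => tau x.2 ^ (4 : ℝ)) {η : ℝ} (hη : 0 < η) :
    ∀ᶠ δ in 𝓝[>] (0 : ℝ), |∫ y in shell δ, obsDensity p m (capCutoff e) v q δ y|
      ≤ η * volume.real (shell δ) := by
  have hlam : 0 < Λ / 3 * √(3 / Λ) := mul_pos (by positivity) (Real.sqrt_pos.2 (by positivity))
  -- The divisor 16 is the bound on μ τ⁴ from `mu_tau_le`.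
  have hη' : 0 < Λ / 3 * √(3 / Λ) * η / 16 := by positivity
  have hev := eventually_shellF.1 (herr.def hη')
  have hH := contDiff_Hc he he'
  have hβ := contDiff_capCutoff e
  filter_upwards [hev, Ioo_mem_nhdsGT (show (0 : ℝ) < min (1 / 4) (r / 2) by positivity)]
    with δ herrδ ⟨hδ, hδ'⟩
  have hδ4 : δ < 1 / 4 := hδ'.trans_le (min_le_left _ _)
  have hδr : 2 * δ ≤ r := by have := hδ'.trans_le (min_le_right _ _); linarith
  set X := testX Λ p m (capCutoff e) (resc v δ) q g with hX
  set S := shell δ ∩ capCompl p e r with hS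
  have hSc : IsCompact S := (isCompact_shell δ).inter (isCompact_capCompl p e r)
  have hSO : S ⊆ O ∩ intM := fun y hy => ⟨(hKO hy.2).1, mem_intM_of_mem_shell hδ hδ4 hy.1⟩
  have hX0 : ∀ y ∉ S, X y = 0 := fun y hy => testX_eq_zero hvs he hδ hδ4 hδr hdisj hy
  have hX0' : ∀ y ∉ S, X =ᶠ[𝓝 y] fun _ => 0 := fun y hy => by
    filter_upwards [hSc.isClosed.isOpen_compl.mem_nhds hy] with z hz using hX0 z hz
  have hXd : ContDiff ℝ 1 X := contDiff_iff_contDiffAt.2 fun y => by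
    by_cases hy : y ∈ S
    · exact (contDiffAt_testX hE hO (hSO hy) hβ hH (contDiff_resc hv δ)).of_le (by norm_num)
    · exact contDiffAt_const.congr_of_eventuallyEq (hX0' y hy)
  have hXs : HasCompactSupport X := HasCompactSupport.intro hSc hX0
  have hdiv0 : ∀ y ∉ S, divg X y = 0 := fun y hy => by
    rw [divg, (hX0' y hy).fderiv_eq]
    simp [trE]
  have hint := integral_divg_eq_zero hXd hXs
  rw [← setIntegral_eq_integral_of_forall_compl_eq_zero (s := shell δ)
    (fun y hy => hdiv0 y fun h => hy h.1)] at hint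
  have hdc : Continuous (divg X) := by
    have := hXd.continuous_fderiv (by norm_num)
    unfold divg trE
    fun_prop
  have hobs : ContinuousOn (obsDensity p m (capCutoff e) v q δ) (shell δ) :=
    (continuousOn_obsDensity hH hv).mono fun y hy => mem_intM_of_mem_shell hδ hδ4 hy
  have i1 : IntegrableOn (divg X) (shell δ) :=
    hdc.continuousOn.integrableOn_compact (isCompact_shell δ)
  have i2 : IntegrableOn (fun y => Λ / 3 * √(3 / Λ) * obsDensity p m (capCutoff e) v q δ y)
    (shell δ) := (continuousOn_const.mul hobs).integrableOn_compact (isCompact_shell δ)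
  have hb : ‖∫ y in shell δ, (divg X y - Λ / 3 * √(3 / Λ) * obsDensity p m (capCutoff e) v q δ y)‖
      ≤ Λ / 3 * √(3 / Λ) * η * volume.real (shell δ) := by
    refine norm_setIntegral_le_of_norm_le_const (isCompact_shell δ).measure_lt_top fun y hy => ?_
    have hyM := mem_intM_of_mem_shell hδ hδ4 hy
    by_cases h : y ∈ capCompl p e r
    · have hyS : y ∈ S := ⟨hy, h⟩
      rw [hX, divg_testX hΛ hE hO (hSO hyS) hβ hH (contDiff_resc hv δ), mul_add, mu_mul hyM,
        add_sub_cancel_left, norm_mul]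
      have hτ : tau y < 1 / 2 := hy.2.trans_lt (by linarith)
      have hm := mu_tau_le hyM hτ
      have hmu : 0 ≤ mu y := by
        have := tau_pos hyM
        have := sT_pos hyM
        rw [mu]; positivity
      have := herrδ y ⟨h, hyM⟩ hy.1 hy.2
      have e4 : tau y ^ (4 : ℝ) = tau y ^ 4 := by norm_cast
      simp only [e4] at this
      rw [Real.norm_of_nonneg (pow_nonneg (tau_pos hyM).le 4)] at this
      rw [Real.norm_of_nonneg hmu]
      calc _ ≤ mu y * (Λ / 3 * √(3 / Λ) * η / 16 * tau y ^ 4) := by gcongr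
        _ = mu y * tau y ^ 4 * (Λ / 3 * √(3 / Λ) * η / 16) := by ring
        _ ≤ 16 * (Λ / 3 * √(3 / Λ) * η / 16) := by gcongr
        _ = _ := by ring
    -- Inside the caps, where the metric need not be defined, the test field and the obstruction
    -- density both vanish.
    · have h2 : ∀ j, deriv (capCutoff e) (cq (p j) y) = 0 := by
        by_contra h2
        exact h (mem_capCompl_of_ne he hδ hδ4 hδr hdisj hy fun h3 => h2 h3.2)
      rw [hdiv0 y fun h3 => h h3.2, obsDensity, obs_eq_zero h2]
      simp; positivity
  rw [integral_sub i1 i2, hint, zero_sub, norm_neg, integral_const_mul, norm_mul,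
    Real.norm_of_nonneg hlam.le] at hb
  exact le_of_mul_le_mul_left (hb.trans_eq (mul_assoc _ _ _)) hlam

end

end

end SdSGluing

namespace SdSGluing

noncomputable section

/-! # Evaluation of the obstruction integral -/

open MeasureTheory

section

variable {β v : ℝ → ℝ} {δ : ℝ}

theorem setIntegral_shell_comp (R : E4 ≃ₗᵢ[ℝ] E4) (δ : ℝ) (f : E4 → ℝ) :
    ∫ y in shell δ, f (R y) = ∫ y in shell δ, f y := by
  have h := R.measurePreserving.setIntegral_preimage_emb
    R.toHomeomorph.measurableEmbedding f (shell δ)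
  have e : R ⁻¹' shell δ = shell δ := by
    ext y; simp [shell, tau]
  rw [← h]
  congr 2
  exact e.symm

theorem tau_map (R : E4 ≃ₗᵢ[ℝ] E4) (y : E4) : tau (R y) = tau y := by simp [tau]

theorem cq_map (R : E4 ≃ₗᵢ[ℝ] E4) (q y : E4) : cq (R q) (R y) = cq q y := by
  have : psi (R y) = R (psi y) := by simp [psi]
  rw [cq, this, R.inner_map_map, cq]

theorem radialWt_map (R : E4 ≃ₗᵢ[ℝ] E4) (v : ℝ → ℝ) (δ : ℝ) (y : E4) :
    radialWt v δ (R y) = radialWt v δ y := by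
  simp [radialWt, tau_map, sT]

/-- The normalization of the obstruction integral. -/
def obsNorm (β v : ℝ → ℝ) (δ : ℝ) (p : E4) : ℝ :=
  ∫ y in shell δ, radialWt v δ y * (Hc β (cq p y) * (1 - cq p y ^ 2))

/-- The reflection in the hyperplane bisecting p and p' exchanges them and preserves shell, measure
and radial weight. -/
theorem obsNorm_eq {p p' : E4} (h : ‖p‖ = ‖p'‖) : obsNorm β v δ p = obsNorm β v δ p' := by
  set R : E4 ≃ₗᵢ[ℝ] E4 := (ℝ ∙ (p - p'))ᗮ.reflection
  have hR : R p = p' := Submodule.reflection_sub h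
  rw [obsNorm, obsNorm, ← setIntegral_shell_comp R δ fun y =>
    radialWt v δ y * (Hc β (cq p' y) * (1 - cq p' y ^ 2))]
  simp only [← hR, radialWt_map, cq_map]

theorem integrableOn_shell {f : E4 → ℝ} (hf : ContinuousOn f intM) (h0 : 0 < δ) (h1 : δ < 1 / 4) :
    IntegrableOn f (shell δ) :=
  (hf.mono fun _ hy => mem_intM_of_mem_shell h0 h1 hy).integrableOn_compact (isCompact_shell δ)

/-- Split q into its multiple of p and the orthogonal part q'. The reflection along q' fixes p and
reverses the sign of ⟨q', ψ⟩, so the contribution of q' integrates to zero. -/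
theorem integral_theta (hH : ContDiff ℝ ∞ (Hc β)) (hv : ContDiff ℝ ∞ v) (h0 : 0 < δ) (h1 : δ < 1 / 4)
    {p : E4} (hp : ‖p‖ = 1) (q : E4) :
    ∫ y in shell δ, radialWt v δ y * (Hc β (cq p y) * theta p q y) =
      ⟪p, q⟫_ℝ * obsNorm β v δ p := by
  set q' := q - ⟪p, q⟫_ℝ • p with hq'
  set R : E4 ≃ₗᵢ[ℝ] E4 := (ℝ ∙ q')ᗮ.reflection
  have hRq : R q' = -q' := Submodule.reflection_orthogonalComplement_singleton_eq_neg q'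
  have hpq : ⟪q', p⟫_ℝ = 0 := by
    rw [hq', inner_sub_left, inner_smul_left, real_inner_self_eq_norm_sq, hp, real_inner_comm]
    simp
  have hRp : R p = p := Submodule.reflection_mem_subspace_eq_self
    (Submodule.mem_orthogonal_singleton_iff_inner_right.2 hpq)
  have hodd : ∫ y in shell δ, radialWt v δ y * (Hc β (cq p y) * (cq p y * cq q' y)) = 0 := by
    have h := setIntegral_shell_comp R δ fun y =>
      radialWt v δ y * (Hc β (cq p y) * (cq p y * cq q' y))
    have e : ∀ y, cq q' (R y) = -cq q' y := fun y => by
      have h1 := cq_map R q' y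
      rw [hRq] at h1
      rw [← h1, cq, cq, inner_neg_left, neg_neg]
    have e' : ∀ y, cq p (R y) = cq p y := fun y => by
      have h1 := cq_map R p y
      rwa [hRp] at h1
    simp only [e, e', radialWt_map, mul_neg, integral_neg] at h
    linarith
  have hc : ∀ y, cq q y = cq q' y + ⟪p, q⟫_ℝ * cq p y := fun y => by
    simp only [hq', cq, inner_sub_left, inner_smul_left]
    simp
  have e : ∀ y, radialWt v δ y * (Hc β (cq p y) * theta p q y) =
      ⟪p, q⟫_ℝ * (radialWt v δ y * (Hc β (cq p y) * (1 - cq p y ^ 2)))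
        - radialWt v δ y * (Hc β (cq p y) * (cq p y * cq q' y)) := fun y => by
    rw [theta, hc]; ring
  have cH : ContinuousOn (fun y => Hc β (cq p y)) intM :=
    hH.continuous.comp_continuousOn (continuousOn_cq p)
  have cW := continuousOn_radialWt hv δ
  have i1 := integrableOn_shell (cW.mul (cH.mul (continuousOn_const.sub
    ((continuousOn_cq p).pow 2)))) h0 h1 (f := fun y => radialWt v δ y *
      (Hc β (cq p y) * (1 - cq p y ^ 2)))
  have i2 := integrableOn_shell (cW.mul (cH.mul ((continuousOn_cq p).mul (continuousOn_cq q'))))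
    h0 h1 (f := fun y => radialWt v δ y * (Hc β (cq p y) * (cq p y * cq q' y)))
  simp only [e]
  rw [integral_sub (i1.const_mul _) i2, hodd, sub_zero, integral_const_mul, obsNorm]

/-- All unit vectors share one normalization by `obsNorm_eq`, so it factors out of the sum over i.
-/
theorem integral_obsDensity {N : ℕ} {p : Fin N → E4} (m : Fin N → ℝ) (hH : ContDiff ℝ ∞ (Hc β))
    (hv : ContDiff ℝ ∞ v) (h0 : 0 < δ) (h1 : δ < 1 / 4) (hp : ∀ i, ‖p i‖ = 1) (q : E4)
    {p₀ : E4} (hp₀ : ‖p₀‖ = 1) :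
    ∫ y in shell δ, obsDensity p m β v q δ y = ⟪∑ i, m i • p i, q⟫_ℝ * obsNorm β v δ p₀ := by
  have e : ∀ y, obsDensity p m β v q δ y =
      ∑ i, m i * (radialWt v δ y * (Hc β (cq (p i) y) * theta (p i) q y)) := fun y => by
    rw [obsDensity, obs, Finset.mul_sum]
    exact Finset.sum_congr rfl fun i _ => by ring
  simp only [e]
  have hi : ∀ i, IntegrableOn (fun y => radialWt v δ y * (Hc β (cq (p i) y) * theta (p i) q y))
    (shell δ) := fun i => integrableOn_shell ((continuousOn_radialWt hv δ).mul
    (continuousOn_Hc_mul_theta hH (p i) q)) h0 h1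
  rw [integral_finsetSum _ fun i _ => (hi i).const_mul (m i)]
  simp only [integral_const_mul, integral_theta hH hv h0 h1 (hp _), sum_inner, inner_smul_left,
    Finset.sum_mul]
  refine Finset.sum_congr rfl fun i _ => ?_
  rw [obsNorm_eq ((hp i).trans hp₀.symm)]
  simp
  ring

/-- The shell lies between two concentric balls, and (1 - δ)⁴ - (1 - 2δ)⁴ ≤ 4δ. -/
theorem volume_shell_le (h0 : 0 < δ) (h1 : δ < 1 / 4) :
    volume.real (shell δ) ≤ 4 * δ * volume.real (Metric.ball (0 : E4) 1) := by
  have hsub : shell δ ⊆ Metric.closedBall (0 : E4) (1 - δ) \ Metric.ball 0 (1 - 2 * δ) := fun y hy => by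
    have a1 := hy.1
    have a2 := hy.2
    rw [tau] at a1 a2
    refine ⟨by simp; linarith, by simp; linarith⟩
  have hfin : volume (Metric.closedBall (0 : E4) (1 - δ) \ Metric.ball 0 (1 - 2 * δ)) ≠ ⊤ :=
    ((measure_mono Set.sdiff_subset).trans_lt measure_closedBall_lt_top).ne
  refine (measureReal_mono hsub hfin).trans ?_
  have hball : volume.real (Metric.ball (0 : E4) (1 - 2 * δ)) =
      (1 - 2 * δ) ^ Module.finrank ℝ E4 * volume.real (Metric.ball (0 : E4) 1) := by
    have h2 : 0 ≤ 1 - 2 * δ := by linarith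
    rw [measureReal_def, Measure.addHaar_ball _ _ h2, ENNReal.toReal_mul,
      ENNReal.toReal_ofReal (pow_nonneg h2 _), measureReal_def]
  rw [measureReal_sdiff (Metric.ball_subset_closedBall.trans
    (Metric.closedBall_subset_closedBall (by linarith))) measurableSet_ball
    (h₁ := measure_closedBall_lt_top.ne), Measure.addHaar_real_closedBall _ _ (by linarith),
    hball, ← sub_mul]
  have hd : Module.finrank ℝ E4 = 4 := by simp [E4]
  rw [hd]
  refine mul_le_mul_of_nonneg_right ?_ measureReal_nonneg
  nlinarith [pow_pos h0 2, pow_pos h0 3, pow_pos h0 4]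

/-- The integral of a homogeneous function of degree zero over a ball. -/
theorem setIntegral_closedBall_of_homogeneous {f : E4 → ℝ} (hf : ∀ r : ℝ, 0 < r → ∀ y, f (r • y) = f y)
    {r : ℝ} (hr : 0 < r) :
    ∫ y in Metric.closedBall 0 r, f y = r ^ 4 * ∫ y in Metric.closedBall 0 1, f y := by
  have h := Measure.setIntegral_comp_smul (volume : Measure E4) f hr.ne'
    (s := Metric.closedBall (0 : E4) 1)
  have hd : Module.finrank ℝ E4 = 4 := by simp [E4]
  rw [smul_closedBall _ _ zero_le_one, smul_zero, mul_one, Real.norm_of_nonneg hr.le, hd] at h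
  simp only [hf r hr] at h
  rw [h, abs_of_pos (by positivity), smul_eq_mul]
  field_simp

theorem cq_smul {r : ℝ} (hr : 0 < r) (q y : E4) : cq q (r • y) = cq q y := by
  rw [cq_eq, cq_eq, inner_smul_right, norm_smul, Real.norm_of_nonneg hr.le,
    mul_div_mul_left _ _ hr.ne']

/-- The sphere of radius 1/2 is connected and contains ±p/2, where the values are ±1. -/
theorem exists_cq_eq {p : E4} (hp : ‖p‖ = 1) {c : ℝ} (hc : -1 ≤ c) (hc' : c ≤ 1) :
    ∃ y ∈ intM, cq p y = c := by
  have hpre : IsPreconnected (Metric.sphere (0 : E4) (1 / 2)) :=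
    isPreconnected_sphere (by
      rw [← Module.finrank_eq_rank, show Module.finrank ℝ E4 = 4 by simp [E4]]
      norm_num) _ _
  have hsub : Metric.sphere (0 : E4) (1 / 2) ⊆ intM := fun y hy => by
    rw [mem_sphere_zero_iff_norm] at hy
    exact ⟨by rw [hy]; norm_num, by rw [hy]; norm_num⟩
  have hm : ∀ s : ℝ, |s| = 1 / 2 → s • p ∈ Metric.sphere (0 : E4) (1 / 2) := fun s hs => by
    rw [mem_sphere_zero_iff_norm, norm_smul, hp, Real.norm_eq_abs, hs, mul_one]
  have hcs : ∀ s : ℝ, |s| = 1 / 2 → cq p (s • p) = 2 * s := fun s hs => by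
    rw [cq_eq, inner_smul_right, real_inner_self_eq_norm_sq, norm_smul, hp, Real.norm_eq_abs, hs]
    norm_num
    ring
  have a1 : |(-(1 / 2) : ℝ)| = 1 / 2 := by norm_num [abs_of_pos]
  have a2 : |(1 / 2 : ℝ)| = 1 / 2 := by norm_num [abs_of_pos]
  obtain ⟨y, hy, h⟩ := hpre.intermediate_value (hm _ a1) (hm _ a2)
    ((continuousOn_cq p).mono hsub) (show c ∈ Set.Icc _ _ by
      rw [hcs _ a1, hcs _ a2]; constructor <;> linarith)
  exact ⟨y, hsub hy, h⟩

theorem measurable_cq (p : E4) : Measurable (cq p) := by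
  have : cq p = fun y => ⟪p, y⟫_ℝ / ‖y‖ := funext (cq_eq p)
  rw [this]
  exact (continuous_const.inner continuous_id).measurable.div measurable_norm

/-- The angular weight of the normalization. -/
def angWt (β : ℝ → ℝ) (p y : E4) : ℝ := Hc β (cq p y) * (1 - cq p y ^ 2)

theorem abs_cq_le' (q y : E4) : |cq q y| ≤ ‖q‖ := by
  rw [cq_eq, abs_div, abs_norm]
  exact div_le_of_le_mul₀ (norm_nonneg y) (norm_nonneg q) (abs_real_inner_le_norm q y)

theorem angWt_nonneg (hβ : ∀ c, 0 ≤ Hc β c) {p : E4} (hp : ‖p‖ = 1) (y : E4) : 0 ≤ angWt β p y := by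
  have h := abs_le.1 (abs_cq_le' p y)
  rw [hp] at h
  exact mul_nonneg (hβ _) (by nlinarith [h.1, h.2])

theorem integrableOn_angWt (hH : ContDiff ℝ ∞ (Hc β)) (p : E4) (r : ℝ) :
    IntegrableOn (angWt β p) (Metric.closedBall 0 r) := by
  have hc : Continuous fun c : ℝ => Hc β c * (1 - c ^ 2) :=
    hH.continuous.mul (continuous_const.sub (continuous_pow 2))
  obtain ⟨C, hC⟩ := (isCompact_Icc (a := -‖p‖) (b := ‖p‖)).exists_bound_of_continuousOn
    hc.continuousOn
  refine Measure.integrableOn_of_bounded (M := C) measure_closedBall_lt_top.ne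
    (hc.measurable.comp (measurable_cq p)).aestronglyMeasurable
    (Filter.Eventually.of_forall fun y => ?_)
  exact hC _ (abs_le.1 (abs_cq_le' p y))

/-- The integrand is nonnegative and continuous on the punctured ball, and it is positive at a point
with ⟨p, ψ⟩ = c, hence on a nonempty open set. -/
theorem integral_angWt_pos (hH : ContDiff ℝ ∞ (Hc β)) (hβ : ∀ c, 0 ≤ Hc β c) {c : ℝ} (hc : -1 < c)
    (hc' : c < 1) (hpos : 0 < Hc β c) {p : E4} (hp : ‖p‖ = 1) :
    0 < ∫ y in Metric.closedBall (0 : E4) 1, angWt β p y := by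
  rw [setIntegral_pos_iff_support_of_nonneg_ae
    (Filter.Eventually.of_forall fun y => angWt_nonneg hβ hp y) (integrableOn_angWt hH p 1)]
  have hcont : ContinuousOn (angWt β p) intM :=
    (hH.continuous.comp_continuousOn (continuousOn_cq p)).mul
      (continuousOn_const.sub ((continuousOn_cq p).pow 2))
  have hopen : IsOpen (intM ∩ angWt β p ⁻¹' Set.Ioi 0) :=
    hcont.isOpen_inter_preimage isOpen_intM isOpen_Ioi
  have hne : (intM ∩ angWt β p ⁻¹' Set.Ioi 0).Nonempty := by
    obtain ⟨y, hy, h⟩ := exists_cq_eq hp hc.le hc'.le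
    refine ⟨y, hy, ?_⟩
    rw [Set.mem_preimage, angWt, h, Set.mem_Ioi]
    exact mul_pos hpos (by nlinarith)
  refine (hopen.measure_pos volume hne).trans_le (measure_mono fun y hy => ⟨?_, ?_⟩)
  · exact (Set.mem_Ioi.1 hy.2).ne'
  · simpa using hy.1.2.le

theorem radialWt_ge (h0 : 0 < δ) (h1 : δ < 1 / 4) (hv0 : ∀ t, 0 ≤ v t) {y : E4} (hy : y ∈ shell δ) :
    v (tau y / δ) / 2 ≤ radialWt v δ y := by
  have hM := mem_intM_of_mem_shell h0 h1 hy
  have ht := tau_pos hM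
  have ht' : tau y ≤ 1 / 2 := by linarith [hy.2]
  have hs := sT_pos hM
  have e1 : 1 ≤ (‖y‖ ^ 3 * sT y)⁻¹ :=
    (one_le_inv₀ (mul_pos (pow_pos hM.1 3) hs)).2
      (mul_le_one₀ (pow_le_one₀ hM.1.le hM.2.le) hs.le (sT_le_one y))
  have e2 : 1 / 2 ≤ 1 - 2 * tau y ^ 2 := by nlinarith
  have := hv0 (tau y / δ)
  calc v (tau y / δ) / 2 = 1 * (1 / 2) * v (tau y / δ) := by ring
    _ ≤ _ := by rw [radialWt]; gcongr

/-- The normalization of the obstruction integral is bounded below by a multiple of the volume of the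
shell. -/
theorem exists_obsNorm_ge (hH : ContDiff ℝ ∞ (Hc β)) (hβ : ∀ c, 0 ≤ Hc β c) {c : ℝ} (hc : -1 < c)
    (hc' : c < 1) (hpos : 0 < Hc β c) (hv : ContDiff ℝ ∞ v) (hv0 : ∀ t, 0 ≤ v t)
    (hvs : Function.support v = Set.Ioo 1 2) {p : E4} (hp : ‖p‖ = 1) :
    ∃ κ : ℝ, 0 < κ ∧ ∀ δ, 0 < δ → δ < 1 / 4 → κ * δ ≤ obsNorm β v δ p := by
  obtain ⟨t₀, ht₀, hmin⟩ := (isCompact_Icc (a := (5 / 4 : ℝ)) (b := 7 / 4)).exists_isMinOn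
    ⟨5 / 4, by norm_num, by norm_num⟩ hv.continuous.continuousOn
  have hvt : 0 < v t₀ := (hv0 t₀).lt_of_ne' (by
    have : t₀ ∈ Function.support v := by rw [hvs]; exact ⟨by linarith [ht₀.1], by linarith [ht₀.2]⟩
    exact this)
  have hI := integral_angWt_pos hH hβ hc hc' hpos hp
  set I := ∫ y in Metric.closedBall (0 : E4) 1, angWt β p y
  refine ⟨v t₀ / 2 * (1 / 16 * I), by positivity, fun δ h0 h1 => ?_⟩
  -- On this inner layer τ/δ lies in [5/4, 7/4], compactly inside the support of v, so v is bounded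
  -- below by its minimum v t₀.
  set Q := Metric.closedBall (0 : E4) (1 - 5 / 4 * δ) \ Metric.closedBall 0 (1 - 7 / 4 * δ)
  have hQτ : ∀ y ∈ Q, 5 / 4 * δ ≤ tau y ∧ tau y ≤ 7 / 4 * δ := fun y hy => by
    have a1 := hy.1
    have a2 := hy.2
    simp only [Metric.mem_closedBall, dist_zero_right, not_le] at a1 a2
    rw [tau]; constructor <;> linarith
  have hQ : Q ⊆ shell δ := fun y hy => by
    obtain ⟨a, b⟩ := hQτ y hy
    exact ⟨by linarith, by linarith⟩
  have hcW : ContinuousOn (fun y => radialWt v δ y * angWt β p y) intM :=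
    (continuousOn_radialWt hv δ).mul ((hH.continuous.comp_continuousOn (continuousOn_cq p)).mul
      (continuousOn_const.sub ((continuousOn_cq p).pow 2)))
  have hint := integrableOn_shell hcW h0 h1
  have hmeas : MeasurableSet Q := measurableSet_closedBall.diff measurableSet_closedBall
  have hsm : MeasurableSet (shell δ) := (isCompact_shell δ).isClosed.measurableSet
  have s1 : ∫ y in Q, radialWt v δ y * angWt β p y ≤ obsNorm β v δ p :=
    setIntegral_mono_set hint ((ae_restrict_iff' hsm).2 (Filter.Eventually.of_forall fun y hy =>
      mul_nonneg (le_trans (by have := hv0 (tau y / δ); positivity) (radialWt_ge h0 h1 hv0 hy))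
        (angWt_nonneg hβ hp y))) (Filter.Eventually.of_forall hQ)
  have iQ : IntegrableOn (angWt β p) Q := (integrableOn_angWt hH p _).mono_set Set.sdiff_subset
  have s2 : ∫ y in Q, v t₀ / 2 * angWt β p y ≤ ∫ y in Q, radialWt v δ y * angWt β p y := by
    refine setIntegral_mono_on (iQ.const_mul _) (hint.mono_set hQ) hmeas fun y hy => ?_
    refine mul_le_mul_of_nonneg_right (le_trans ?_ (radialWt_ge h0 h1 hv0 (hQ hy)))
      (angWt_nonneg hβ hp y)
    obtain ⟨a, b⟩ := hQτ y hy
    have : v t₀ ≤ v (tau y / δ) := hmin ⟨(le_div_iff₀ h0).2 a, (div_le_iff₀ h0).2 b⟩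
    linarith
  have hhom : ∀ r : ℝ, 0 < r → ∀ y, angWt β p (r • y) = angWt β p y := fun r hr y => by
    rw [angWt, angWt, cq_smul hr]
  -- The angular weight is homogeneous of degree zero, so its integral over a ball scales like the
  -- fourth power of the radius.
  have s3 : ∫ y in Q, angWt β p y = ((1 - 5 / 4 * δ) ^ 4 - (1 - 7 / 4 * δ) ^ 4) * I := by
    rw [setIntegral_sdiff measurableSet_closedBall (integrableOn_angWt hH p _)
      (Metric.closedBall_subset_closedBall (by linarith)),
      setIntegral_closedBall_of_homogeneous hhom (r := 1 - 5 / 4 * δ) (by linarith),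
      setIntegral_closedBall_of_homogeneous hhom (r := 1 - 7 / 4 * δ) (by linarith), sub_mul]
  have s4 : 1 / 16 * δ ≤ (1 - 5 / 4 * δ) ^ 4 - (1 - 7 / 4 * δ) ^ 4 := by
    have e : (1 - 5 / 4 * δ) ^ 4 - (1 - 7 / 4 * δ) ^ 4 = δ / 2 * ((1 - 5 / 4 * δ + (1 - 7 / 4 * δ))
      * ((1 - 5 / 4 * δ) ^ 2 + (1 - 7 / 4 * δ) ^ 2)) := by ring
    have e1 : (1 / 2 : ℝ) ≤ 1 - 5 / 4 * δ := by linarith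
    have e2 : (1 / 2 : ℝ) ≤ 1 - 7 / 4 * δ := by linarith
    have e3 : (1 / 2 : ℝ) ^ 2 ≤ (1 - 5 / 4 * δ) ^ 2 := by gcongr
    have e4 : (1 / 2 + 1 / 2 : ℝ) * ((1 / 2) ^ 2 + 0) ≤ (1 - 5 / 4 * δ + (1 - 7 / 4 * δ))
      * ((1 - 5 / 4 * δ) ^ 2 + (1 - 7 / 4 * δ) ^ 2) := by gcongr; positivity
    rw [e]
    nlinarith
  rw [integral_const_mul, s3] at s2
  calc v t₀ / 2 * (1 / 16 * I) * δ = v t₀ / 2 * (1 / 16 * δ * I) := by ring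
    _ ≤ v t₀ / 2 * (((1 - 5 / 4 * δ) ^ 4 - (1 - 7 / 4 * δ) ^ 4) * I) := by gcongr
    _ ≤ _ := s2.trans s1

end

end

end SdSGluing

theorem theorem3p4 (Λ : ℝ) (hΛ : 0 < Λ) (N : ℕ)
    -- the points and masses
    (p : Fin N → E4) (hp : ∀ i, p i ∈ bdryM) (hpinj : Function.Injective p) (m : Fin N → ℝ)
    -- the punctured balls around the points
    (V : Fin N → Set E4) (hVball : ∀ i, ∃ ρ > 0, V i = puncturedBall (p i) ρ)
    (hVU : ∀ i, V i ⊆ Udom (p i))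
    (hVdisj : Pairwise fun i j => Disjoint (closure (V i)) (closure (V j)))
    -- the neighborhood `U = O ∩ M` of the boundary without the points
    (O : Set E4) (hO : IsOpen O) (hOp : bdryM \ Set.range p ⊆ O)
    -- the metric
    (g : E4 → Bil) (hEin : IsEinstein Λ O g)
    (hSdS : ∀ i, ∀ᶠ y in 𝓝ˢ (V i), y ∈ O ∩ intM → g y = sds Λ (p i) (m i) y)
    (ε : ℝ) (hε : 0 < ε)
    (hasymp : ∃ a b c : E4 → Bil, IsSmooth0Section O a ∧ IsSmooth0Section O b ∧
      IsConormal0Section O (3 + ε) c ∧ ∀ y ∈ O ∩ intM,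
        g y - deSitter Λ y = (tau y ^ 3 * Real.log (tau y)) • a y + tau y ^ 3 • b y + c y) :
    IsBalanced p m := by
  have hn : ∀ i, ‖p i‖ = 1 := fun i => by simpa [bdryM] using hp i
  obtain ⟨e, he, he', hcap, hdisj⟩ := exists_cap hp hpinj hVball
  obtain ⟨r, hr, -, hKO⟩ := exists_capCompl_subset hp hO hOp he
  obtain ⟨v, hv, hv0, hvs⟩ := exists_bump
  have hβ := contDiff_capCutoff e
  have hH := contDiff_Hc he (show e < 1 / 2 by linarith)
  obtain ⟨C, hC⟩ := bounds_of_asymptotics hε hO hasymp (isCompact_capCompl p e r) hKO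
  -- Any unit vector serves as reference for the normalization, even when there are no points.
  have hp₀ : ‖ev 0‖ = 1 := norm_ev 0
  obtain ⟨c, hc1, hc2, hc⟩ := exists_deriv_capCutoff_pos he
  have hHc : 0 < Hc (capCutoff e) c :=
    mul_pos hc (inv_pos.2 (pow_pos (Real.sqrt_pos.2 (by nlinarith)) 3))
  obtain ⟨κ, hκ, hnorm⟩ := exists_obsNorm_ge hH (Hc_nonneg he) (by linarith) (by linarith) hHc hv hv0
    hvs hp₀
  refine ⟨hpinj, ext_inner_right ℝ fun q => ?_⟩
  rw [inner_zero_left]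
  have herr := KBound.testErr_isLittleO (m := m) (q := q) hC hΛ hEin hO hKO hβ hv fun i => by
    obtain ⟨r', hr', hg⟩ := exists_eq_sds (hcap i) (hSdS i)
    exact annAsymp_of_eq_sds hΛ hβ (hn i) (show 0 < 1 - 2 * e by linarith)
      (show 1 - e < 1 by linarith) hr' (deriv_capCutoff_supp he)
      fun y hy => hg y ⟨(hKO hy.1).1, hy.2⟩
  set B := MeasureTheory.volume.real (Metric.ball (0 : E4) 1)
  have hB : 0 ≤ B := MeasureTheory.measureReal_nonneg
  by_contra hS
  have hS' := abs_pos.2 hS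
  set S := |⟪∑ i, m i • p i, q⟫_ℝ|
  -- With shell volume at most 4δB, this η bounds the obstruction integral by S κ δ B/(2(B + 1)),
  -- strictly below its lower bound S κ δ.
  have hη : 0 < S * κ / (8 * (B + 1)) := by positivity
  obtain ⟨δ, hδ, hδ0, hδ1⟩ := ((abs_integral_obsDensity_le hΛ hEin hO he (by linarith) hv hvs hdisj hr
    hKO herr hη).and (Ioo_mem_nhdsGT (show (0 : ℝ) < 1 / 4 by norm_num))).exists
  have hJ := hnorm δ hδ0 hδ1
  rw [integral_obsDensity m hH hv hδ0 hδ1 hn q hp₀, abs_mul,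
    abs_of_nonneg ((mul_pos hκ hδ0).le.trans hJ)] at hδ
  have h1 : S * (κ * δ) ≤ S * κ / (8 * (B + 1)) * (4 * δ * B) :=
    (mul_le_mul_of_nonneg_left hJ hS'.le).trans (hδ.trans
      (mul_le_mul_of_nonneg_left (volume_shell_le hδ0 hδ1) hη.le))
  have h2 : S * κ / (8 * (B + 1)) * (4 * δ * B) = S * (κ * δ) * (B / (2 * (B + 1))) := by
    field_simp
    ring
  have h3 : B / (2 * (B + 1)) < 1 := by
    rw [div_lt_one (by positivity)]; linarith
  have h4 : 0 < S * (κ * δ) := by positivity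
  nlinarith
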